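/- Conventions: Hilbert spaces are complex, and $M_n$ is the algebra of complex $n\times n$ matrices, identified with the bounded operators on $\mathbb{C}^n$ with its Euclidean inner product. A bounded operator $S$ on a Hilbert space $K$ is a dilation of a bounded operator $T$ on a Hilbert space $H$ (and $T$ is a compression of $S$) if there is a linear map $X:H\to K$ with $X^*X=I_H$ and $X^*SX=T$; it is a unitary dilation if moreover $S$ is unitary. A contraction is an operator $T$ with $\|T\|\le 1$. For $C\in M_n$ and a bounded operator $T$ on a Hilbert space $H$ with $\dim H\ge n$ (possibly infinite), the $C$-numerical range of $T$ is $$W_C(T)=\{\operatorname{tr}(CY): Y\in M_n \text{ is a compression of } T\}\subseteq\mathbb{C},$$ and $\mathbf{cl}$ denotes closure in $\mathbb{C}$. Theorem. Let $n\ge 2$ and let $C\in M_n$ be nonzero. The following conditions are equivalent. (a) $C$ is a rank-one normal matrix. (b) For every contraction $T$ on a Hilbert space $H$ with $\dim H\ge n$, $$\mathbf{cl}(W_C(T))=\bigcap\{\mathbf{cl}(W_C(U)): U \text{ is a unitary dilation of } T\}.$$ (c) For every rank-one nilpotent contraction $T\in M_n$, $$W_C(T)=\bigcap\{W_C(U):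 U \text{ is a unitary dilation of } T\}.$$ -/

import Mathlib

universe u

noncomputable section

/-- `S ∈ B(K)` is a dilation of `T ∈ B(H)` (equivalently, `T` is a compression of `S`): there is a
linear isometry `X : H → K`, that is `X* X = I_H`, with `X* S X = T`. -/
def IsDilation {H : Type*} [NormedAddCommGroup H] [InnerProductSpace ℂ H] [CompleteSpace H]
    {K : Type*} [NormedAddCommGroup K] [InnerProductSpace ℂ K] [CompleteSpace K]
    (S : K →L[ℂ] K) (T : H →L[ℂ] H) : Prop :=
  ∃ X : H →ₗᵢ[ℂ] K,
    (ContinuousLinearMap.adjoint X.toContinuousLinearMap).comp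
      (S.comp X.toContinuousLinearMap) = T

/-- `U ∈ B(K)` is a unitary dilation of `T ∈ B(H)`. -/
def IsUnitaryDilation {H : Type*} [NormedAddCommGroup H] [InnerProductSpace ℂ H] [CompleteSpace H]
    {K : Type*} [NormedAddCommGroup K] [InnerProductSpace ℂ K] [CompleteSpace K]
    (U : K →L[ℂ] K) (T : H →L[ℂ] H) : Prop :=
  U ∈ unitary (K →L[ℂ] K) ∧ IsDilation U T

/-- A complex `n × n` matrix, as an operator on the Hilbert space `ℂⁿ`. -/
def matrixOp {n : ℕ} (A : Matrix (Fin n) (Fin n) ℂ) :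
    EuclideanSpace ℂ (Fin n) →L[ℂ] EuclideanSpace ℂ (Fin n) :=
  Matrix.toEuclideanCLM (𝕜 := ℂ) (n := Fin n) A

/-- The `C`-numerical range `W_C(T) = {tr(C Y) : Y ∈ M_n is a compression of T}`. -/
def cNumericalRange {n : ℕ} (C : Matrix (Fin n) (Fin n) ℂ)
    {H : Type*} [NormedAddCommGroup H] [InnerProductSpace ℂ H] [CompleteSpace H]
    (T : H →L[ℂ] H) : Set ℂ :=
  {z | ∃ Y : Matrix (Fin n) (Fin n) ℂ, IsDilation T (matrixOp Y) ∧ z = (C * Y).trace}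

end

/-!
For an orthonormal eigenbasis of a normal matrix `C` with eigenvalues `c`, the points of `W_C(T)`
are the sums `∑ c_i ⟨x_i, T x_i⟩` over orthonormal families `x`.

If `C` is rank-one normal, this is a multiple of the classical numerical range `W(T)`, which is
convex by the Toeplitz–Hausdorff theorem (`convex_numericalRangeOn`). The dilation formula then
amounts to the following: if `W(T)` lies strictly inside a half plane, some unitary dilation of
the contraction `T` has its numerical range in the corresponding half plane. When the half plane
cuts the unit disc, an explicit dilation on `H ⊕ H` does this (`exists_unitaryDilation_re_le`),
and otherwise every unitary dilation will do (`exists_unitaryDilation`). In finite dimension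
`W(T)` is compact, so closures may be dropped (`cNumericalRange_eq_of_diagonal`).

For all other nonzero `C` there is a *gap* (`HasDilationGap`): a rank-one nilpotent contraction
`T` and one point `z` outside a disc containing `W_C(T)` that belongs to `W_C(U)` for all unitary
dilations `U` of `T`. This contradicts both dilation formulas. The gap comes from two sources.

* Local surjectivity: rotating one vector of an isometry `X` with `X* U X = T` moves
  `tr (C X* U X)`, and if the first order term of this variation is nondegenerate, a disc of controlled radius
  is covered (`mem_cNumericalRange_of_nondegenerate`). This settles nonnormal `C`
  (`hasDilationGap_of_not_isStarNormal`) and `C` with real eigenvalues whose extreme eigenvalues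
  do not vanish (`hasDilationGap_of_extreme_ne_zero`).
* Minkowski sums: eigenvectors for two eigenvalues may range over two orthogonal subspaces, and
  the resulting sum of two numerical ranges is convex (`mem_cNumericalRange_of_forall_re_le`).
  Together with local surjectivity, which allows one to assume that `U²` is nearly scalar on the
  relevant vectors, this settles normal `C` with two eigenvalues of nonreal ratio
  (`hasDilationGap_of_im_ne_zero`). It also settles semidefinite singular `C` of rank at least two
  (`hasDilationGap_of_extreme_eq_zero`), where `U` shifts an orthonormal triple.

Up to a scalar factor this exhausts all cases (`hasDilationGap_of_ne_rankOne_normal`).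
-/

open scoped InnerProductSpace

universe w

/-! ### Compressions and the trace form of the `C`-numerical range -/

section Basics

variable {n : ℕ} {H : Type*} [NormedAddCommGroup H] [InnerProductSpace ℂ H] [CompleteSpace H]
  {K : Type*} [NormedAddCommGroup K] [InnerProductSpace ℂ K] [CompleteSpace K]

theorem inner_self_eq_ofReal_norm_sq {E : Type*} [NormedAddCommGroup E] [InnerProductSpace ℂ E]
    (x : E) : ⟪x, x⟫_ℂ = ((‖x‖ ^ 2 : ℝ) : ℂ) := by
  rw [inner_self_eq_norm_sq_to_K]
  simp

theorem isDilation_iff {S : K →L[ℂ] K} {T : H →L[ℂ] H} :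
    IsDilation S T ↔ ∃ X : H →ₗᵢ[ℂ] K, ∀ h k, ⟪X h, S (X k)⟫_ℂ = ⟪h, T k⟫_ℂ := by
  refine exists_congr fun X => ⟨fun hX h k => ?_, fun hX => ?_⟩
  · rw [← hX]
    simp [ContinuousLinearMap.adjoint_inner_right]
  · ext k
    refine ext_inner_left ℂ fun h => ?_
    rw [← hX h k]
    simp [ContinuousLinearMap.adjoint_inner_right]

theorem IsDilation.trans {L : Type*} [NormedAddCommGroup L] [InnerProductSpace ℂ L]
    [CompleteSpace L] {R : L →L[ℂ] L} {S : K →L[ℂ] K} {T : H →L[ℂ] H}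
    (h₁ : IsDilation R S) (h₂ : IsDilation S T) : IsDilation R T := by
  rw [isDilation_iff] at *
  obtain ⟨X, hX⟩ := h₁
  obtain ⟨Y, hY⟩ := h₂
  exact ⟨X.comp Y, fun h k => by simp [hX, hY]⟩

theorem cNumericalRange_mono (C : Matrix (Fin n) (Fin n) ℂ) {S : K →L[ℂ] K} {T : H →L[ℂ] H}
    (h : IsDilation S T) : cNumericalRange C T ⊆ cNumericalRange C S := by
  rintro z ⟨Y, hY, rfl⟩
  exact ⟨Y, h.trans hY, rfl⟩

theorem trace_matrixOp (A : Matrix (Fin n) (Fin n) ℂ) :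
    LinearMap.trace ℂ _ (matrixOp A).toLinearMap = A.trace := by
  have : (matrixOp A).toLinearMap = Matrix.toEuclideanLin A := rfl
  rw [this, Matrix.toEuclideanLin, Matrix.toLpLin_eq_toLin, Matrix.trace_toLin_eq]

theorem matrixOp_mul (A B : Matrix (Fin n) (Fin n) ℂ) :
    matrixOp (A * B) = matrixOp A * matrixOp B := by
  simp [matrixOp]

theorem matrixOp_star (A : Matrix (Fin n) (Fin n) ℂ) :
    matrixOp (star A) = ContinuousLinearMap.adjoint (matrixOp A) := by
  simp only [matrixOp, map_star]
  rfl

/-- The trace form of the `C`-numerical range, computed in an arbitrary orthonormal basis: the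
points of `W_C(T)` are the numbers `tr (X* T X C)`, where `X : ℂⁿ → H` is an isometry. -/
theorem mem_cNumericalRange_iff (C : Matrix (Fin n) (Fin n) ℂ) (T : H →L[ℂ] H)
    (b : OrthonormalBasis (Fin n) ℂ (EuclideanSpace ℂ (Fin n))) (z : ℂ) :
    z ∈ cNumericalRange C T ↔ ∃ X : EuclideanSpace ℂ (Fin n) →ₗᵢ[ℂ] H,
      z = ∑ i, ⟪X (b i), T (X (matrixOp C (b i)))⟫_ℂ := by
  have key : ∀ (X : EuclideanSpace ℂ (Fin n) →ₗᵢ[ℂ] H) (Y : Matrix (Fin n) (Fin n) ℂ),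
      (∀ h k, ⟪X h, T (X k)⟫_ℂ = ⟪h, matrixOp Y k⟫_ℂ) →
      (C * Y).trace = ∑ i, ⟪X (b i), T (X (matrixOp C (b i)))⟫_ℂ := by
    intro X Y h
    rw [Matrix.trace_mul_comm, ← trace_matrixOp, LinearMap.trace_eq_sum_inner _ b, matrixOp_mul]
    simp [h]
  constructor
  · rintro ⟨Y, hY, rfl⟩
    obtain ⟨X, hX⟩ := isDilation_iff.1 hY
    exact ⟨X, key X Y hX⟩
  · rintro ⟨X, rfl⟩
    have hX : ∀ h k, ⟪X h, T (X k)⟫_ℂ = ⟪h, matrixOp ((Matrix.toEuclideanCLM (𝕜 := ℂ)).symm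
        ((ContinuousLinearMap.adjoint X.toContinuousLinearMap).comp
          (T.comp X.toContinuousLinearMap))) k⟫_ℂ := by
      intro h k
      simp [matrixOp, ContinuousLinearMap.adjoint_inner_right]
    exact ⟨_, isDilation_iff.2 ⟨X, hX⟩, (key X _ hX).symm⟩

theorem exists_linearIsometry_apply_eq {E F : Type*} [NormedAddCommGroup E]
    [InnerProductSpace ℂ E] [NormedAddCommGroup F] [InnerProductSpace ℂ F]
    (b : OrthonormalBasis (Fin n) ℂ E) {x : Fin n → F} (hx : Orthonormal ℂ x) :
    ∃ X : E →ₗᵢ[ℂ] F, ∀ i, X (b i) = x i := by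
  have hX : Orthonormal ℂ ((b.toBasis.constr ℂ x) ∘ b.toBasis) := by
    convert hx using 1
    funext i
    simp only [Function.comp_apply, Module.Basis.constr_basis]
  refine ⟨LinearMap.isometryOfOrthonormal (v := b.toBasis) (b.toBasis.constr ℂ x)
    (by simp [b.orthonormal]) hX, fun i => ?_⟩
  have := b.toBasis.constr_basis ℂ x i
  rwa [b.coe_toBasis] at this

/-- If the orthonormal basis `b` diagonalizes `C` with eigenvalues `c`, then `W_C(T)` consists of
the weighted sums `∑ cᵢ ⟨xᵢ, T xᵢ⟩` over orthonormal families `x`. -/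
theorem mem_cNumericalRange_iff_of_diagonal {C : Matrix (Fin n) (Fin n) ℂ} (T : H →L[ℂ] H)
    {b : OrthonormalBasis (Fin n) ℂ (EuclideanSpace ℂ (Fin n))} {c : Fin n → ℂ}
    (hb : ∀ i, matrixOp C (b i) = c i • b i) (z : ℂ) :
    z ∈ cNumericalRange C T ↔ ∃ x : Fin n → H, Orthonormal ℂ x ∧
      z = ∑ i, c i * ⟪x i, T (x i)⟫_ℂ := by
  rw [mem_cNumericalRange_iff C T b]
  constructor
  · rintro ⟨X, rfl⟩
    exact ⟨fun i => X (b i), b.orthonormal.comp_linearIsometry X, by simp [hb]⟩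
  · rintro ⟨x, hx, rfl⟩
    obtain ⟨X, hXb⟩ := exists_linearIsometry_apply_eq b hx
    exact ⟨X, by simp [hb, hXb]⟩

/-- A finite-dimensional subspace of smaller dimension has a unit vector orthogonal to it. -/
theorem exists_unit_orthogonal {E : Type*} [NormedAddCommGroup E] [InnerProductSpace ℂ E]
    (N : Submodule ℂ E) [FiniteDimensional ℂ N] (hN : N ≠ ⊤) :
    ∃ x : E, ‖x‖ = 1 ∧ ∀ y ∈ N, ⟪y, x⟫_ℂ = 0 := by
  have h : Nᗮ ≠ ⊥ := fun h => hN ((Submodule.orthogonal_eq_bot_iff).1 h)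
  obtain ⟨x, hx, hx0⟩ := Submodule.exists_mem_ne_zero_of_ne_bot h
  refine ⟨((‖x‖⁻¹ : ℝ) : ℂ) • x, ?_, fun y hy => ?_⟩
  · rw [norm_smul, Complex.norm_real, norm_inv, norm_norm]
    exact inv_mul_cancel₀ (norm_ne_zero_iff.2 hx0)
  · rw [inner_smul_right, hx y hy, mul_zero]

theorem span_ne_top_of_card_lt {E : Type*} [NormedAddCommGroup E] [InnerProductSpace ℂ E]
    {ι : Type} [Fintype ι] (f : ι → E) (s : Finset ι)
    (hs : ((s.card : ℕ) : Cardinal) < Module.rank ℂ E) :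
    Submodule.span ℂ (f '' s) ≠ ⊤ := by
  classical
  intro h
  have h1 := rank_span_le (R := ℂ) (f '' (s : Set ι))
  rw [h, rank_top, ← Finset.coe_image] at h1
  have h2 : Cardinal.mk ((s.image f : Finset E) : Set E) ≤ s.card := by
    simpa using Finset.card_image_le
  exact absurd (h1.trans h2) (not_le.2 hs)

/-- An orthonormal family indexed by a set `J` of indices extends to all of `Fin n` as soon as the
dimension is at least `n`. -/
theorem exists_orthonormal_extension {E : Type*} [NormedAddCommGroup E] [InnerProductSpace ℂ E]
    (hE : (n : Cardinal) ≤ Module.rank ℂ E) (J : Finset (Fin n)) (x : Fin n → E)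
    (hx : ∀ i ∈ J, ∀ j ∈ J, ⟪x i, x j⟫_ℂ = if i = j then 1 else 0) :
    ∃ y : Fin n → E, Orthonormal ℂ y ∧ ∀ i ∈ J, y i = x i := by
  classical
  suffices h : ∀ J' : Finset (Fin n), ∃ y : Fin n → E,
      (∀ i ∈ J ∪ J', ∀ j ∈ J ∪ J', ⟪y i, y j⟫_ℂ = if i = j then 1 else 0) ∧
      ∀ i ∈ J, y i = x i by
    obtain ⟨y, hy, hyx⟩ := h Finset.univ
    exact ⟨y, orthonormal_iff_ite.2 fun i j => hy i (by simp) j (by simp), hyx⟩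
  intro J'
  induction J' using Finset.induction_on with
  | empty => exact ⟨x, by simpa using hx, fun _ _ => rfl⟩
  | insert k J' hk ih =>
    obtain ⟨y, hy, hyx⟩ := ih
    by_cases hkJ : k ∈ J ∪ J'
    · refine ⟨y, ?_, hyx⟩
      have : J ∪ insert k J' = J ∪ J' := by
        rw [Finset.union_insert]
        exact Finset.insert_eq_of_mem hkJ
      rwa [this]
    · have hcard : (((J ∪ J').card : ℕ) : Cardinal) < Module.rank ℂ E := by
        refine lt_of_lt_of_le ?_ hE
        have : (J ∪ J').card < n := by
          simpa using Finset.card_lt_univ_of_notMem hkJ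
        exact_mod_cast this
      have : FiniteDimensional ℂ (Submodule.span ℂ (y '' (J ∪ J' : Finset (Fin n)))) :=
        FiniteDimensional.span_of_finite ℂ (Set.toFinite _)
      obtain ⟨a, ha, hay⟩ := exists_unit_orthogonal _ (span_ne_top_of_card_lt y (J ∪ J') hcard)
      have hay' : ∀ i ∈ J ∪ J', ⟪y i, a⟫_ℂ = 0 := fun i hi =>
        hay _ (Submodule.subset_span ⟨i, hi, rfl⟩)
      have hay'' : ∀ i ∈ J ∪ J', ⟪a, y i⟫_ℂ = 0 := fun i hi =>
        inner_eq_zero_symm.1 (hay' i hi)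
      have hne : ∀ i ∈ J ∪ J', i ≠ k := fun i hi h => hkJ (h ▸ hi)
      refine ⟨Function.update y k a, ?_, fun i hi => ?_⟩
      · intro i hi j hj
        rw [Finset.union_insert, Finset.mem_insert] at hi hj
        rcases hi with rfl | hi <;> rcases hj with rfl | hj
        · simp [ha]
        · rw [Function.update_self, Function.update_of_ne (hne j hj), hay'' j hj,
            if_neg (hne j hj).symm]
        · rw [Function.update_self, Function.update_of_ne (hne i hi), hay' i hi,
            if_neg (hne i hi)]
        · rw [Function.update_of_ne (hne i hi), Function.update_of_ne (hne j hj), hy i hi j hj]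
      · rw [Function.update_of_ne (hne i (Finset.mem_union_left _ hi)), hyx i hi]

end Basics

/-! ### Convexity of the numerical range -/

section ToeplitzHausdorff

variable {H : Type*} [NormedAddCommGroup H] [InnerProductSpace ℂ H]

/-- The numerical range `{⟨x, T x⟩ : x ∈ N, ‖x‖ = 1}` of the compression of `T` to a subspace
`N`. -/
def numericalRangeOn (T : H →L[ℂ] H) (N : Submodule ℂ H) : Set ℂ :=
  {z | ∃ x ∈ N, ‖x‖ = 1 ∧ z = ⟪x, T x⟫_ℂ}

theorem inner_smul_self_apply (T : H →L[ℂ] H) (a : ℂ) (x : H) :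
    ⟪a • x, T (a • x)⟫_ℂ = (‖a‖ ^ 2 : ℝ) * ⟪x, T x⟫_ℂ := by
  rw [map_smul, inner_smul_left, inner_smul_right, ← mul_assoc, Complex.conj_mul']
  push_cast
  ring

/-- The **Toeplitz–Hausdorff theorem**, for the compression of `T` to a subspace. -/
theorem convex_numericalRangeOn (T : H →L[ℂ] H) (N : Submodule ℂ H) :
    Convex ℝ (numericalRangeOn T N) := by
  rw [convex_iff_segment_subset]
  rintro _ ⟨x, hxN, hx, rfl⟩ _ ⟨y, hyN, hy, rfl⟩
  set α := ⟪x, T x⟫_ℂ with hα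
  set β := ⟪y, T y⟫_ℂ with hβ
  rcases eq_or_ne α β with hab | hab
  · rw [hab, segment_same]
    rintro _ rfl
    exact ⟨y, hyN, hy, hβ⟩
  -- The form `t v = ⟨v, (T - α) v⟩ / (β - α)` is `0` at `x` and `1` at `y`.
  have hd : β - α ≠ 0 := sub_ne_zero.2 hab.symm
  have hxx : ⟪x, x⟫_ℂ = 1 := by rw [inner_self_eq_norm_sq_to_K, hx]; simp
  have hyy : ⟪y, y⟫_ℂ = 1 := by rw [inner_self_eq_norm_sq_to_K, hy]; simp
  -- A unimodular `u` that makes the cross terms of `t ((1 - s) u x + s y)` real.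
  set P : ℂ := (⟪x, T y⟫_ℂ - α * ⟪x, y⟫_ℂ) / (β - α) with hP
  set Q : ℂ := (⟪y, T x⟫_ℂ - α * ⟪y, x⟫_ℂ) / (β - α) with hQ
  obtain ⟨u, hu, huim⟩ : ∃ u : ℂ, ‖u‖ = 1 ∧ (star u * P + u * Q).im = 0 := by
    set w := P - star Q with hw
    rcases eq_or_ne w 0 with h0 | h0
    · refine ⟨1, by simp, ?_⟩
      have : P = star Q := sub_eq_zero.1 h0
      simp [this]
    · refine ⟨w / ‖w‖, by simp [h0], ?_⟩
      have hn : (‖w‖ : ℂ) ≠ 0 := by simpa using h0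
      have h1 : (star (w / ‖w‖) * P + (w / ‖w‖) * Q).im
          = (star (w / ‖w‖) * w).im := by
        simp only [hw, Complex.star_def, Complex.add_im, Complex.mul_im, Complex.sub_re,
          Complex.sub_im, Complex.conj_re, Complex.conj_im]
        ring
      rw [h1]
      have h2 : star (w / ‖w‖) * w = (‖w‖ : ℂ) := by
        rw [star_div₀, Complex.star_def, Complex.conj_ofReal, div_mul_eq_mul_div,
          Complex.conj_mul', div_eq_iff hn]
        ring
      rw [h2]
      simp
  set v : ℝ → H := fun s => (((1 - s : ℝ) : ℂ) * u) • x + ((s : ℝ) : ℂ) • y with hv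
  have huu : star u * u = 1 := by
    rw [Complex.star_def, Complex.conj_mul', hu]; simp
  have hvN : ∀ s, v s ∈ N := fun s => N.add_mem (N.smul_mem _ hxN) (N.smul_mem _ hyN)
  -- Linear dependence of `u x` and `y` would force `α = β`.
  have hv0 : ∀ s, v s ≠ 0 := by
    intro s hs
    apply hab
    have h1 : ((s : ℝ) : ℂ) • y = (-(((1 - s : ℝ) : ℂ) * u)) • x := by
      rw [neg_smul]; exact eq_neg_of_add_eq_zero_right hs
    have h2 : |s| = |1 - s| := by
      have := congrArg norm h1
      rw [norm_smul, norm_smul, hx, hy, norm_neg, norm_mul, hu] at this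
      rw [Complex.norm_real, Complex.norm_real] at this
      simpa using this
    have hs0 : s ≠ 0 := by
      rintro rfl
      simp at h2
    have h3 := congrArg (fun w => ⟪w, T w⟫_ℂ) h1
    simp only [inner_smul_self_apply] at h3
    rw [norm_neg, norm_mul, hu, Complex.norm_real, Complex.norm_real, Real.norm_eq_abs,
      Real.norm_eq_abs, mul_one, ← h2] at h3
    have : (((|s| ^ 2 : ℝ)) : ℂ) ≠ 0 := by simpa using hs0
    exact (mul_left_cancel₀ this h3).symm
  set t : ℝ → ℂ := fun s => (⟪v s, T (v s)⟫_ℂ - α * ⟪v s, v s⟫_ℂ) / (β - α) with ht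
  have htexp : ∀ s : ℝ, t s = (s ^ 2 : ℝ) + ((1 - s) * s : ℝ) * (star u * P + u * Q) := by
    intro s
    have e1 : ⟪x, T x⟫_ℂ = α := hα.symm
    have e2 : ⟪y, T y⟫_ℂ = β := hβ.symm
    simp only [ht, hP, hQ, hv]
    rw [map_add, map_smul, map_smul]
    simp only [inner_add_left, inner_add_right, inner_smul_left, inner_smul_right, e1, e2, hxx,
      hyy, map_mul, Complex.conj_ofReal, Complex.star_def]
    rw [Complex.star_def] at huu
    field_simp
    push_cast
    linear_combination (0 : ℂ) * huu
  have htim : ∀ s, (t s).im = 0 := by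
    intro s
    rw [htexp, Complex.add_im, Complex.ofReal_im, Complex.im_ofReal_mul, huim]
    simp
  have hnorm : ∀ s, ⟪v s, v s⟫_ℂ = (‖v s‖ ^ 2 : ℝ) := fun s => by
    rw [inner_self_eq_norm_sq_to_K]; simp
  have hpos : ∀ s, ‖v s‖ ^ 2 ≠ 0 := fun s => pow_ne_zero _ (norm_ne_zero_iff.2 (hv0 s))
  have hvc : Continuous v := by fun_prop
  have hgc : Continuous fun s => (t s).re / ‖v s‖ ^ 2 := by
    refine Continuous.div (Complex.continuous_re.comp ?_) (by fun_prop) hpos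
    exact ((hvc.inner (T.continuous.comp hvc)).sub
      (continuous_const.mul (hvc.inner hvc))).div_const _
  have hv1 : v 1 = y := by simp [hv]
  have ht0 : (t 0).re = 0 := by rw [htexp]; simp
  have ht1 : (t 1).re = 1 := by rw [htexp]; simp
  rw [segment_eq_image']
  rintro _ ⟨θ, hθ, rfl⟩
  obtain ⟨s, -, hs⟩ := intermediate_value_Icc (zero_le_one' ℝ) hgc.continuousOn
    (show θ ∈ Set.Icc ((t 0).re / ‖v 0‖ ^ 2) ((t 1).re / ‖v 1‖ ^ 2) by
      rw [ht0, ht1, hv1, hy]; simpa using hθ)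
  refine ⟨((‖v s‖⁻¹ : ℝ) : ℂ) • v s, N.smul_mem _ (hvN s), ?_, ?_⟩
  · rw [norm_smul, Complex.norm_real, norm_inv, norm_norm]
    exact inv_mul_cancel₀ (norm_ne_zero_iff.2 (hv0 s))
  · have h1 : t s = ((θ * ‖v s‖ ^ 2 : ℝ) : ℂ) := by
      apply Complex.ext
      · rw [Complex.ofReal_re, ← hs, div_mul_cancel₀ _ (hpos s)]
      · rw [htim, Complex.ofReal_im]
    have h2 : ⟪v s, T (v s)⟫_ℂ = ((‖v s‖ ^ 2 : ℝ) : ℂ) * (α + θ * (β - α)) := by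
      have : t s * (β - α) = ⟪v s, T (v s)⟫_ℂ - α * ⟪v s, v s⟫_ℂ := div_mul_cancel₀ _ hd
      rw [h1, hnorm] at this
      push_cast at this ⊢
      linear_combination -this
    rw [inner_smul_self_apply, h2, Complex.norm_real, norm_inv, norm_norm, ← mul_assoc,
      ← Complex.ofReal_mul, inv_pow, inv_mul_cancel₀ (hpos s)]
    simp

end ToeplitzHausdorff

/-! ### Block operators on `H ⊕ H` -/

section BlockOperators

variable {H : Type*} [NormedAddCommGroup H] [InnerProductSpace ℂ H]

/-- The operator on the Hilbert space `H ⊕ H` with block matrix `!![a, b; c, d]`. -/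
noncomputable def blockOp (a b c d : H →L[ℂ] H) : WithLp 2 (H × H) →L[ℂ] WithLp 2 (H × H) :=
  (WithLp.prodContinuousLinearEquiv 2 ℂ H H).symm.toContinuousLinearMap ∘L
    ((a ∘L ContinuousLinearMap.fst ℂ H H + b ∘L ContinuousLinearMap.snd ℂ H H).prod
      (c ∘L ContinuousLinearMap.fst ℂ H H + d ∘L ContinuousLinearMap.snd ℂ H H)) ∘L
    (WithLp.prodContinuousLinearEquiv 2 ℂ H H).toContinuousLinearMap

theorem blockOp_apply (a b c d : H →L[ℂ] H) (x : WithLp 2 (H × H)) :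
    blockOp a b c d x = WithLp.toLp 2 (a x.fst + b x.snd, c x.fst + d x.snd) := rfl

theorem blockOp_one : blockOp (1 : H →L[ℂ] H) 0 0 1 = 1 := by
  ext x
  simp only [blockOp_apply, one_apply_eq_self, zero_apply, add_zero, zero_add]
  rfl

theorem blockOp_mul (a b c d a' b' c' d' : H →L[ℂ] H) :
    blockOp a b c d * blockOp a' b' c' d' =
      blockOp (a * a' + b * c') (a * b' + b * d') (c * a' + d * c') (c * b' + d * d') := by
  ext x
  simp [blockOp_apply, add_add_add_comm]

theorem inner_blockOp (a b c d : H →L[ℂ] H) (x y : WithLp 2 (H × H)) :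
    ⟪x, blockOp a b c d y⟫_ℂ =
      ⟪x.fst, a y.fst + b y.snd⟫_ℂ + ⟪x.snd, c y.fst + d y.snd⟫_ℂ := rfl

theorem inner_blockOp_left (a b c d : H →L[ℂ] H) (x y : WithLp 2 (H × H)) :
    ⟪blockOp a b c d x, y⟫_ℂ =
      ⟪a x.fst + b x.snd, y.fst⟫_ℂ + ⟪c x.fst + d x.snd, y.snd⟫_ℂ := rfl

variable [CompleteSpace H]

theorem star_blockOp (a b c d : H →L[ℂ] H) :
    star (blockOp a b c d) = blockOp (star a) (star c) (star b) (star d) := by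
  symm
  rw [ContinuousLinearMap.star_eq_adjoint (blockOp a b c d), ContinuousLinearMap.eq_adjoint_iff]
  intro x y
  simp only [inner_blockOp, inner_blockOp_left, inner_add_left, inner_add_right,
    ContinuousLinearMap.star_eq_adjoint, ContinuousLinearMap.adjoint_inner_left]
  ring

end BlockOperators

/-! ### Unitary dilations -/

section Dilations

variable {H : Type*} [NormedAddCommGroup H] [InnerProductSpace ℂ H] [CompleteSpace H]

theorem nonneg_one_sub_mul_star {T : H →L[ℂ] H} (hT : ‖T‖ ≤ 1) : 0 ≤ 1 - T * star T := by
  rw [sub_nonneg]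
  exact CStarAlgebra.mul_star_le_algebraMap_norm_sq.trans (by
    simpa using algebraMap_mono (H →L[ℂ] H) (pow_le_one₀ (n := 2) (norm_nonneg T) hT))

/-- **Constrained unitary dilation.** Let `T` be a contraction, `|p| = 1`, with `Re T < Re p`
uniformly. Then `T` has a unitary dilation `U` on `H ⊕ H` with `Re U ≤ Re p`.

With `A = 1 - p⁻¹ T`, `R = A⁻¹` and `D = (R + R*)^{1/2} ≥ 1`, the operator `V = 1 - D A D` is
unitary, `U = p ⊕ p V`, and the isometry is `h ↦ ((1 - D⁻²)^{1/2} h, D⁻¹ h)`. The bound on `Re U`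
holds because `Re (p (1 - V)) = D (Re p - Re T) D`. -/
theorem exists_unitaryDilation_re_le {T : H →L[ℂ] H} (hT : ‖T‖ ≤ 1) {p : ℂ} (hp : ‖p‖ = 1)
    {δ : ℝ} (hδ : 0 < δ) (hTp : ∀ x, (⟪x, T x⟫_ℂ).re ≤ (p.re - δ) * ‖x‖ ^ 2) :
    ∃ U : WithLp 2 (H × H) →L[ℂ] WithLp 2 (H × H),
      IsUnitaryDilation U T ∧ ∀ y, (⟪y, U y⟫_ℂ).re ≤ p.re * ‖y‖ ^ 2 := by
  have hpp : star p * p = 1 := by rw [Complex.star_def, Complex.conj_mul', hp]; simp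
  have hpp' : p * star p = 1 := by rw [mul_comm, hpp]
  set A : H →L[ℂ] H := 1 - star p • T with hA
  have hpA : p • A = p • (1 : H →L[ℂ] H) - T := by
    rw [hA, smul_sub, smul_smul, hpp', one_smul]
  have hre : ∀ x, δ * ‖x‖ ^ 2 ≤ (⟪x, (p • A) x⟫_ℂ).re := by
    intro x
    have h1 : (⟪x, (p • A) x⟫_ℂ).re = p.re * ‖x‖ ^ 2 - (⟪x, T x⟫_ℂ).re := by
      rw [hpA]
      simp only [sub_apply, smul_apply,
        one_apply_eq_self, inner_sub_right, inner_smul_right, Complex.sub_re]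
      rw [inner_self_eq_ofReal_norm_sq, Complex.re_mul_ofReal]
    rw [h1]
    linarith [hTp x]
  have hAunit : IsUnit A := by
    refine ContinuousLinearMap.isUnit_of_forall_le_norm_inner_map A (c := ⟨δ, hδ.le⟩) hδ ?_
    intro x
    have h1 : ‖⟪A x, x⟫_ℂ‖ = ‖⟪x, (p • A) x⟫_ℂ‖ := by
      rw [smul_apply, inner_smul_right, norm_mul, hp, one_mul,
        norm_inner_symm]
    rw [h1]
    calc ‖x‖ ^ 2 * δ = δ * ‖x‖ ^ 2 := mul_comm _ _
      _ ≤ _ := hre x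
      _ ≤ _ := Complex.re_le_norm _
  obtain ⟨R, hAR, hRA⟩ : ∃ R, A * R = 1 ∧ R * A = 1 := by
    obtain ⟨u, hu⟩ := hAunit
    exact ⟨↑u⁻¹, by rw [← hu, Units.mul_inv], by rw [← hu, Units.inv_mul]⟩
  have hAR' : star R * star A = 1 := by rw [← star_mul, hAR, star_one]
  have hRA' : star A * star R = 1 := by rw [← star_mul, hRA, star_one]
  -- `R + R* - 1 = R (1 - (p⁻¹ T) (p⁻¹ T)*) R* ≥ 0`.
  have hF1 : 0 ≤ R + star R - 1 := by
    have h2 : R + star R - 1 = R * (1 - T * star T) * star R := by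
      have h3 : T * star T = (1 - A) * star (1 - A) := by
        rw [hA, sub_sub_cancel, star_smul, star_star, smul_mul_smul_comm, hpp, one_smul]
      rw [h3, star_sub, star_one]
      have h4 : R * (1 - (1 - A) * (1 - star A)) * star R
          = R * (star A * star R) + (R * A) * star R - (R * A) * (star A * star R) := by
        noncomm_ring
      rw [h4, hRA, hRA']
      noncomm_ring
    rw [h2]
    exact star_right_conjugate_nonneg (nonneg_one_sub_mul_star hT) R
  have hF : 0 ≤ R + star R := by
    have : (0 : H →L[ℂ] H) ≤ 1 := zero_le_one
    have h := add_nonneg hF1 this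
    rwa [sub_add_cancel] at h
  set D := CFC.sqrt (R + star R) with hD
  have hDD : D * D = R + star R := CFC.sqrt_mul_sqrt_self _ hF
  have hDs : star D = D := (CFC.sqrt_nonneg (R + star R)).isSelfAdjoint.star_eq
  have hDunit : IsUnit D := by
    have h1 : (1 : H →L[ℂ] H) ≤ D * D := by rw [hDD, ← sub_nonneg]; exact hF1
    have h2 : IsUnit (D * D) := CStarAlgebra.isUnit_of_le 1 h1
    exact ((Commute.refl D).isUnit_mul_iff.1 h2).1
  obtain ⟨G, hDG, hGD⟩ : ∃ G, D * G = 1 ∧ G * D = 1 := by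
    obtain ⟨u, hu⟩ := hDunit
    exact ⟨↑u⁻¹, by rw [← hu, Units.mul_inv], by rw [← hu, Units.inv_mul]⟩
  have hGs : star G = G := by
    have h1 : star G * D = 1 := by
      have := congrArg star hDG
      rwa [star_mul, hDs, star_one] at this
    calc star G = star G * (D * G) := by rw [hDG, mul_one]
      _ = G := by rw [← mul_assoc, h1, one_mul]
  have hGG : 0 ≤ 1 - G * G := by
    have h1 : 1 - G * G = G * (R + star R - 1) * star G := by
      rw [← hDD, hGs]
      calc 1 - G * G = (G * D) * (D * G) - G * G := by rw [hGD, hDG, one_mul]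
        _ = _ := by noncomm_ring
    rw [h1]
    exact star_right_conjugate_nonneg hF1 G
  set Z := CFC.sqrt (1 - G * G) with hZ
  have hZZ : Z * Z = 1 - G * G := CFC.sqrt_mul_sqrt_self _ hGG
  have hZs : star Z = Z := (CFC.sqrt_nonneg (1 - G * G)).isSelfAdjoint.star_eq
  set V := 1 - D * A * D with hV
  have hVs : star V = 1 - D * star A * D := by
    rw [hV, star_sub, star_one, star_mul, star_mul, hDs, mul_assoc]
  have hVV : V * star V = 1 := by
    have h1 : A * (D * D) * star A = star A + A := by
      rw [hDD]
      calc A * (R + star R) * star A = (A * R) * star A + A * (star R * star A) := by noncomm_ring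
        _ = _ := by rw [hAR, hAR', one_mul, mul_one]
    calc V * star V = 1 - D * A * D - D * star A * D + D * (A * (D * D) * star A) * D := by
          rw [hVs, hV]; noncomm_ring
      _ = 1 := by rw [h1]; noncomm_ring
  have hVV' : star V * V = 1 := by
    have h1 : star A * (D * D) * A = star A + A := by
      rw [hDD]
      calc star A * (R + star R) * A = star A * (R * A) + (star A * star R) * A := by noncomm_ring
        _ = _ := by rw [hRA, hRA', one_mul, mul_one]
    calc star V * V = 1 - D * A * D - D * star A * D + D * (star A * (D * D) * A) * D := by
          rw [hVs, hV]; noncomm_ring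
      _ = 1 := by rw [h1]; noncomm_ring
  have inner_mv : ∀ (B : H →L[ℂ] H), star B = B → ∀ x y, ⟪B x, y⟫_ℂ = ⟪x, B y⟫_ℂ := by
    intro B hB x y
    conv_lhs => rw [← hB, ContinuousLinearMap.star_eq_adjoint,
      ContinuousLinearMap.adjoint_inner_left]
  refine ⟨blockOp (p • 1) 0 0 (p • V), ⟨?_, ?_⟩, ?_⟩
  · rw [Unitary.mem_iff, star_blockOp, blockOp_mul, blockOp_mul]
    rw [Complex.star_def] at hpp hpp'
    simp [hVV, hVV', smul_smul, hpp, hpp', blockOp_one]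
  · rw [isDilation_iff]
    have hiso : ∀ h k : H, ⟪Z h, Z k⟫_ℂ + ⟪G h, G k⟫_ℂ = ⟪h, k⟫_ℂ := by
      intro h k
      rw [inner_mv Z hZs, inner_mv G hGs, ← inner_add_right, ← mul_apply_eq_comp,
        ← mul_apply_eq_comp, hZZ]
      simp
    let X₀ : H →ₗ[ℂ] WithLp 2 (H × H) :=
      (WithLp.linearEquiv 2 ℂ (H × H)).symm.toLinearMap ∘ₗ (Z.toLinearMap.prod G.toLinearMap)
    have hX₀ : ∀ h, X₀ h = WithLp.toLp 2 (Z h, G h) := fun h => rfl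
    let X : H →ₗᵢ[ℂ] WithLp 2 (H × H) := X₀.isometryOfInner fun h k => by
      rw [hX₀, hX₀, WithLp.prod_inner_apply]
      exact hiso h k
    have hX : ∀ h, X h = WithLp.toLp 2 (Z h, G h) := fun h => rfl
    refine ⟨X, fun h k => ?_⟩
    rw [hX, hX, inner_blockOp]
    have h1 : G * (p • V) * G = T - p • (Z * Z) := by
      rw [hZZ, hV]
      calc G * (p • (1 - D * A * D)) * G
          = p • (G * G - (G * D) * A * (D * G)) := by
            rw [mul_smul_comm, smul_mul_assoc]; congr 1; noncomm_ring
        _ = _ := by rw [hGD, hDG, one_mul, mul_one, smul_sub, hpA]; rw [smul_sub]; abel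
    have h2 : ⟪G h, (p • V) (G k)⟫_ℂ = ⟪h, T k⟫_ℂ - p * ⟪Z h, Z k⟫_ℂ := by
      rw [inner_mv G hGs, inner_mv Z hZs, ← mul_apply_eq_comp,
        ← mul_apply_eq_comp, h1]
      simp
    simp only [zero_apply, add_zero, zero_add, WithLp.toLp_fst, WithLp.toLp_snd]
    rw [h2, smul_apply, one_apply_eq_self, inner_smul_right]
    ring
  · intro y
    rw [inner_blockOp, WithLp.prod_norm_sq_eq_of_L2]
    simp only [zero_apply, add_zero, zero_add, Complex.add_re]
    have h1 : (⟪y.fst, (p • (1 : H →L[ℂ] H)) y.fst⟫_ℂ).re = p.re * ‖y.fst‖ ^ 2 := by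
      rw [smul_apply, one_apply_eq_self, inner_smul_right,
        inner_self_eq_ofReal_norm_sq, Complex.re_mul_ofReal]
    have h2 : ⟪y.snd, (p • V) y.snd⟫_ℂ =
        p * (‖y.snd‖ ^ 2 : ℝ) - ⟪D y.snd, (p • A) (D y.snd)⟫_ℂ := by
      rw [inner_mv D hDs]
      have h3 : (p • V) y.snd = p • y.snd - D ((p • A) (D y.snd)) := by
        simp [hV, smul_sub]
      rw [h3, inner_sub_right, inner_smul_right, inner_self_eq_ofReal_norm_sq]
    have h4 := hre (D y.snd)
    have h5 : 0 ≤ δ * ‖D y.snd‖ ^ 2 := by positivity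
    rw [h1, h2, Complex.sub_re, Complex.re_mul_ofReal]
    linarith

set_option synthInstance.maxHeartbeats 200000 in
/-- The **Halmos dilation**: every contraction has a unitary dilation on `H ⊕ H`. It is obtained
as `(N + i (1 - N²)^{1/2}) J`, where `N = !![0, T; T*, 0]` and `J` is the flip of `H ⊕ H`. -/
theorem exists_unitaryDilation {T : H →L[ℂ] H} (hT : ‖T‖ ≤ 1) :
    ∃ U : WithLp 2 (H × H) →L[ℂ] WithLp 2 (H × H), IsUnitaryDilation U T := by
  set N := blockOp 0 T (star T) 0 with hN
  have hNs : star N = N := by rw [hN, star_blockOp]; simp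
  have hNN : N * N = blockOp (T * star T) 0 0 (star T * T) := by
    rw [hN, blockOp_mul]; simp
  have hNnorm : ‖N‖ ≤ 1 := by
    refine ContinuousLinearMap.opNorm_le_bound _ zero_le_one fun x => ?_
    rw [one_mul, ← sq_le_sq₀ (norm_nonneg _) (norm_nonneg _), WithLp.prod_norm_sq_eq_of_L2,
      WithLp.prod_norm_sq_eq_of_L2, hN, blockOp_apply]
    have h1 : ‖T x.snd‖ ≤ ‖x.snd‖ := by
      simpa using T.le_of_opNorm_le hT x.snd
    have h2 : ‖star T x.fst‖ ≤ ‖x.fst‖ := by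
      simpa using (star T).le_of_opNorm_le ((norm_star T).le.trans hT) x.fst
    simp only [zero_apply, add_zero, zero_add, WithLp.toLp_fst, WithLp.toLp_snd]
    rw [add_comm]
    gcongr
  set W := selfAdjoint.unitarySelfAddISMul ⟨N, hNs⟩ hNnorm with hW
  set S := CFC.sqrt (1 - N ^ 2) with hS
  have hWc : (W : WithLp 2 (H × H) →L[ℂ] WithLp 2 (H × H)) = N + Complex.I • S := rfl
  set J := blockOp (0 : H →L[ℂ] H) 1 1 0 with hJ
  have hJu : J ∈ unitary (WithLp 2 (H × H) →L[ℂ] WithLp 2 (H × H)) := by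
    rw [Unitary.mem_iff, hJ, star_blockOp, blockOp_mul, blockOp_mul]
    simp [blockOp_one]
  -- `S` is block diagonal, because `1 - N²` commutes with `1 ⊕ (-1)`.
  set E := blockOp (1 : H →L[ℂ] H) 0 0 (-1) with hE
  have hEs : star E = E := by rw [hE, star_blockOp]; simp
  have hcomm : Commute (1 - N ^ 2) E := by
    rw [Commute, SemiconjBy, sub_mul, mul_sub, one_mul, mul_one, sq, hNN, hE, blockOp_mul,
      blockOp_mul]
    simp
  have hSE : Commute S E := Commute.cfcₙ_nnreal hcomm _
  let X₀ : H →ₗ[ℂ] WithLp 2 (H × H) :=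
    (WithLp.linearEquiv 2 ℂ (H × H)).symm.toLinearMap ∘ₗ (LinearMap.inl ℂ H H)
  have hX₀ : ∀ h, X₀ h = WithLp.toLp 2 (h, 0) := fun h => rfl
  let X : H →ₗᵢ[ℂ] WithLp 2 (H × H) := X₀.isometryOfInner fun h k => by
    rw [hX₀, hX₀, WithLp.prod_inner_apply]
    simp
  have hX : ∀ h, X h = WithLp.toLp 2 (h, 0) := fun h => rfl
  refine ⟨W * J, mul_mem W.2 hJu, isDilation_iff.2 ⟨X, fun h k => ?_⟩⟩
  have hJk : J (X k) = WithLp.toLp 2 (0, k) := by simp [hJ, blockOp_apply, hX]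
  have hSz : ⟪X h, S (WithLp.toLp 2 (0, k))⟫_ℂ = 0 := by
    have h1 : E (X h) = X h := by simp [hE, blockOp_apply, hX]
    have h2 : E (WithLp.toLp 2 (0, k)) = -(WithLp.toLp 2 (0, k) : WithLp 2 (H × H)) := by
      simp [hE, blockOp_apply, ← WithLp.toLp_neg]
    have h3 : ⟪X h, S (WithLp.toLp 2 (0, k))⟫_ℂ = -⟪X h, S (WithLp.toLp 2 (0, k))⟫_ℂ := by
      conv_lhs => rw [← h1, ← hEs, ContinuousLinearMap.star_eq_adjoint,
        ContinuousLinearMap.adjoint_inner_left, ← mul_apply_eq_comp, ← hSE.eq,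
        mul_apply_eq_comp, h2, map_neg, inner_neg_right]
    exact self_eq_neg.1 h3
  rw [mul_apply_eq_comp, hJk, hWc, add_apply, inner_add_right,
    smul_apply, inner_smul_right, hSz, hN, blockOp_apply, hX,
    WithLp.prod_inner_apply]
  simp

end Dilations

/-! ### The dilation formula for rank-one normal matrices -/

section NumericalRange

variable {H : Type*} [NormedAddCommGroup H] [InnerProductSpace ℂ H] [CompleteSpace H]

theorem IsUnitaryDilation.smul {K : Type*} [NormedAddCommGroup K] [InnerProductSpace ℂ K]
    [CompleteSpace K] {U : K →L[ℂ] K} {T : H →L[ℂ] H} (h : IsUnitaryDilation U T) {ω : ℂ}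
    (hω : ‖ω‖ = 1) : IsUnitaryDilation (ω • U) (ω • T) := by
  have h1 : star ω * ω = 1 := by rw [Complex.star_def, Complex.conj_mul', hω]; simp
  have h2 : ω * star ω = 1 := by rw [mul_comm, h1]
  refine ⟨?_, ?_⟩
  · obtain ⟨h3, h4⟩ := Unitary.mem_iff.1 h.1
    rw [Unitary.mem_iff, star_smul, smul_mul_smul_comm, smul_mul_smul_comm, h1, h2, h3, h4]
    simp
  · obtain ⟨X, hX⟩ := isDilation_iff.1 h.2
    exact isDilation_iff.2 ⟨X, fun h k => by simp [hX]⟩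

theorem norm_apply_of_mem_unitary {U : H →L[ℂ] H} (hU : U ∈ unitary (H →L[ℂ] H)) (x : H) :
    ‖U x‖ = ‖x‖ := ContinuousLinearMap.norm_map_of_mem_unitary hU x

/-- The closed numerical range of a contraction is the intersection of the closed numerical ranges
of its unitary dilations on `H ⊕ H`; this is the nontrivial inclusion. A point outside is
separated by a half plane `Re (ω ·) ≤ m₁`, and the constrained dilation stays in it. -/
theorem mem_closure_numericalRangeOn_of_forall_dilation [Nontrivial H] {T : H →L[ℂ] H}
    (hT : ‖T‖ ≤ 1) {z : ℂ}
    (hz : ∀ U : WithLp 2 (H × H) →L[ℂ] WithLp 2 (H × H), IsUnitaryDilation U T →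
      z ∈ closure (numericalRangeOn U ⊤)) :
    z ∈ closure (numericalRangeOn T ⊤) := by
  by_contra hzT
  obtain ⟨f, u, hfu, huz⟩ := geometric_hahn_banach_closed_point
    (convex_numericalRangeOn T ⊤).closure isClosed_closure hzT
  set ω₀ : ℂ := f 1 - f Complex.I * Complex.I with hω₀
  have hf : ∀ w, f w = (ω₀ * w).re := by
    intro w
    have h1 : w = w.re • (1 : ℂ) + w.im • Complex.I := by
      simp [Complex.re_add_im]
    conv_lhs => rw [h1, map_add, map_smul, map_smul]
    simp [hω₀]
    ring
  obtain ⟨x₀, hx₀⟩ : ∃ x : H, ‖x‖ = 1 := exists_norm_eq H zero_le_one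
  have hω₀0 : ω₀ ≠ 0 := by
    intro h0
    have h1 := hfu _ (subset_closure ⟨x₀, trivial, hx₀, rfl⟩)
    rw [hf, h0, zero_mul] at h1
    rw [hf, h0, zero_mul] at huz
    exact lt_asymm h1 huz
  have hρ : 0 < ‖ω₀‖ := norm_pos_iff.2 hω₀0
  set ω : ℂ := ((‖ω₀‖⁻¹ : ℝ) : ℂ) * ω₀ with hω
  have hωn : ‖ω‖ = 1 := by
    rw [hω, norm_mul, Complex.norm_real, norm_inv, norm_norm, inv_mul_cancel₀ hρ.ne']
  have hωre : ∀ w, (ω * w).re = ‖ω₀‖⁻¹ * f w := by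
    intro w
    rw [hf, hω, mul_assoc, Complex.re_ofReal_mul]
  set m := ‖ω₀‖⁻¹ * u with hm
  have hzm : m < (ω * z).re := by
    rw [hωre]
    exact mul_lt_mul_of_pos_left huz (inv_pos.2 hρ)
  have hTm : ∀ x : H, ‖x‖ = 1 → (ω * ⟪x, T x⟫_ℂ).re < m := by
    intro x hx
    rw [hωre]
    exact mul_lt_mul_of_pos_left (hfu _ (subset_closure ⟨x, trivial, hx, rfl⟩)) (inv_pos.2 hρ)
  have hclosed : ∀ r : ℝ, IsClosed {w : ℂ | (ω * w).re ≤ r} := fun r =>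
    isClosed_le (by fun_prop) continuous_const
  rcases lt_or_ge m 1 with hm1 | hm1
  · obtain ⟨m₁, hmm₁, hm₁⟩ := exists_between (lt_min hm1 hzm)
    have hm₁1 : m₁ < 1 := hm₁.trans_le (min_le_left _ _)
    have hm₁z : m₁ < (ω * z).re := hm₁.trans_le (min_le_right _ _)
    have hm₁' : -1 < m₁ := by
      have h1 : ‖ω * ⟪x₀, T x₀⟫_ℂ‖ ≤ 1 := by
        rw [norm_mul, hωn, one_mul]
        refine (norm_inner_le_norm _ _).trans ?_
        have := T.le_of_opNorm_le hT x₀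
        rw [hx₀] at this ⊢
        linarith
      have h2 := (abs_le.1 ((Complex.abs_re_le_norm _).trans h1)).1
      linarith [hTm x₀ hx₀]
    have hsq : 0 ≤ 1 - m₁ ^ 2 := by nlinarith
    set p : ℂ := ⟨m₁, √(1 - m₁ ^ 2)⟩ with hp
    have hpn : ‖p‖ = 1 := by
      rw [← sq_eq_sq₀ (norm_nonneg _) zero_le_one, ← Complex.normSq_eq_norm_sq, hp,
        Complex.normSq_mk, Real.mul_self_sqrt hsq]
      ring
    have hT' : ‖ω • T‖ ≤ 1 := by rw [norm_smul, hωn, one_mul]; exact hT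
    obtain ⟨U, hU, hUp⟩ := exists_unitaryDilation_re_le hT' hpn (sub_pos.2 hmm₁) (by
      intro x
      have hpm : p.re - (m₁ - m) = m := by simp [hp]
      rw [hpm]
      rcases eq_or_ne x 0 with rfl | hx
      · simp
      have hx' := norm_ne_zero_iff.2 hx
      have h1 := hTm (((‖x‖⁻¹ : ℝ) : ℂ) • x) (by
        rw [norm_smul, Complex.norm_real, norm_inv, norm_norm, inv_mul_cancel₀ hx'])
      rw [inner_smul_self_apply, Complex.norm_real, norm_inv, norm_norm, mul_left_comm,
        Complex.re_ofReal_mul, inv_pow, inv_mul_eq_div, div_lt_iff₀ (by positivity)] at h1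
      rw [smul_apply, inner_smul_right]
      exact h1.le)
    have hω' : ‖star ω‖ = 1 := by simpa using hωn
    have hωω : star ω * ω = 1 := by rw [Complex.star_def, Complex.conj_mul', hωn]; simp
    have hUT : IsUnitaryDilation (star ω • U) T := by
      have := hU.smul hω'
      rwa [smul_smul, hωω, one_smul] at this
    have h1 : numericalRangeOn (star ω • U) ⊤ ⊆ {w : ℂ | (ω * w).re ≤ m₁} := by
      rintro w ⟨y, -, hy, rfl⟩
      have h2 := hUp y
      rw [hy] at h2
      have h3 : ω * ⟪y, (star ω • U) y⟫_ℂ = ⟪y, U y⟫_ℂ := by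
        rw [smul_apply, inner_smul_right, ← mul_assoc, mul_comm ω, hωω, one_mul]
      rw [Set.mem_ofPred_eq, h3]
      simpa using h2
    exact absurd (closure_minimal h1 (hclosed _) (hz _ hUT)) (not_le.2 hm₁z)
  · obtain ⟨U, hU⟩ := exists_unitaryDilation hT
    have h1 : numericalRangeOn U ⊤ ⊆ {w : ℂ | (ω * w).re ≤ 1} := by
      rintro w ⟨y, -, hy, rfl⟩
      refine (Complex.re_le_norm _).trans ?_
      rw [norm_mul, hωn, one_mul]
      refine (norm_inner_le_norm _ _).trans ?_
      rw [norm_apply_of_mem_unitary hU.1, hy, one_mul]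
    exact absurd (closure_minimal h1 (hclosed _) (hz _ hU)) (not_le.2 (hm1.trans_lt hzm))

theorem isCompact_numericalRangeOn {H : Type*} [NormedAddCommGroup H] [InnerProductSpace ℂ H]
    (T : H →L[ℂ] H) (N : Submodule ℂ H) [FiniteDimensional ℂ N] :
    IsCompact (numericalRangeOn T N) := by
  have : FiniteDimensional ℝ N := FiniteDimensional.complexToReal N
  have : ProperSpace N := FiniteDimensional.proper ℝ N
  have h : numericalRangeOn T N = (fun x : N => ⟪(x : H), T x⟫_ℂ) '' Metric.sphere 0 1 := by
    ext z
    constructor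
    · rintro ⟨x, hxN, hx, rfl⟩
      exact ⟨⟨x, hxN⟩, by simpa using hx, rfl⟩
    · rintro ⟨x, hx, rfl⟩
      exact ⟨x, x.2, by simpa using hx, rfl⟩
  rw [h]
  exact (isCompact_sphere 0 1).image (by fun_prop)

variable {n : ℕ}

open scoped Pointwise in
/-- If `C` is a multiple `c` of the projection onto a line, then `W_C(T)` is `c` times the
classical numerical range. -/
theorem cNumericalRange_eq_smul {C : Matrix (Fin n) (Fin n) ℂ} (T : H →L[ℂ] H)
    {b : OrthonormalBasis (Fin n) ℂ (EuclideanSpace ℂ (Fin n))} {c : Fin n → ℂ}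
    (hb : ∀ i, matrixOp C (b i) = c i • b i) {i₀ : Fin n} (hc : ∀ j, j ≠ i₀ → c j = 0)
    (hH : (n : Cardinal) ≤ Module.rank ℂ H) :
    cNumericalRange C T = c i₀ • numericalRangeOn T ⊤ := by
  have hsum : ∀ x : Fin n → H, ∑ i, c i * ⟪x i, T (x i)⟫_ℂ = c i₀ * ⟪x i₀, T (x i₀)⟫_ℂ := by
    intro x
    exact Finset.sum_eq_single i₀ (fun j _ hj => by rw [hc j hj, zero_mul]) (by simp)
  ext z
  rw [mem_cNumericalRange_iff_of_diagonal T hb]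
  constructor
  · rintro ⟨x, hx, rfl⟩
    rw [hsum]
    exact ⟨_, ⟨x i₀, trivial, hx.1 i₀, rfl⟩, rfl⟩
  · rintro ⟨_, ⟨x, -, hx, rfl⟩, rfl⟩
    obtain ⟨y, hy, hyx⟩ := exists_orthonormal_extension hH {i₀} (fun _ => x) (by
      intro i hi j hj
      rw [Finset.mem_singleton] at hi hj
      rw [hi, hj, inner_self_eq_ofReal_norm_sq, hx]
      simp)
    refine ⟨y, hy, ?_⟩
    rw [hsum, hyx i₀ (by simp)]
    rfl

theorem rank_le_of_isDilation {H K : Type*} [NormedAddCommGroup H] [InnerProductSpace ℂ H]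
    [CompleteSpace H] [NormedAddCommGroup K] [InnerProductSpace ℂ K] [CompleteSpace K]
    {U : K →L[ℂ] K} {T : H →L[ℂ] H} (h : IsDilation U T) {n : ℕ}
    (hH : (n : Cardinal) ≤ Module.rank ℂ H) : (n : Cardinal) ≤ Module.rank ℂ K := by
  obtain ⟨X, -⟩ := h
  have h1 := LinearMap.lift_rank_le_of_injective X.toLinearMap X.injective
  have h2 := (Cardinal.lift_le.2 hH).trans h1
  simpa using h2

/-- The dilation formula for closed `C`-numerical ranges, for `C` a nonzero multiple of the
projection onto a line, where it reduces to the one for the classical numerical range. -/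
theorem closure_cNumericalRange_eq {C : Matrix (Fin n) (Fin n) ℂ} (hn : n ≠ 0)
    {b : OrthonormalBasis (Fin n) ℂ (EuclideanSpace ℂ (Fin n))} {c : Fin n → ℂ}
    (hb : ∀ i, matrixOp C (b i) = c i • b i) {i₀ : Fin n} (hc : ∀ j, j ≠ i₀ → c j = 0)
    (h0 : c i₀ ≠ 0) {H : Type u} [NormedAddCommGroup H] [InnerProductSpace ℂ H] [CompleteSpace H]
    (T : H →L[ℂ] H) (hH : (n : Cardinal) ≤ Module.rank ℂ H) (hT : ‖T‖ ≤ 1) :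
    closure (cNumericalRange C T) =
      {z : ℂ | ∀ (K : Type u) [NormedAddCommGroup K] [InnerProductSpace ℂ K]
        [CompleteSpace K] (U : K →L[ℂ] K), IsUnitaryDilation U T →
        z ∈ closure (cNumericalRange C U)} := by
  refine Set.Subset.antisymm (fun z hz K _ _ _ U hU =>
    closure_mono (cNumericalRange_mono C hU.2) hz) fun z hz => ?_
  have : Nontrivial H := by
    rw [← rank_pos_iff_nontrivial (R := ℂ)]
    refine lt_of_lt_of_le ?_ hH
    exact_mod_cast Nat.pos_of_ne_zero hn
  rw [cNumericalRange_eq_smul T hb hc hH, closure_smul₀' h0, Set.mem_smul_set_iff_inv_smul_mem₀ h0]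
  refine mem_closure_numericalRangeOn_of_forall_dilation hT fun U hU => ?_
  have h1 := hz _ U hU
  rwa [cNumericalRange_eq_smul U hb hc (rank_le_of_isDilation hU.2 hH), closure_smul₀' h0,
    Set.mem_smul_set_iff_inv_smul_mem₀ h0] at h1

end NumericalRange

/-! ### Quantitative local surjectivity -/

section LocalSurjectivity

variable {K : Type*} [NormedAddCommGroup K] [InnerProductSpace ℂ K]

/-- The real-linear map `ζ ↦ α ζ + β ζ̄` of `ℂ`. -/
noncomputable def realLinearMap (α β : ℂ) : ℂ →L[ℝ] ℂ :=
  α • ContinuousLinearMap.id ℝ ℂ + β • (Complex.conjCLE : ℂ →L[ℝ] ℂ)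

theorem realLinearMap_apply (α β ζ : ℂ) :
    realLinearMap α β ζ = α * ζ + β * (starRingEnd ℂ) ζ := by
  simp [realLinearMap]

/-- If `|α| ≠ |β|`, then `ζ ↦ α ζ + β ζ̄` is invertible with inverse bounded by
`1 / ||α| - |β||`. -/
noncomputable def realLinearMapRightInverse {α β : ℂ} {κ : ℝ} (hκ : 0 < κ)
    (h : κ ≤ |‖α‖ - ‖β‖|) : (realLinearMap α β).NonlinearRightInverse where
  toFun z := ((starRingEnd ℂ) α * z - β * (starRingEnd ℂ) z) / ((‖α‖ ^ 2 - ‖β‖ ^ 2 : ℝ) : ℂ)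
  nnnorm := ⟨κ⁻¹, inv_nonneg.2 hκ.le⟩
  bound' z := by
    have h1 : 0 < |‖α‖ - ‖β‖| := hκ.trans_le h
    have h2 : 0 < ‖α‖ + ‖β‖ := by
      refine lt_of_le_of_ne (by positivity) fun h0 => ?_
      have ha : ‖α‖ = 0 := by linarith [norm_nonneg α, norm_nonneg β]
      have hb : ‖β‖ = 0 := by linarith [norm_nonneg α, norm_nonneg β]
      rw [ha, hb] at h1
      simp at h1
    rw [norm_div, Complex.norm_real, Real.norm_eq_abs, sq_sub_sq, abs_mul, abs_of_pos h2]
    rw [div_le_iff₀ (mul_pos h2 h1)]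
    calc ‖(starRingEnd ℂ) α * z - β * (starRingEnd ℂ) z‖ ≤ ‖α‖ * ‖z‖ + ‖β‖ * ‖z‖ := by
          refine (norm_sub_le _ _).trans ?_
          simp
      _ = κ⁻¹ * ‖z‖ * ((‖α‖ + ‖β‖) * κ) := by field_simp
      _ ≤ κ⁻¹ * ‖z‖ * ((‖α‖ + ‖β‖) * |‖α‖ - ‖β‖|) := by gcongr
  right_inv' z := by
    have h0 : ((‖α‖ ^ 2 - ‖β‖ ^ 2 : ℝ) : ℂ) ≠ 0 := by
      have h1 : ‖α‖ ^ 2 - ‖β‖ ^ 2 ≠ 0 := by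
        intro h0
        have h2 : ‖α‖ = ‖β‖ := by
          rw [← sq_eq_sq₀ (norm_nonneg _) (norm_nonneg _)]; linarith
        rw [h2, sub_self, abs_zero] at h
        linarith
      exact_mod_cast h1
    rw [realLinearMap_apply, map_div₀, Complex.conj_ofReal, ← mul_div_assoc, ← mul_div_assoc,
      ← add_div, div_eq_iff h0]
    push_cast
    rw [← Complex.mul_conj', ← Complex.mul_conj']
    simp
    ring

/-- The radius of the disc produced by `exists_perturbation`. -/
noncomputable def perturbationRadius (κ M : ℝ) : ℝ := κ * min (1 / 2) (κ / (24 * M)) / 2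

theorem perturbationRadius_pos {κ M : ℝ} (hκ : 0 < κ) (hM : 0 < M) :
    0 < perturbationRadius κ M := by
  unfold perturbationRadius
  positivity

/-- **Quantitative local surjectivity.** With `d(q) = (√(1 - |q|²) - 1) x + q a`, the function
`q ↦ ⟨P, d⟩ + ⟨d, Q⟩ + c ⟨d, U d⟩` has differential `α q + β q̄` at `0`, where `α = ⟨P, a⟩` and
`β = ⟨a, Q⟩`. When `||α| - |β|| ≥ κ`, it covers a disc around `0` whose radius depends only on `κ`
and on a common bound `M` of the data. -/
theorem exists_perturbation {x a P Q : K} {U : K →L[ℂ] K} {c : ℂ} {κ M : ℝ}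
    (hx : ‖x‖ = 1) (ha : ‖a‖ = 1) (hU : ‖U‖ ≤ 1) (hP : ‖P‖ ≤ M) (hQ : ‖Q‖ ≤ M) (hc : ‖c‖ ≤ M)
    (hM : 0 < M) (hκ : 0 < κ) (h : κ ≤ |‖⟪P, a⟫_ℂ‖ - ‖⟪a, Q⟫_ℂ‖|) {z : ℂ}
    (hz : ‖z‖ ≤ perturbationRadius κ M) :
    ∃ q : ℂ, ‖q‖ ≤ 1 ∧ ∃ d : K, d = ((√(1 - ‖q‖ ^ 2) - 1 : ℝ) : ℂ) • x + q • a ∧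
      z = ⟪P, d⟫_ℂ + ⟪d, Q⟫_ℂ + c * ⟪d, U d⟫_ℂ := by
  set s : ℝ := min (1 / 2) (κ / (24 * M)) with hs
  have hs0 : 0 < s := by positivity
  have hs2 : s ≤ 1 / 2 := min_le_left _ _
  have hsκ : 12 * M * s ≤ κ / 2 := by
    have h1 : s ≤ κ / (24 * M) := min_le_right _ _
    rw [le_div_iff₀ (by positivity)] at h1
    linarith
  set p : ℂ → ℝ := fun q => √(1 - ‖q‖ ^ 2) with hp
  set d : ℂ → K := fun q => ((p q - 1 : ℝ) : ℂ) • x + q • a with hd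
  set F : ℂ → ℂ := fun q => ⟪P, d q⟫_ℂ + ⟪d q, Q⟫_ℂ + c * ⟪d q, U (d q)⟫_ℂ with hF
  have hp1 : ∀ q : ℂ, ‖q‖ ≤ s → 1 / 2 ≤ p q ∧ p q ^ 2 = 1 - ‖q‖ ^ 2 := by
    intro q hq
    have h1 : ‖q‖ ^ 2 ≤ 1 / 4 := by nlinarith [norm_nonneg q]
    refine ⟨Real.le_sqrt_of_sq_le (by linarith), Real.sq_sqrt (by linarith)⟩
  have hpp : ∀ q q' : ℂ, ‖q‖ ≤ s → ‖q'‖ ≤ s → |p q - p q'| ≤ 2 * s * ‖q - q'‖ := by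
    intro q q' hq hq'
    obtain ⟨h1, h2⟩ := hp1 q hq
    obtain ⟨h3, h4⟩ := hp1 q' hq'
    calc |p q - p q'| ≤ |p q - p q'| * (p q + p q') :=
          le_mul_of_one_le_right (abs_nonneg _) (by linarith)
      _ = |(p q - p q') * (p q + p q')| := by
          rw [abs_mul, abs_of_pos (by linarith : 0 < p q + p q')]
      _ = |(‖q‖ - ‖q'‖) * (‖q‖ + ‖q'‖)| := by
          rw [← abs_neg]; congr 1; linear_combination h4 - h2
      _ = |‖q‖ - ‖q'‖| * (‖q‖ + ‖q'‖) := by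
          rw [abs_mul, abs_of_nonneg (by positivity : 0 ≤ ‖q‖ + ‖q'‖)]
      _ ≤ ‖q - q'‖ * (2 * s) := by
          gcongr
          · exact abs_norm_sub_norm_le q q'
          · linarith
      _ = _ := mul_comm _ _
  have hp0 : p 0 = 1 := by simp [hp]
  have hd0 : d 0 = 0 := by simp [hd, hp0]
  have hdd : ∀ q q' : ℂ, d q - d q' = ((p q - p q' : ℝ) : ℂ) • x + (q - q') • a := by
    intro q q'
    simp only [hd]
    push_cast
    module
  have hdn : ∀ q q' : ℂ, ‖q‖ ≤ s → ‖q'‖ ≤ s → ‖d q - d q'‖ ≤ 2 * ‖q - q'‖ := by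
    intro q q' hq hq'
    rw [hdd]
    refine (norm_add_le _ _).trans ?_
    rw [norm_smul, norm_smul, hx, ha, Complex.norm_real, Real.norm_eq_abs]
    have h1 := hpp q q' hq hq'
    nlinarith [norm_nonneg (q - q')]
  have hdn0 : ∀ q : ℂ, ‖q‖ ≤ s → ‖d q‖ ≤ 2 * s := by
    intro q hq
    have h1 := hdn q 0 hq (by simpa using hs0.le)
    rw [hd0, sub_zero, sub_zero] at h1
    linarith
  have hFd : ∀ q q' : ℂ, F q - F q' - realLinearMap ⟪P, a⟫_ℂ ⟪a, Q⟫_ℂ (q - q') =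
      ((p q - p q' : ℝ) : ℂ) * (⟪P, x⟫_ℂ + ⟪x, Q⟫_ℂ) +
        c * (⟪d q - d q', U (d q)⟫_ℂ + ⟪d q', U (d q - d q')⟫_ℂ) := by
    intro q q'
    have h1 : F q - F q' = ⟪P, d q - d q'⟫_ℂ + ⟪d q - d q', Q⟫_ℂ +
        c * (⟪d q - d q', U (d q)⟫_ℂ + ⟪d q', U (d q - d q')⟫_ℂ) := by
      simp only [hF, map_sub, inner_sub_left, inner_sub_right]
      ring
    have h2 : ⟪P, d q - d q'⟫_ℂ + ⟪d q - d q', Q⟫_ℂ =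
        ((p q - p q' : ℝ) : ℂ) * (⟪P, x⟫_ℂ + ⟪x, Q⟫_ℂ) +
          realLinearMap ⟪P, a⟫_ℂ ⟪a, Q⟫_ℂ (q - q') := by
      rw [hdd, realLinearMap_apply]
      simp only [inner_add_left, inner_add_right, inner_smul_left, inner_smul_right,
        Complex.conj_ofReal]
      ring
    rw [h1, h2]
    ring
  have happ : ApproximatesLinearOn F (realLinearMap ⟪P, a⟫_ℂ ⟪a, Q⟫_ℂ)
      (Metric.closedBall 0 s) ⟨κ / 2, by positivity⟩ := by
    intro q hq q' hq'
    rw [mem_closedBall_zero_iff] at hq hq'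
    change _ ≤ κ / 2 * ‖q - q'‖
    rw [hFd]
    have h1 : ‖⟪P, x⟫_ℂ + ⟪x, Q⟫_ℂ‖ ≤ 2 * M := by
      refine (norm_add_le _ _).trans ?_
      have h2 := norm_inner_le_norm (𝕜 := ℂ) P x
      have h3 := norm_inner_le_norm (𝕜 := ℂ) x Q
      rw [hx] at h2 h3
      linarith
    have hUn : ∀ y, ‖U y‖ ≤ ‖y‖ := fun y => by simpa using U.le_of_opNorm_le hU y
    have h2 : ‖⟪d q - d q', U (d q)⟫_ℂ + ⟪d q', U (d q - d q')⟫_ℂ‖ ≤ 8 * s * ‖q - q'‖ := by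
      refine (norm_add_le _ _).trans ?_
      have h3 := (norm_inner_le_norm (𝕜 := ℂ) (d q - d q') (U (d q))).trans
        (mul_le_mul (hdn q q' hq hq') ((hUn _).trans (hdn0 q hq)) (norm_nonneg _) (by positivity))
      have h4 := (norm_inner_le_norm (𝕜 := ℂ) (d q') (U (d q - d q'))).trans
        (mul_le_mul (hdn0 q' hq') ((hUn _).trans (hdn q q' hq hq')) (norm_nonneg _)
          (by positivity))
      linarith
    calc _ ≤ (2 * s * ‖q - q'‖) * (2 * M) + M * (8 * s * ‖q - q'‖) := by
          refine (norm_add_le _ _).trans ?_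
          rw [norm_mul, norm_mul, Complex.norm_real, Real.norm_eq_abs]
          have h5 := hpp q q' hq hq'
          gcongr
      _ = 12 * M * s * ‖q - q'‖ := by ring
      _ ≤ κ / 2 * ‖q - q'‖ := by gcongr
  have hsurj := happ.surjOn_closedBall_of_nonlinearRightInverse
    (realLinearMapRightInverse hκ h) hs0.le subset_rfl
  have hF0 : F 0 = 0 := by simp [hF, hd0]
  have hrad : ((((realLinearMapRightInverse hκ h).nnnorm : ℝ)⁻¹ - κ / 2) * s)
      = perturbationRadius κ M := by
    change ((κ⁻¹)⁻¹ - κ / 2) * s = κ * s / 2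
    rw [inv_inv]
    ring
  obtain ⟨q, hq, rfl⟩ := hsurj (show z ∈ Metric.closedBall (F 0) _ by
    rw [hF0, mem_closedBall_zero_iff]
    exact hz.trans hrad.ge)
  rw [mem_closedBall_zero_iff] at hq
  exact ⟨q, by linarith, d q, rfl, rfl⟩

end LocalSurjectivity

/-! ### Discs in the `C`-numerical range -/

section Perturbation

variable {n : ℕ} {K : Type*} [NormedAddCommGroup K] [InnerProductSpace ℂ K]

/-- Rotating the vector `X v` of the range of an isometry `X` into the direction `a` orthogonal to
that range gives another isometry. -/
theorem exists_rotated_isometry {E : Type*} [NormedAddCommGroup E] [InnerProductSpace ℂ E]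
    (X : E →ₗᵢ[ℂ] K) {v : E} (hv : ‖v‖ = 1) {a : K}
    (ha : ‖a‖ = 1) (haX : ∀ h, ⟪X h, a⟫_ℂ = 0) {q : ℂ} (hq : ‖q‖ ≤ 1) :
    ∃ X' : E →ₗᵢ[ℂ] K, ∀ h, X' h = X h + ⟪v, h⟫_ℂ •
      (((√(1 - ‖q‖ ^ 2) - 1 : ℝ) : ℂ) • X v + q • a) := by
  set p := √(1 - ‖q‖ ^ 2) with hp
  have hp2 : p ^ 2 = 1 - ‖q‖ ^ 2 := Real.sq_sqrt (by nlinarith [norm_nonneg q])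
  set d : K := ((p - 1 : ℝ) : ℂ) • X v + q • a with hd
  have hXa : ∀ h, ⟪a, X h⟫_ℂ = 0 := fun h => inner_eq_zero_symm.1 (haX h)
  have hvv : ⟪v, v⟫_ℂ = 1 := by rw [inner_self_eq_ofReal_norm_sq, hv]; simp
  have haa : ⟪a, a⟫_ℂ = 1 := by rw [inner_self_eq_ofReal_norm_sq, ha]; simp
  have h1 : ∀ h, ⟪X h, d⟫_ℂ = ((p - 1 : ℝ) : ℂ) * ⟪h, v⟫_ℂ := fun h => by
    simp [hd, haX]
  have h2 : ∀ h, ⟪d, X h⟫_ℂ = ((p - 1 : ℝ) : ℂ) * ⟪v, h⟫_ℂ := fun h => by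
    rw [← inner_conj_symm, h1, map_mul, Complex.conj_ofReal, inner_conj_symm]
  have h3 : ⟪d, d⟫_ℂ = ((-2 * (p - 1) : ℝ) : ℂ) := by
    have h4 : ⟪d, d⟫_ℂ = ((p - 1 : ℝ) : ℂ) * ((p - 1 : ℝ) : ℂ) + q * (starRingEnd ℂ) q := by
      rw [hd]
      simp only [inner_add_left, inner_add_right, inner_smul_left, inner_smul_right,
        LinearIsometry.inner_map_map, hvv, haa, haX, hXa, Complex.conj_ofReal]
      ring
    rw [h4, Complex.mul_conj', ← Complex.ofReal_mul, ← Complex.ofReal_pow, ← Complex.ofReal_add]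
    congr 1
    linear_combination hp2
  let X₀ : E →ₗ[ℂ] K := X.toLinearMap + ((innerSL ℂ v).smulRight d).toLinearMap
  have hX₀ : ∀ h, X₀ h = X h + ⟪v, h⟫_ℂ • d := fun h => rfl
  refine ⟨X₀.isometryOfInner fun h k => ?_, fun h => rfl⟩
  rw [hX₀, hX₀]
  simp only [inner_add_left, inner_add_right, inner_smul_left, inner_smul_right,
    LinearIsometry.inner_map_map, h1, h2, h3, inner_conj_symm]
  push_cast
  ring

variable [CompleteSpace K]

theorem trace_sum_rotated (C : Matrix (Fin n) (Fin n) ℂ) (U : K →L[ℂ] K)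
    (b : OrthonormalBasis (Fin n) ℂ (EuclideanSpace ℂ (Fin n)))
    (X : EuclideanSpace ℂ (Fin n) →ₗᵢ[ℂ] K) (v : EuclideanSpace ℂ (Fin n)) (d : K) :
    ∑ i, ⟪X (b i) + ⟪v, b i⟫_ℂ • d,
        U (X (matrixOp C (b i)) + ⟪v, matrixOp C (b i)⟫_ℂ • d)⟫_ℂ =
      ∑ i, ⟪X (b i), U (X (matrixOp C (b i)))⟫_ℂ +
        (⟪ContinuousLinearMap.adjoint U (X (ContinuousLinearMap.adjoint (matrixOp C) v)), d⟫_ℂ +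
          ⟪d, U (X (matrixOp C v))⟫_ℂ + ⟪v, matrixOp C v⟫_ℂ * ⟪d, U d⟫_ℂ) := by
  have hrepr : ∀ w : EuclideanSpace ℂ (Fin n), ∑ i, ⟪b i, w⟫_ℂ • b i = w := fun w => by
    simpa [b.repr_apply_apply] using b.sum_repr w
  have e1 : ∑ i, ⟪v, matrixOp C (b i)⟫_ℂ * ⟪X (b i), U d⟫_ℂ =
      ⟪ContinuousLinearMap.adjoint U (X (ContinuousLinearMap.adjoint (matrixOp C) v)), d⟫_ℂ := by
    rw [ContinuousLinearMap.adjoint_inner_left]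
    conv_rhs => rw [← hrepr (ContinuousLinearMap.adjoint (matrixOp C) v), map_sum, sum_inner]
    refine Finset.sum_congr rfl fun i _ => ?_
    rw [map_smul, inner_smul_left, inner_conj_symm, ContinuousLinearMap.adjoint_inner_left]
  have e2 : ∑ i, ⟪b i, v⟫_ℂ * ⟪d, U (X (matrixOp C (b i)))⟫_ℂ = ⟪d, U (X (matrixOp C v))⟫_ℂ := by
    conv_rhs => rw [← hrepr v]
    simp
  have e3 : ∑ i, ⟪b i, v⟫_ℂ * ⟪v, matrixOp C (b i)⟫_ℂ = ⟪v, matrixOp C v⟫_ℂ := by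
    conv_rhs => rw [← hrepr v, map_sum]
    rw [hrepr v]
    simp
  rw [← e1, ← e2, ← e3, Finset.sum_mul, ← Finset.sum_add_distrib, ← Finset.sum_add_distrib,
    ← Finset.sum_add_distrib]
  refine Finset.sum_congr rfl fun i _ => ?_
  simp only [map_add, map_smul, inner_add_left, inner_add_right, inner_smul_left,
    inner_smul_right, inner_conj_symm]
  ring

/-- A point `tr (X* U X C)` of `W_C(U)` is surrounded by a disc in `W_C(U)`, with radius depending
only on `κ` and `‖C‖`, if rotating `X v` towards some `a ⊥ ran X` is nondegenerate to first
order. -/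
theorem mem_cNumericalRange_of_nondegenerate {C : Matrix (Fin n) (Fin n) ℂ} {U : K →L[ℂ] K}
    (hU : ‖U‖ ≤ 1) (b : OrthonormalBasis (Fin n) ℂ (EuclideanSpace ℂ (Fin n)))
    (X : EuclideanSpace ℂ (Fin n) →ₗᵢ[ℂ] K) {v : EuclideanSpace ℂ (Fin n)} (hv : ‖v‖ = 1) {a : K}
    (ha : ‖a‖ = 1) (haX : ∀ h, ⟪X h, a⟫_ℂ = 0) {κ M : ℝ} (hκ : 0 < κ) (hM : 0 < M)
    (hCM : ‖matrixOp C‖ ≤ M)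
    (h : κ ≤ |‖⟪ContinuousLinearMap.adjoint U (X (ContinuousLinearMap.adjoint (matrixOp C) v)),
      a⟫_ℂ‖ - ‖⟪a, U (X (matrixOp C v))⟫_ℂ‖|) {z : ℂ}
    (hz : ‖z - ∑ i, ⟪X (b i), U (X (matrixOp C (b i)))⟫_ℂ‖ ≤ perturbationRadius κ M) :
    z ∈ cNumericalRange C U := by
  have hUn : ∀ y, ‖U y‖ ≤ ‖y‖ := fun y => by simpa using U.le_of_opNorm_le hU y
  have hUn' : ∀ y, ‖ContinuousLinearMap.adjoint U y‖ ≤ ‖y‖ := fun y => by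
    simpa using (ContinuousLinearMap.adjoint U).le_of_opNorm_le
      ((LinearIsometryEquiv.norm_map _ U).le.trans hU) y
  have hCn : ‖matrixOp C v‖ ≤ M := by
    simpa [hv] using (matrixOp C).le_of_opNorm_le hCM v
  have hCn' : ‖ContinuousLinearMap.adjoint (matrixOp C) v‖ ≤ M := by
    simpa [hv] using (ContinuousLinearMap.adjoint (matrixOp C)).le_of_opNorm_le
      ((LinearIsometryEquiv.norm_map _ (matrixOp C)).le.trans hCM) v
  obtain ⟨q, hq, d, hd, hzd⟩ := exists_perturbation (x := X v) (a := a)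
    (P := ContinuousLinearMap.adjoint U (X (ContinuousLinearMap.adjoint (matrixOp C) v)))
    (Q := U (X (matrixOp C v))) (U := U) (c := ⟪v, matrixOp C v⟫_ℂ) (by simpa using hv) ha hU
    ((hUn' _).trans (by simpa using hCn')) ((hUn _).trans (by simpa using hCn))
    ((norm_inner_le_norm _ _).trans (by simpa [hv] using hCn)) hM hκ h hz
  obtain ⟨X', hX'⟩ := exists_rotated_isometry X hv ha haX hq
  rw [mem_cNumericalRange_iff C U b]
  refine ⟨X', ?_⟩
  simp only [hX', ← hd]
  rw [trace_sum_rotated, ← hzd]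
  ring

end Perturbation

/-! ### Gaps and nonnormal matrices -/

section Gap

variable {n : ℕ}

/-- `C` admits a *gap*: some rank-one nilpotent contraction `T` and some point `z` at positive
distance from `W_C(T)` lying in `W_C(U)` for every unitary dilation `U` of `T`. The separation is
expressed by a disc `‖w‖ ≤ R` that contains `W_C(T)` but not `z`. -/
def HasDilationGap (C : Matrix (Fin n) (Fin n) ℂ) : Prop :=
  ∃ T : Matrix (Fin n) (Fin n) ℂ, T.rank = 1 ∧ IsNilpotent T ∧ ‖matrixOp T‖ ≤ 1 ∧
    ∃ (z : ℂ) (R : ℝ), (∀ w ∈ cNumericalRange C (matrixOp T), ‖w‖ ≤ R) ∧ R < ‖z‖ ∧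
      ∀ (K : Type w) [NormedAddCommGroup K] [InnerProductSpace ℂ K] [CompleteSpace K]
        (U : K →L[ℂ] K), IsUnitaryDilation U (matrixOp T) → z ∈ cNumericalRange C U

theorem rank_eq_finrank_range_matrixOp (A : Matrix (Fin n) (Fin n) ℂ) :
    A.rank = Module.finrank ℂ (LinearMap.range (matrixOp A).toLinearMap) := by
  have h : (matrixOp A).toLinearMap = Matrix.toLin (PiLp.basisFun 2 ℂ (Fin n))
      (PiLp.basisFun 2 ℂ (Fin n)) A := by
    rw [← Matrix.toLpLin_eq_toLin]
    rfl
  rw [h]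
  exact Matrix.rank_eq_finrank_range_toLin A _ _

theorem isStarNormal_matrixOp_iff (A : Matrix (Fin n) (Fin n) ℂ) :
    IsStarNormal (matrixOp A) ↔ IsStarNormal A := by
  simp only [isStarNormal_iff, Commute, SemiconjBy, ContinuousLinearMap.star_eq_adjoint,
    ← matrixOp_star, ← matrixOp_mul]
  exact (Matrix.toEuclideanCLM (𝕜 := ℂ) (n := Fin n)).injective.eq_iff

/-- The rank-one nilpotent matrix `t u w*` of an orthonormal pair `u`, `w`. -/
theorem exists_rankOne_nilpotent {u w : EuclideanSpace ℂ (Fin n)} (hu : ‖u‖ = 1) (hw : ‖w‖ = 1)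
    (hwu : ⟪w, u⟫_ℂ = 0) {t : ℝ} (ht : 0 < t) :
    ∃ T : Matrix (Fin n) (Fin n) ℂ, T.rank = 1 ∧ IsNilpotent T ∧ ‖matrixOp T‖ ≤ t ∧
      ∀ x, matrixOp T x = ((t : ℂ) * ⟪w, x⟫_ℂ) • u := by
  set T := (Matrix.toEuclideanCLM (𝕜 := ℂ) (n := Fin n)).symm
    ((t : ℂ) • (innerSL ℂ w).smulRight u) with hT
  have hTx : ∀ x, matrixOp T x = ((t : ℂ) * ⟪w, x⟫_ℂ) • u := fun x => by
    simp [matrixOp, hT, mul_smul]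
  have ht' : (t : ℂ) ≠ 0 := by exact_mod_cast ht.ne'
  have hu0 : u ≠ 0 := norm_ne_zero_iff.1 (by rw [hu]; exact one_ne_zero)
  have hww : ⟪w, w⟫_ℂ = 1 := by rw [inner_self_eq_ofReal_norm_sq, hw]; simp
  refine ⟨T, ?_, ⟨2, ?_⟩, ?_, hTx⟩
  · have h : LinearMap.range (matrixOp T).toLinearMap = Submodule.span ℂ {u} := by
      apply le_antisymm
      · rintro _ ⟨x, rfl⟩
        exact Submodule.mem_span_singleton.2 ⟨_, (hTx x).symm⟩
      · rw [Submodule.span_singleton_le_iff_mem]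
        refine ⟨(t : ℂ)⁻¹ • w, ?_⟩
        change matrixOp T _ = _
        rw [hTx, inner_smul_right, hww, mul_one, mul_inv_cancel₀ ht', one_smul]
    rw [rank_eq_finrank_range_matrixOp, h, finrank_span_singleton hu0]
  · apply (Matrix.toEuclideanCLM (𝕜 := ℂ) (n := Fin n)).injective
    change matrixOp (T ^ 2) = Matrix.toEuclideanCLM (𝕜 := ℂ) (n := Fin n) 0
    rw [map_zero, sq, matrixOp_mul]
    ext1 x
    rw [mul_apply_eq_comp, hTx, hTx, inner_smul_right, hwu]
    simp
  · refine ContinuousLinearMap.opNorm_le_bound _ ht.le fun x => ?_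
    rw [hTx, norm_smul, norm_mul, hu, mul_one, Complex.norm_real, Real.norm_of_nonneg ht.le]
    gcongr
    simpa [hw] using norm_inner_le_norm (𝕜 := ℂ) w x

theorem norm_le_of_mem_cNumericalRange (C : Matrix (Fin n) (Fin n) ℂ) {H : Type*}
    [NormedAddCommGroup H] [InnerProductSpace ℂ H] [CompleteSpace H] {T : H →L[ℂ] H} {t M : ℝ}
    (ht : ‖T‖ ≤ t) (hM : ‖matrixOp C‖ ≤ M) {z : ℂ} (hz : z ∈ cNumericalRange C T) :
    ‖z‖ ≤ n * (t * M) := by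
  set b := EuclideanSpace.basisFun (Fin n) ℂ
  obtain ⟨X, rfl⟩ := (mem_cNumericalRange_iff C T b z).1 hz
  have h : ∀ i, ‖⟪X (b i), T (X (matrixOp C (b i)))⟫_ℂ‖ ≤ t * M := by
    intro i
    have ht0 : 0 ≤ t := (norm_nonneg _).trans ht
    refine (norm_inner_le_norm _ _).trans ?_
    rw [X.norm_map, b.norm_eq_one, one_mul]
    refine (T.le_of_opNorm_le ht _).trans ?_
    gcongr
    rw [X.norm_map]
    simpa [b.norm_eq_one] using (matrixOp C).le_of_opNorm_le hM (b i)
  calc _ ≤ ∑ i, ‖⟪X (b i), T (X (matrixOp C (b i)))⟫_ℂ‖ := norm_sum_le _ _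
    _ ≤ ∑ _i : Fin n, t * M := Finset.sum_le_sum fun i _ => h i
    _ = n * (t * M) := by simp

theorem sum_inner_mem_cNumericalRange (C T : Matrix (Fin n) (Fin n) ℂ)
    (b : OrthonormalBasis (Fin n) ℂ (EuclideanSpace ℂ (Fin n))) :
    ∑ i, ⟪b i, matrixOp T (matrixOp C (b i))⟫_ℂ ∈ cNumericalRange C (matrixOp T) :=
  (mem_cNumericalRange_iff C _ b _).2 ⟨LinearIsometry.id, rfl⟩

/-- If the quadratic forms of `C* (1 - T* T) C` and `C (1 - T T*) C*` differ by `Δ` at a unit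
vector, then every unitary dilation `U` of `T` has in `W_C(U)` a disc around `tr (C T)`, with
radius depending only on `Δ` and `‖C‖`: the two forms are the squared norms of the components of
`U X C v` and `U* X C* v` orthogonal to `ran X`. -/
theorem mem_cNumericalRange_of_defect_ne {C T : Matrix (Fin n) (Fin n) ℂ}
    {K : Type*} [NormedAddCommGroup K] [InnerProductSpace ℂ K] [CompleteSpace K]
    {U : K →L[ℂ] K} (hU : IsUnitaryDilation U (matrixOp T))
    (b : OrthonormalBasis (Fin n) ℂ (EuclideanSpace ℂ (Fin n)))
    {v : EuclideanSpace ℂ (Fin n)} (hv : ‖v‖ = 1) {Δ M : ℝ} (hΔ : 0 < Δ) (hM : 0 < M)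
    (hCM : ‖matrixOp C‖ ≤ M)
    (h : Δ ≤ |(‖matrixOp C v‖ ^ 2 - ‖matrixOp T (matrixOp C v)‖ ^ 2) -
      (‖ContinuousLinearMap.adjoint (matrixOp C) v‖ ^ 2 -
        ‖ContinuousLinearMap.adjoint (matrixOp T)
          (ContinuousLinearMap.adjoint (matrixOp C) v)‖ ^ 2)|) {z : ℂ}
    (hz : ‖z - ∑ i, ⟪b i, matrixOp T (matrixOp C (b i))⟫_ℂ‖ ≤
      perturbationRadius (Δ / (2 * M)) M) :
    z ∈ cNumericalRange C U := by
  obtain ⟨hUu, hUT⟩ := hU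
  obtain ⟨X, hX⟩ := isDilation_iff.1 hUT
  have hU1 : ‖U‖ ≤ 1 := U.opNorm_le_bound zero_le_one fun x => by
    rw [norm_apply_of_mem_unitary hUu, one_mul]
  have hUn : ∀ y, ‖U y‖ = ‖y‖ := norm_apply_of_mem_unitary hUu
  have hUn' : ∀ y, ‖ContinuousLinearMap.adjoint U y‖ = ‖y‖ :=
    norm_apply_of_mem_unitary (Unitary.star_mem hUu)
  have hX' : ∀ h k, ⟪X h, ContinuousLinearMap.adjoint U (X k)⟫_ℂ =
      ⟪h, ContinuousLinearMap.adjoint (matrixOp T) k⟫_ℂ := fun h k => by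
    rw [ContinuousLinearMap.adjoint_inner_right, ContinuousLinearMap.adjoint_inner_right,
      ← inner_conj_symm, hX, inner_conj_symm]
  -- The components orthogonal to the range of `X`, and their norms.
  have hperp : ∀ (y : K) (h₀ : EuclideanSpace ℂ (Fin n)), (∀ h, ⟪X h, y⟫_ℂ = ⟪h, h₀⟫_ℂ) →
      (∀ h, ⟪X h, y - X h₀⟫_ℂ = 0) ∧ ‖y - X h₀‖ ^ 2 = ‖y‖ ^ 2 - ‖h₀‖ ^ 2 := by
    intro y h₀ hy
    have h1 : ∀ h, ⟪X h, y - X h₀⟫_ℂ = 0 := fun h => by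
      rw [inner_sub_right, hy, X.inner_map_map, sub_self]
    refine ⟨h1, ?_⟩
    have h2 := norm_add_sq_eq_norm_sq_add_norm_sq_of_inner_eq_zero (𝕜 := ℂ) _ _ (h1 h₀)
    rw [add_sub_cancel, X.norm_map] at h2
    linarith [h2, sq (‖y‖), sq ‖h₀‖, sq ‖y - X h₀‖]
  set P := ContinuousLinearMap.adjoint U (X (ContinuousLinearMap.adjoint (matrixOp C) v)) with hP
  set Q := U (X (matrixOp C v)) with hQ
  obtain ⟨hP0, hPn⟩ := hperp P _ fun h => hX' h _
  obtain ⟨hQ0, hQn⟩ := hperp Q _ fun h => hX h _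
  set P₀ := P - X (ContinuousLinearMap.adjoint (matrixOp T)
    (ContinuousLinearMap.adjoint (matrixOp C) v)) with hP₀
  set Q₀ := Q - X (matrixOp T (matrixOp C v)) with hQ₀
  rw [hP, hUn', X.norm_map] at hPn
  rw [hQ, hUn, X.norm_map] at hQn
  rw [← hPn, ← hQn] at h
  have hCn : ‖matrixOp C v‖ ≤ M := by
    simpa [hv] using (matrixOp C).le_of_opNorm_le hCM v
  have hCn' : ‖ContinuousLinearMap.adjoint (matrixOp C) v‖ ≤ M := by
    simpa [hv] using (ContinuousLinearMap.adjoint (matrixOp C)).le_of_opNorm_le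
      ((LinearIsometryEquiv.norm_map _ (matrixOp C)).le.trans hCM) v
  have hPM : ‖P₀‖ ≤ M := by
    refine le_trans ?_ hCn'
    rw [← sq_le_sq₀ (norm_nonneg _) (norm_nonneg _), hPn]
    linarith [sq_nonneg ‖ContinuousLinearMap.adjoint (matrixOp T)
      (ContinuousLinearMap.adjoint (matrixOp C) v)‖]
  have hQM : ‖Q₀‖ ≤ M := by
    refine le_trans ?_ hCn
    rw [← sq_le_sq₀ (norm_nonneg _) (norm_nonneg _), hQn]
    linarith [sq_nonneg ‖matrixOp T (matrixOp C v)‖]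
  have hgap : Δ / (2 * M) ≤ |‖Q₀‖ - ‖P₀‖| := by
    rw [div_le_iff₀ (by positivity)]
    refine h.trans ?_
    rw [sq_sub_sq, abs_mul, abs_of_nonneg (by positivity : 0 ≤ ‖Q₀‖ + ‖P₀‖), mul_comm]
    gcongr
    linarith
  have hgap0 : 0 < |‖Q₀‖ - ‖P₀‖| := lt_of_lt_of_le (by positivity) hgap
  have hunit : ∀ y : K, 0 < ‖y‖ → ‖((‖y‖⁻¹ : ℝ) : ℂ) • y‖ = 1 := fun y hy => by
    rw [norm_smul, Complex.norm_real, norm_inv, norm_norm, inv_mul_cancel₀ hy.ne']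
  have hinner : ∀ y : K, 0 < ‖y‖ → ‖⟪y, ((‖y‖⁻¹ : ℝ) : ℂ) • y⟫_ℂ‖ = ‖y‖ := fun y hy => by
    rw [inner_smul_right, inner_self_eq_ofReal_norm_sq, ← Complex.ofReal_mul, Complex.norm_real,
      Real.norm_of_nonneg (by positivity)]
    field_simp
  have hsum : ∑ i, ⟪X (b i), U (X (matrixOp C (b i)))⟫_ℂ =
      ∑ i, ⟪b i, matrixOp T (matrixOp C (b i))⟫_ℂ := Finset.sum_congr rfl fun i _ => hX _ _
  -- For `a ⊥ ran X` only the orthogonal components matter.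
  have hfin : ∀ a : K, ‖a‖ = 1 → (∀ h, ⟪X h, a⟫_ℂ = 0) →
      Δ / (2 * M) ≤ |‖⟪P₀, a⟫_ℂ‖ - ‖⟪Q₀, a⟫_ℂ‖| → z ∈ cNumericalRange C U := by
    intro a ha haX hκ
    refine mem_cNumericalRange_of_nondegenerate hU1 b X hv ha haX (κ := Δ / (2 * M))
      (by positivity) hM hCM ?_
      (by rwa [hsum])
    rw [hP₀, hQ₀, inner_sub_left, inner_sub_left, haX, haX, sub_zero, sub_zero,
      norm_inner_symm Q] at hκ
    exact hκ
  rcases lt_or_ge ‖P₀‖ ‖Q₀‖ with hlt | hge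
  · have hQpos : 0 < ‖Q₀‖ := (norm_nonneg _).trans_lt hlt
    refine hfin _ (hunit Q₀ hQpos) (fun h => by rw [inner_smul_right, hQ0, mul_zero]) ?_
    rw [hinner _ hQpos, abs_sub_comm]
    refine hgap.trans ?_
    have h1 := norm_inner_le_norm (𝕜 := ℂ) P₀ (((‖Q₀‖⁻¹ : ℝ) : ℂ) • Q₀)
    rw [hunit Q₀ hQpos, mul_one] at h1
    rw [abs_of_pos (by linarith), abs_of_nonneg (by linarith)]
    linarith
  · have hPpos : 0 < ‖P₀‖ := by
      refine lt_of_lt_of_le (lt_of_lt_of_le hgap0 ?_) le_rfl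
      rw [abs_of_nonpos (by linarith)]
      linarith [norm_nonneg Q₀]
    refine hfin _ (hunit P₀ hPpos) (fun h => by rw [inner_smul_right, hP0, mul_zero]) ?_
    rw [hinner _ hPpos]
    refine hgap.trans ?_
    have h1 := norm_inner_le_norm (𝕜 := ℂ) Q₀ (((‖P₀‖⁻¹ : ℝ) : ℂ) • P₀)
    rw [hunit P₀ hPpos, mul_one] at h1
    rw [abs_of_nonpos (by linarith), abs_of_nonneg (by linarith)]
    linarith

/-- For a non-normal matrix `C` small multiples of any rank-one nilpotent matrix produce a gap. -/
theorem hasDilationGap_of_not_isStarNormal {C : Matrix (Fin n) (Fin n) ℂ} (hn : 2 ≤ n)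
    (hC : ¬ IsStarNormal C) : HasDilationGap.{w} C := by
  rw [← isStarNormal_matrixOp_iff, ContinuousLinearMap.isStarNormal_iff_norm_eq_adjoint] at hC
  push Not at hC
  obtain ⟨v₀, hv₀⟩ := hC
  have hv₀0 : ‖v₀‖ ≠ 0 := by
    intro h0
    rw [norm_eq_zero] at h0
    simp [h0] at hv₀
  obtain ⟨v, hv, hvC⟩ : ∃ v : EuclideanSpace ℂ (Fin n), ‖v‖ = 1 ∧
      ‖matrixOp C v‖ ≠ ‖ContinuousLinearMap.adjoint (matrixOp C) v‖ := by
    refine ⟨((‖v₀‖⁻¹ : ℝ) : ℂ) • v₀, ?_, ?_⟩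
    · rw [norm_smul, Complex.norm_real, norm_inv, norm_norm, inv_mul_cancel₀ hv₀0]
    · rw [map_smul, map_smul, norm_smul, norm_smul, Complex.norm_real, norm_inv, norm_norm]
      exact fun h => hv₀ (mul_left_cancel₀ (inv_ne_zero hv₀0) h)
  set M := ‖matrixOp C‖ + 1 with hM
  have hM0 : 0 < M := by positivity
  have hCM : ‖matrixOp C‖ ≤ M := by rw [hM]; linarith
  set Δ := |‖matrixOp C v‖ ^ 2 - ‖ContinuousLinearMap.adjoint (matrixOp C) v‖ ^ 2| with hΔ
  have hΔ0 : 0 < Δ := by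
    rw [hΔ, abs_pos, sub_ne_zero]
    exact fun h => hvC ((sq_eq_sq₀ (norm_nonneg _) (norm_nonneg _)).1 h)
  set ρ := perturbationRadius (Δ / 2 / (2 * M)) M with hρ
  have hρ0 : 0 < ρ := perturbationRadius_pos (by positivity) hM0
  have hn0 : (0 : ℝ) < n := by exact_mod_cast (by omega : 0 < n)
  set t := min 1 (min (Δ / (2 * M ^ 2)) (ρ / (3 * n * M))) with ht
  have ht0 : 0 < t := by positivity
  have ht1 : t ≤ 1 := min_le_left _ _
  have htΔ : t ^ 2 * M ^ 2 ≤ Δ / 2 := by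
    have h1 : t ≤ Δ / (2 * M ^ 2) := (min_le_right _ _).trans (min_le_left _ _)
    rw [le_div_iff₀ (by positivity)] at h1
    have h2 : t ^ 2 ≤ t := by nlinarith
    nlinarith [sq_nonneg M]
  have htρ : n * (t * M) ≤ ρ / 3 := by
    have h1 : t ≤ ρ / (3 * n * M) := (min_le_right _ _).trans (min_le_right _ _)
    rw [le_div_iff₀ (by positivity)] at h1
    linarith
  set b := EuclideanSpace.basisFun (Fin n) ℂ with hb
  obtain ⟨T, hT1, hT2, hT3, -⟩ := exists_rankOne_nilpotent (u := b ⟨0, by omega⟩)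
    (w := b ⟨1, by omega⟩) (b.norm_eq_one _) (b.norm_eq_one _)
    (b.orthonormal.2 (by simp [Fin.ext_iff])) ht0
  refine ⟨T, hT1, hT2, hT3.trans ht1, ((ρ / 2 : ℝ) : ℂ), n * (t * M), fun w hw =>
    norm_le_of_mem_cNumericalRange C hT3 hCM hw, ?_, fun K _ _ _ U hU => ?_⟩
  · rw [Complex.norm_real, Real.norm_of_nonneg (by positivity)]
    linarith
  · refine mem_cNumericalRange_of_defect_ne hU b hv (Δ := Δ / 2) (by positivity) hM0 hCM ?_ ?_
    · have hCn : ‖matrixOp C v‖ ≤ M := by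
        simpa [hv] using (matrixOp C).le_of_opNorm_le hCM v
      have hCn' : ‖ContinuousLinearMap.adjoint (matrixOp C) v‖ ≤ M := by
        simpa [hv] using (ContinuousLinearMap.adjoint (matrixOp C)).le_of_opNorm_le
          ((LinearIsometryEquiv.norm_map _ (matrixOp C)).le.trans hCM) v
      have h1 : ‖matrixOp T (matrixOp C v)‖ ^ 2 ≤ Δ / 2 := by
        refine le_trans ?_ htΔ
        rw [← mul_pow]
        gcongr
        exact ((matrixOp T).le_of_opNorm_le hT3 _).trans (by gcongr)
      have h2 : ‖ContinuousLinearMap.adjoint (matrixOp T)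
          (ContinuousLinearMap.adjoint (matrixOp C) v)‖ ^ 2 ≤ Δ / 2 := by
        refine le_trans ?_ htΔ
        rw [← mul_pow]
        gcongr
        exact ((ContinuousLinearMap.adjoint (matrixOp T)).le_of_opNorm_le
          ((LinearIsometryEquiv.norm_map _ (matrixOp T)).le.trans hT3) _).trans (by gcongr)
      set A := ‖matrixOp C v‖ ^ 2 - ‖ContinuousLinearMap.adjoint (matrixOp C) v‖ ^ 2
      set B := ‖ContinuousLinearMap.adjoint (matrixOp T)
          (ContinuousLinearMap.adjoint (matrixOp C) v)‖ ^ 2 - ‖matrixOp T (matrixOp C v)‖ ^ 2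
        with hB
      have h3 : |B| ≤ Δ / 2 := by
        rw [abs_le]
        constructor <;> rw [hB] <;> linarith [sq_nonneg ‖matrixOp T (matrixOp C v)‖,
          sq_nonneg ‖ContinuousLinearMap.adjoint (matrixOp T)
          (ContinuousLinearMap.adjoint (matrixOp C) v)‖]
      have h4 : |A| ≤ |A + B| + |B| := by
        simpa using abs_sub (A + B) B
      have h5 : Δ / 2 ≤ |A + B| := by linarith
      refine h5.trans (le_of_eq ?_)
      congr 1
      simp only [A, hB]
      ring
    · refine (norm_sub_le _ _).trans ?_
      have h1 := norm_le_of_mem_cNumericalRange C hT3 hCM (sum_inner_mem_cNumericalRange C T b)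
      rw [Complex.norm_real, Real.norm_of_nonneg (by positivity)]
      linarith

end Gap

/-! ### Diagonalization of normal matrices -/

section NormalMatrices

variable {n : ℕ}

theorem adjoint_apply_of_eigenvector {E : Type*} [NormedAddCommGroup E] [InnerProductSpace ℂ E]
    [CompleteSpace E] {T : E →L[ℂ] E} (hT : IsStarNormal T) {c : ℂ} {x : E} (hx : T x = c • x) :
    ContinuousLinearMap.adjoint T x = (starRingEnd ℂ) c • x := by
  have h1 : IsStarNormal (T - c • (1 : E →L[ℂ] E)) := by
    rw [isStarNormal_iff] at hT ⊢
    rw [star_sub, star_smul, star_one]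
    exact ((hT.sub_left ((Commute.one_left _).smul_left _)).sub_right
      (((Commute.one_right _).smul_right _).sub_left
        (((Commute.one_left _).smul_left _).smul_right _)))
  have h2 := (ContinuousLinearMap.IsStarNormal.adjoint_apply_eq_zero_iff h1 x).2 (by simp [hx])
  rw [map_sub, map_smulₛₗ, ← ContinuousLinearMap.star_eq_adjoint,
    ← ContinuousLinearMap.star_eq_adjoint, star_one] at h2
  rw [← ContinuousLinearMap.star_eq_adjoint]
  simpa [sub_eq_zero] using h2

/-- The **spectral theorem** for normal matrices. -/
theorem exists_orthonormalBasis_eigenvectors {C : Matrix (Fin n) (Fin n) ℂ} (hC : IsStarNormal C) :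
    ∃ (b : OrthonormalBasis (Fin n) ℂ (EuclideanSpace ℂ (Fin n))) (c : Fin n → ℂ),
      ∀ i, matrixOp C (b i) = c i • b i := by
  classical
  have hT := (isStarNormal_matrixOp_iff C).2 hC
  set T := matrixOp C
  have hrank : Module.rank ℂ (EuclideanSpace ℂ (Fin n)) = n := by
    rw [rank_eq_card_basis (EuclideanSpace.basisFun (Fin n) ℂ).toBasis, Fintype.card_fin]
  have key : ∀ J : Finset (Fin n), ∃ (y : Fin n → EuclideanSpace ℂ (Fin n)) (c : Fin n → ℂ),
      (∀ i ∈ J, ∀ j ∈ J, ⟪y i, y j⟫_ℂ = if i = j then 1 else 0) ∧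
      ∀ i ∈ J, T (y i) = c i • y i := by
    intro J
    induction J using Finset.induction_on with
    | empty => exact ⟨0, 0, by simp, by simp⟩
    | insert k J hk ih =>
      obtain ⟨y, c, hy, hc⟩ := ih
      have hcard : ((J.card : ℕ) : Cardinal) < Module.rank ℂ (EuclideanSpace ℂ (Fin n)) := by
        rw [hrank]
        have : J.card < n := by simpa using Finset.card_lt_univ_of_notMem hk
        exact_mod_cast this
      set N := Submodule.span ℂ (y '' (J : Set (Fin n)))
      have hNt : Nᗮ ≠ ⊥ := fun h =>
        span_ne_top_of_card_lt y J hcard (Submodule.orthogonal_eq_bot_iff.1 h)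
      have hinv : ∀ x ∈ Nᗮ, T x ∈ Nᗮ := by
        intro x hx
        rw [Submodule.mem_orthogonal] at hx ⊢
        intro a ha
        induction ha using Submodule.span_induction with
        | mem a ha =>
          obtain ⟨i, hi, rfl⟩ := ha
          rw [← ContinuousLinearMap.adjoint_inner_left,
            adjoint_apply_of_eigenvector hT (hc i hi), inner_smul_left,
            hx _ (Submodule.subset_span ⟨i, hi, rfl⟩), mul_zero]
        | zero => exact inner_zero_left _
        | add a a' _ _ h h' => rw [inner_add_left, h, h', add_zero]
        | smul s a _ h => rw [inner_smul_left, h, mul_zero]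
      have : Nontrivial Nᗮ := Submodule.nontrivial_iff_ne_bot.2 hNt
      obtain ⟨μ, hμ⟩ := Module.End.exists_eigenvalue (T.toLinearMap.restrict hinv)
      obtain ⟨x, hx⟩ := hμ.exists_hasEigenvector
      have hx1 : T (x : EuclideanSpace ℂ (Fin n)) = μ • (x : EuclideanSpace ℂ (Fin n)) :=
        congrArg Subtype.val hx.apply_eq_smul
      have hx0 : ‖(x : EuclideanSpace ℂ (Fin n))‖ ≠ 0 := by
        rw [norm_ne_zero_iff]
        exact fun h => hx.2 (Subtype.ext h)
      set a : EuclideanSpace ℂ (Fin n) :=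
        ((‖(x : EuclideanSpace ℂ (Fin n))‖⁻¹ : ℝ) : ℂ) • (x : EuclideanSpace ℂ (Fin n)) with ha
      have ha1 : ‖a‖ = 1 := by
        rw [ha, norm_smul, Complex.norm_real, norm_inv, norm_norm, inv_mul_cancel₀ hx0]
      have haT : T a = μ • a := by rw [ha, map_smul, hx1, smul_comm]
      have hya : ∀ i ∈ J, ⟪y i, a⟫_ℂ = 0 := fun i hi => by
        rw [ha, inner_smul_right,
          (Submodule.mem_orthogonal _ _).1 x.2 _ (Submodule.subset_span ⟨i, hi, rfl⟩), mul_zero]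
      have hay : ∀ i ∈ J, ⟪a, y i⟫_ℂ = 0 := fun i hi => inner_eq_zero_symm.1 (hya i hi)
      have hne : ∀ i ∈ J, i ≠ k := fun i hi h => hk (h ▸ hi)
      refine ⟨Function.update y k a, Function.update c k μ, ?_, ?_⟩
      · intro i hi j hj
        rw [Finset.mem_insert] at hi hj
        rcases hi with rfl | hi <;> rcases hj with rfl | hj
        · simp [ha1]
        · rw [Function.update_self, Function.update_of_ne (hne j hj), hay j hj,
            if_neg (hne j hj).symm]
        · rw [Function.update_self, Function.update_of_ne (hne i hi), hya i hi,
            if_neg (hne i hi)]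
        · rw [Function.update_of_ne (hne i hi), Function.update_of_ne (hne j hj), hy i hi j hj]
      · intro i hi
        rw [Finset.mem_insert] at hi
        rcases hi with rfl | hi
        · simpa using haT
        · rw [Function.update_of_ne (hne i hi), Function.update_of_ne (hne i hi), hc i hi]
  obtain ⟨y, c, hy, hc⟩ := key Finset.univ
  have hy' : Orthonormal ℂ y := orthonormal_iff_ite.2 fun i j => hy i (by simp) j (by simp)
  have hspan : Submodule.span ℂ (Set.range y) = ⊤ :=
    hy'.linearIndependent.span_eq_top_of_card_eq_finrank' (by simp)
  refine ⟨OrthonormalBasis.mk hy' hspan.ge, c, fun i => ?_⟩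
  rw [OrthonormalBasis.coe_mk]
  exact hc i (by simp)

theorem matrixOp_apply_of_diagonal {C : Matrix (Fin n) (Fin n) ℂ}
    {b : OrthonormalBasis (Fin n) ℂ (EuclideanSpace ℂ (Fin n))} {c : Fin n → ℂ}
    (hb : ∀ i, matrixOp C (b i) = c i • b i) (x : EuclideanSpace ℂ (Fin n)) :
    matrixOp C x = ∑ i, (c i * ⟪b i, x⟫_ℂ) • b i := by
  conv_lhs => rw [← b.sum_repr x, map_sum]
  refine Finset.sum_congr rfl fun i _ => ?_
  rw [map_smul, hb, smul_smul, b.repr_apply_apply, mul_comm]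

theorem adjoint_eq_self_of_diagonal {C : Matrix (Fin n) (Fin n) ℂ}
    {b : OrthonormalBasis (Fin n) ℂ (EuclideanSpace ℂ (Fin n))} {r : Fin n → ℝ}
    (hb : ∀ i, matrixOp C (b i) = (r i : ℂ) • b i) :
    ContinuousLinearMap.adjoint (matrixOp C) = matrixOp C := by
  symm
  rw [ContinuousLinearMap.eq_adjoint_iff]
  intro x y
  rw [matrixOp_apply_of_diagonal hb x, matrixOp_apply_of_diagonal hb y, sum_inner, inner_sum]
  refine Finset.sum_congr rfl fun i _ => ?_
  rw [inner_smul_left, inner_smul_right, map_mul, Complex.conj_ofReal, inner_conj_symm]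
  ring

/-- The rank of a diagonalizable matrix is one exactly when one eigenvalue is nonzero. -/
theorem rank_eq_one_iff_of_diagonal {C : Matrix (Fin n) (Fin n) ℂ}
    {b : OrthonormalBasis (Fin n) ℂ (EuclideanSpace ℂ (Fin n))} {c : Fin n → ℂ}
    (hb : ∀ i, matrixOp C (b i) = c i • b i) :
    C.rank = 1 ↔ ∃ i, c i ≠ 0 ∧ ∀ j, j ≠ i → c j = 0 := by
  rw [rank_eq_finrank_range_matrixOp]
  constructor
  · intro h
    have hmem : ∀ i, c i ≠ 0 → b i ∈ LinearMap.range (matrixOp C).toLinearMap := fun i hi => by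
      refine ⟨(c i)⁻¹ • b i, ?_⟩
      change matrixOp C _ = _
      rw [map_smul, hb, smul_smul, inv_mul_cancel₀ hi, one_smul]
    obtain ⟨i, hi⟩ : ∃ i, c i ≠ 0 := by
      by_contra! h0
      have : LinearMap.range (matrixOp C).toLinearMap = ⊥ := by
        rw [LinearMap.range_eq_bot]
        ext1 x
        change matrixOp C x = 0
        simp [matrixOp_apply_of_diagonal hb, h0]
      rw [this, finrank_bot] at h
      exact zero_ne_one h
    refine ⟨i, hi, fun j hji => ?_⟩
    by_contra hj
    obtain ⟨s, hs⟩ := (finrank_eq_one_iff_of_nonzero' (⟨b i, hmem i hi⟩ :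
      LinearMap.range (matrixOp C).toLinearMap) (by
        intro h0
        exact b.orthonormal.ne_zero i (congrArg Subtype.val h0))).1 h ⟨b j, hmem j hj⟩
    have hs' : s • b i = b j := congrArg Subtype.val hs
    have h1 : ⟪b j, b j⟫_ℂ = 0 := by
      conv_lhs => rw [← hs', inner_smul_left, hs']
      rw [b.orthonormal.2 hji.symm, mul_zero]
    exact b.orthonormal.ne_zero j (inner_self_eq_zero.1 h1)
  · rintro ⟨i, hi, hj⟩
    have hx : ∀ x, matrixOp C x = (c i * ⟪b i, x⟫_ℂ) • b i := fun x => by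
      rw [matrixOp_apply_of_diagonal hb]
      exact Finset.sum_eq_single i (fun j _ hji => by rw [hj j hji, zero_mul, zero_smul]) (by simp)
    have h : LinearMap.range (matrixOp C).toLinearMap = Submodule.span ℂ {b i} := by
      apply le_antisymm
      · rintro _ ⟨x, rfl⟩
        exact Submodule.mem_span_singleton.2 ⟨_, (hx x).symm⟩
      · rw [Submodule.span_singleton_le_iff_mem]
        refine ⟨(c i)⁻¹ • b i, ?_⟩
        change matrixOp C _ = _
        rw [map_smul, hb, smul_smul, inv_mul_cancel₀ hi, one_smul]
    rw [h, finrank_span_singleton (b.orthonormal.ne_zero i)]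

end NormalMatrices

/-! ### Hermitian matrices with nonzero extreme eigenvalues -/

section RealEigenvalues

variable {n : ℕ}

/-- For `C` with real eigenvalues in `[m, M]`, the range `W_C(u w*)` of a rank-one nilpotent
contraction lies in the disc of radius `(M - m) / 2`: since `⟨w, u⟩ = 0`, the eigenvalues may be
shifted by the midpoint of the interval. -/
theorem norm_le_of_mem_cNumericalRange_rankOne {C T : Matrix (Fin n) (Fin n) ℂ}
    {b : OrthonormalBasis (Fin n) ℂ (EuclideanSpace ℂ (Fin n))} {r : Fin n → ℝ}
    (hb : ∀ i, matrixOp C (b i) = (r i : ℂ) • b i) {m M : ℝ} (hr : ∀ i, m ≤ r i ∧ r i ≤ M)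
    {u v : EuclideanSpace ℂ (Fin n)} (hu : ‖u‖ = 1) (hv : ‖v‖ = 1) (hvu : ⟪v, u⟫_ℂ = 0)
    (hT : ∀ x, matrixOp T x = ⟪v, x⟫_ℂ • u) {z : ℂ}
    (hz : z ∈ cNumericalRange C (matrixOp T)) : ‖z‖ ≤ (M - m) / 2 := by
  obtain ⟨X, rfl⟩ := (mem_cNumericalRange_iff C _ b z).1 hz
  set y := b.map (X.toLinearIsometryEquiv rfl) with hy
  have hyX : ∀ i, X (b i) = y i := fun i => by simp [hy]
  have h1 : ∑ i, ⟪X (b i), matrixOp T (X (matrixOp C (b i)))⟫_ℂ =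
      ∑ i, ((r i - (M + m) / 2 : ℝ) : ℂ) * (⟪v, y i⟫_ℂ * ⟪y i, u⟫_ℂ) := by
    have h2 : ∑ i, ⟪v, y i⟫_ℂ * ⟪y i, u⟫_ℂ = 0 := by rw [y.sum_inner_mul_inner, hvu]
    have h3 : ∑ i, (((M + m) / 2 : ℝ) : ℂ) * (⟪v, y i⟫_ℂ * ⟪y i, u⟫_ℂ) = 0 := by
      rw [← Finset.mul_sum, h2, mul_zero]
    rw [← sub_zero (∑ i, ⟪X (b i), _⟫_ℂ), ← h3, ← Finset.sum_sub_distrib]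
    refine Finset.sum_congr rfl fun i _ => ?_
    rw [hb, map_smul, map_smul, hyX, hT, inner_smul_right, inner_smul_right]
    push_cast
    ring
  rw [h1]
  have hMm : ∀ i, |r i - (M + m) / 2| ≤ (M - m) / 2 := fun i => by
    rw [abs_le]
    constructor <;> linarith [(hr i).1, (hr i).2]
  calc _ ≤ ∑ i, ‖((r i - (M + m) / 2 : ℝ) : ℂ) * (⟪v, y i⟫_ℂ * ⟪y i, u⟫_ℂ)‖ := norm_sum_le _ _
    _ ≤ ∑ i, (M - m) / 2 * ((‖⟪v, y i⟫_ℂ‖ ^ 2 + ‖⟪y i, u⟫_ℂ‖ ^ 2) / 2) := by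
        refine Finset.sum_le_sum fun i _ => ?_
        rw [norm_mul, norm_mul, Complex.norm_real, Real.norm_eq_abs]
        refine mul_le_mul (hMm i) ?_ (by positivity) ((abs_nonneg _).trans (hMm i))
        linarith [two_mul_le_add_sq ‖⟪v, y i⟫_ℂ‖ ‖⟪y i, u⟫_ℂ‖]
    _ = (M - m) / 2 := by
        rw [← Finset.mul_sum, ← Finset.sum_div, Finset.sum_add_distrib]
        have h4 : ∑ i, ‖⟪v, y i⟫_ℂ‖ ^ 2 = 1 := by
          rw [y.sum_sq_norm_inner_left v, hv, one_pow]
        have h5 : ∑ i, ‖⟪y i, u⟫_ℂ‖ ^ 2 = 1 := by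
          rw [y.sum_sq_norm_inner_right u, hu, one_pow]
        rw [h4, h5]
        ring

/-- For an orthonormal pair `x, y`, the vectors `(x ± y) / √2` form an orthonormal pair. -/
theorem orthonormal_pair_rotated {E : Type*} [NormedAddCommGroup E] [InnerProductSpace ℂ E]
    {x y : E} (hx : ‖x‖ = 1) (hy : ‖y‖ = 1) (hxy : ⟪x, y⟫_ℂ = 0) :
    ‖((√2)⁻¹ : ℂ) • (x + y)‖ = 1 ∧ ‖((√2)⁻¹ : ℂ) • (x - y)‖ = 1 ∧
      ⟪((√2)⁻¹ : ℂ) • (x - y), ((√2)⁻¹ : ℂ) • (x + y)⟫_ℂ = 0 := by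
  have hyx : ⟪y, x⟫_ℂ = 0 := inner_eq_zero_symm.1 hxy
  have hxx : ⟪x, x⟫_ℂ = 1 := by rw [inner_self_eq_ofReal_norm_sq, hx]; simp
  have hyy : ⟪y, y⟫_ℂ = 1 := by rw [inner_self_eq_ofReal_norm_sq, hy]; simp
  have hs : (√2 : ℝ) ^ 2 = 2 := Real.sq_sqrt (by norm_num)
  have hs' : ‖((√2)⁻¹ : ℂ)‖ ^ 2 = 2⁻¹ := by
    rw [norm_inv, Complex.norm_real, Real.norm_of_nonneg (Real.sqrt_nonneg 2), inv_pow, hs]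
  have hnorm : ∀ a : E, ⟪a, a⟫_ℂ = 2 → ‖((√2)⁻¹ : ℂ) • a‖ = 1 := fun a ha => by
    have h1 : ‖a‖ ^ 2 = 2 := by
      rw [inner_self_eq_ofReal_norm_sq] at ha
      exact_mod_cast ha
    rw [← sq_eq_sq₀ (norm_nonneg _) zero_le_one, norm_smul, mul_pow, hs', h1]
    norm_num
  refine ⟨hnorm _ ?_, hnorm _ ?_, ?_⟩
  · simp only [inner_add_left, inner_add_right, hxx, hyy, hxy, hyx]; norm_num
  · simp only [inner_sub_left, inner_sub_right, hxx, hyy, hxy, hyx]; norm_num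
  · simp only [inner_smul_left, inner_smul_right, inner_sub_left, inner_add_right, hxx, hyy, hxy,
      hyx]
    simp

theorem inv_sqrt_two_mul_self : ((√2)⁻¹ : ℂ) * ((√2)⁻¹ : ℂ) = 1 / 2 := by
  rw [← mul_inv, ← Complex.ofReal_mul, Real.mul_self_sqrt (by norm_num)]
  norm_num

/-- A matrix with real eigenvalues whose extreme eigenvalues are both nonzero has a gap: at
`T = u w*`, with `u, w = (b i ± b k) / √2` built from extreme eigenvectors, the disc `W_C(T)` has
`tr (C T)` on its boundary, and this point is interior to all `W_C(U)`. -/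
theorem hasDilationGap_of_extreme_ne_zero {C : Matrix (Fin n) (Fin n) ℂ}
    {b : OrthonormalBasis (Fin n) ℂ (EuclideanSpace ℂ (Fin n))} {r : Fin n → ℝ}
    (hb : ∀ i, matrixOp C (b i) = (r i : ℂ) • b i) {i k : Fin n} (hik : i ≠ k)
    (hr : ∀ j, r k ≤ r j ∧ r j ≤ r i) (hi : r i ≠ 0) (hk : r k ≠ 0) :
    HasDilationGap.{w} C := by
  have hbi := b.norm_eq_one i
  have hbk := b.norm_eq_one k
  have hbik : ⟪b i, b k⟫_ℂ = 0 := b.orthonormal.2 hik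
  have hbki : ⟪b k, b i⟫_ℂ = 0 := b.orthonormal.2 hik.symm
  have hbii : ⟪b i, b i⟫_ℂ = 1 := by rw [inner_self_eq_ofReal_norm_sq, hbi]; simp
  have hbkk : ⟪b k, b k⟫_ℂ = 1 := by rw [inner_self_eq_ofReal_norm_sq, hbk]; simp
  obtain ⟨hu, hv, hvu⟩ := orthonormal_pair_rotated hbi hbk hbik
  set u := ((√2)⁻¹ : ℂ) • (b i + b k) with hu_def
  set v := ((√2)⁻¹ : ℂ) • (b i - b k) with hv_def
  obtain ⟨T, hT1, hT2, hT3, hT⟩ := exists_rankOne_nilpotent hu hv hvu one_pos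
  have hTx : ∀ x, matrixOp T x = ⟪v, x⟫_ℂ • u := fun x => by rw [hT]; simp
  have hTx' : ∀ x, ContinuousLinearMap.adjoint (matrixOp T) x = ⟪u, x⟫_ℂ • v := fun x => by
    refine ext_inner_left ℂ fun y => ?_
    rw [ContinuousLinearMap.adjoint_inner_right, hTx, inner_smul_left, inner_smul_right,
      inner_conj_symm, mul_comm]
  have hC' := adjoint_eq_self_of_diagonal hb
  have hs := inv_sqrt_two_mul_self
  have hCu : matrixOp C u = ((√2)⁻¹ : ℂ) • ((r i : ℂ) • b i + (r k : ℂ) • b k) := by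
    rw [hu_def, map_smul, map_add, hb, hb]
  have hvCu : ⟪v, matrixOp C u⟫_ℂ = (((r i - r k) / 2 : ℝ) : ℂ) := by
    rw [hCu, hv_def]
    simp only [inner_smul_left, inner_smul_right, inner_sub_left, inner_add_right, hbii, hbkk,
      hbik, hbki, map_inv₀, Complex.conj_ofReal]
    push_cast
    linear_combination ((r i : ℂ) - r k) * hs
  have huCu : ⟪u, matrixOp C u⟫_ℂ = (((r i + r k) / 2 : ℝ) : ℂ) := by
    rw [hCu, hu_def]
    simp only [inner_smul_left, inner_smul_right, inner_add_left, inner_add_right, hbii, hbkk,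
      hbik, hbki, map_inv₀, Complex.conj_ofReal]
    push_cast
    linear_combination ((r i : ℂ) + r k) * hs
  clear_value u v
  have hz₀ : ∑ j, ⟪b j, matrixOp T (matrixOp C (b j))⟫_ℂ = (((r i - r k) / 2 : ℝ) : ℂ) := by
    rw [← hvCu, matrixOp_apply_of_diagonal hb u, inner_sum]
    refine Finset.sum_congr rfl fun j _ => ?_
    rw [hb, map_smul, hTx, inner_smul_right, inner_smul_right, inner_smul_right]
    ring
  set M := ‖matrixOp C‖ + 1 with hM
  have hM0 : 0 < M := by positivity
  have hCM : ‖matrixOp C‖ ≤ M := by rw [hM]; linarith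
  -- As `⟨u, C u⟩ = (r i + r k) / 2` and `⟨v, C u⟩ = (r i - r k) / 2`, the two defects
  -- `‖C u‖² - ⟨v, C u⟩²` and `‖C u‖² - ⟨u, C u⟩²` differ by `r i * r k`.
  have hΔ0 : 0 < |r i * r k| := abs_pos.2 (mul_ne_zero hi hk)
  set ρ := perturbationRadius (|r i * r k| / (2 * M)) M with hρ
  have hρ0 : 0 < ρ := perturbationRadius_pos (by positivity) hM0
  have hrr : 0 ≤ (r i - r k) / 2 := by linarith [(hr i).1]
  refine ⟨T, hT1, hT2, hT3, (((r i - r k) / 2 + ρ : ℝ) : ℂ), (r i - r k) / 2, fun z hz =>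
    norm_le_of_mem_cNumericalRange_rankOne hb hr hu hv hvu hTx hz, ?_, fun K _ _ _ U hU => ?_⟩
  · rw [Complex.norm_real, Real.norm_of_nonneg (by positivity)]
    linarith
  · refine mem_cNumericalRange_of_defect_ne hU b hu hΔ0 hM0 hCM ?_ ?_
    · rw [hC', hTx, hTx', hvCu, huCu, norm_smul, norm_smul, hu, hv, Complex.norm_real,
        Complex.norm_real, Real.norm_eq_abs, Real.norm_eq_abs, mul_one, mul_one, sq_abs, sq_abs]
      refine le_of_eq ?_
      congr 1
      ring
    · rw [hz₀, ← Complex.ofReal_sub, Complex.norm_real, add_sub_cancel_left,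
        Real.norm_of_nonneg hρ0.le]

end RealEigenvalues

/-! ### Support functions of numerical ranges -/

section SupportFunctions

/-- A point of `ℂ` lies in a closed convex set if it satisfies all inequalities given by the
support function of the set. -/
theorem mem_of_forall_re_le {S : Set ℂ} (hS : Convex ℝ S) (hS' : IsClosed S) {z : ℂ}
    (h : ∀ ω : ℂ, ‖ω‖ = 1 → ∃ s ∈ S, (ω * z).re ≤ (ω * s).re) : z ∈ S := by
  by_contra hz
  obtain ⟨f, u, hfu, huz⟩ := geometric_hahn_banach_closed_point hS hS' hz
  set ω₀ : ℂ := f 1 - f Complex.I * Complex.I with hω₀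
  have hf : ∀ w, f w = (ω₀ * w).re := fun w => by
    have h1 : w = w.re • (1 : ℂ) + w.im • Complex.I := by simp
    conv_lhs => rw [h1, map_add, map_smul, map_smul]
    simp [hω₀]
    ring
  have hω0 : ω₀ ≠ 0 := by
    intro h0
    obtain ⟨s, hs, -⟩ := h 1 (by simp)
    have := (hfu s hs).trans huz
    simp [hf, h0] at this
  have hn : 0 < ‖ω₀‖ := norm_pos_iff.2 hω0
  obtain ⟨s, hs, hsz⟩ := h (((‖ω₀‖⁻¹ : ℝ) : ℂ) * ω₀) (by
    rw [norm_mul, Complex.norm_real, norm_inv, norm_norm, inv_mul_cancel₀ hn.ne'])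
  rw [mul_assoc, mul_assoc, Complex.re_ofReal_mul, Complex.re_ofReal_mul, ← hf, ← hf] at hsz
  have := le_of_mul_le_mul_left hsz (by positivity)
  linarith [hfu s hs]

theorem exists_phase (ζ : ℂ) : ∃ p : ℂ, ‖p‖ = 1 ∧ p * ζ = ‖ζ‖ := by
  rcases eq_or_ne ζ 0 with rfl | h
  · exact ⟨1, by simp, by simp⟩
  · have hn : (‖ζ‖ : ℂ) ≠ 0 := by simpa using h
    refine ⟨(starRingEnd ℂ) ζ / ‖ζ‖, ?_, ?_⟩
    · rw [norm_div, RCLike.norm_conj, Complex.norm_real, norm_norm, div_self (by simpa using h)]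
    · rw [div_mul_eq_mul_div, Complex.conj_mul', sq, mul_div_assoc, div_self hn, mul_one]

/-- The numerical range of the compression to the plane spanned by an orthonormal pair `e, f`
reaches far in every direction `q` in which the off-diagonal entries add up: rotate the phase of
`f` in `α e + β f`. -/
theorem exists_re_mul_mem_numericalRangeOn {H : Type*} [NormedAddCommGroup H]
    [InnerProductSpace ℂ H] (T : H →L[ℂ] H) {N : Submodule ℂ H} {e f : H} (he : e ∈ N)
    (hf : f ∈ N) (he1 : ‖e‖ = 1) (hf1 : ‖f‖ = 1) (hef : ⟪e, f⟫_ℂ = 0) {α β : ℝ}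
    (hαβ : α ^ 2 + β ^ 2 = 1) (q : ℂ) :
    ∃ y ∈ numericalRangeOn T N, (q * y).re =
      α * β * ‖q * ⟪e, T f⟫_ℂ + (starRingEnd ℂ) (q * ⟪f, T e⟫_ℂ)‖ +
        (q * (α ^ 2 * ⟪e, T e⟫_ℂ + β ^ 2 * ⟪f, T f⟫_ℂ)).re := by
  obtain ⟨p, hp, hpζ⟩ := exists_phase (q * ⟪e, T f⟫_ℂ + (starRingEnd ℂ) (q * ⟪f, T e⟫_ℂ))
  have hpp : p * (starRingEnd ℂ) p = 1 := by rw [Complex.mul_conj', hp]; simp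
  refine ⟨_, ⟨(α : ℂ) • e + ((β : ℂ) * p) • f, N.add_mem (N.smul_mem _ he) (N.smul_mem _ hf),
    ?_, rfl⟩, ?_⟩
  · rw [← sq_eq_sq₀ (norm_nonneg _) zero_le_one, sq,
      norm_add_sq_eq_norm_sq_add_norm_sq_of_inner_eq_zero (𝕜 := ℂ) _ _
      (by rw [inner_smul_left, inner_smul_right, hef, mul_zero, mul_zero]), norm_smul, norm_smul,
      norm_mul, he1, hf1, hp, Complex.norm_real, Complex.norm_real, Real.norm_eq_abs,
      Real.norm_eq_abs]
    simp only [mul_one]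
    rw [abs_mul_abs_self, abs_mul_abs_self, ← sq, ← sq, hαβ, one_pow]
  · have h1 : q * ⟪(α : ℂ) • e + ((β : ℂ) * p) • f, T ((α : ℂ) • e + ((β : ℂ) * p) • f)⟫_ℂ =
        ((α * β : ℝ) : ℂ) * (p * (q * ⟪e, T f⟫_ℂ) + (starRingEnd ℂ) p * (q * ⟪f, T e⟫_ℂ)) +
          q * (α ^ 2 * ⟪e, T e⟫_ℂ + β ^ 2 * ⟪f, T f⟫_ℂ) := by
      simp only [map_add, map_smul, inner_add_left, inner_add_right, inner_smul_left,
        inner_smul_right, map_mul, Complex.conj_ofReal]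
      push_cast
      linear_combination (q * β ^ 2 * ⟪f, T f⟫_ℂ) * hpp
    have h2 : ((starRingEnd ℂ) p * (q * ⟪f, T e⟫_ℂ)).re =
        (p * (starRingEnd ℂ) (q * ⟪f, T e⟫_ℂ)).re := by
      rw [← Complex.conj_re, map_mul, Complex.conj_conj]
    have h3 := congrArg Complex.re hpζ
    rw [mul_add, Complex.add_re, Complex.ofReal_re] at h3
    rw [h1, Complex.add_re, Complex.re_ofReal_mul, Complex.add_re, h2, h3]

end SupportFunctions

/-! ### Minkowski sums in the `C`-numerical range -/

section OrthogonalPairs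

variable {n : ℕ} {K : Type w} [NormedAddCommGroup K] [InnerProductSpace ℂ K]

theorem natCast_le_rank_of_linearIsometry (X : EuclideanSpace ℂ (Fin n) →ₗᵢ[ℂ] K) :
    (n : Cardinal) ≤ Module.rank ℂ K := by
  have h := LinearMap.lift_rank_le_of_injective X.toLinearMap X.injective
  rw [rank_eq_card_basis (EuclideanSpace.basisFun (Fin n) ℂ).toBasis, Fintype.card_fin] at h
  simpa using h

variable [CompleteSpace K]

open scoped Pointwise in
/-- Replacing two of the vectors `X b_j` by unit vectors of two orthogonal subspaces `N₁`, `N₂`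
gives a Minkowski sum of two numerical ranges inside `W_C(U)`; this sum is closed and convex, so
membership can be checked on its support function. Only the eigenvectors with index in `J`, which
contains all indices of nonzero eigenvalues, need to be orthogonal to `N₁` and `N₂`. -/
theorem mem_cNumericalRange_of_forall_re_le {C : Matrix (Fin n) (Fin n) ℂ}
    {b : OrthonormalBasis (Fin n) ℂ (EuclideanSpace ℂ (Fin n))} {c : Fin n → ℂ}
    (hb : ∀ i, matrixOp C (b i) = c i • b i) (U : K →L[ℂ] K)
    (X : EuclideanSpace ℂ (Fin n) →ₗᵢ[ℂ] K) {J : Finset (Fin n)} (hJ : ∀ j, j ∉ J → c j = 0)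
    {i l : Fin n} (hi : i ∈ J) (hl : l ∈ J) (hil : i ≠ l) (N₁ N₂ : Submodule ℂ K)
    [FiniteDimensional ℂ N₁] [FiniteDimensional ℂ N₂]
    (h₁₂ : ∀ x ∈ N₁, ∀ y ∈ N₂, ⟪x, y⟫_ℂ = 0)
    (h₁ : ∀ j ∈ J, j ≠ i → j ≠ l → ∀ x ∈ N₁, ⟪X (b j), x⟫_ℂ = 0)
    (h₂ : ∀ j ∈ J, j ≠ i → j ≠ l → ∀ x ∈ N₂, ⟪X (b j), x⟫_ℂ = 0)
    (hU : ∀ j ∈ J, j ≠ i → j ≠ l → ⟪X (b j), U (X (b j))⟫_ℂ = 0) {z : ℂ}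
    (hz : ∀ ω : ℂ, ‖ω‖ = 1 → ∃ y₁ ∈ numericalRangeOn U N₁, ∃ y₂ ∈ numericalRangeOn U N₂,
      (ω * z).re ≤ (ω * (c i * y₁ + c l * y₂)).re) :
    z ∈ cNumericalRange C U := by
  classical
  have hmem : z ∈ c i • numericalRangeOn U N₁ + c l • numericalRangeOn U N₂ := by
    refine mem_of_forall_re_le ?_ ?_ fun ω hω => ?_
    · exact ((convex_numericalRangeOn U N₁).linear_image
        ((LinearMap.mulLeft ℂ (c i)).restrictScalars ℝ)).add
        ((convex_numericalRangeOn U N₂).linear_image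
        ((LinearMap.mulLeft ℂ (c l)).restrictScalars ℝ))
    · exact (((isCompact_numericalRangeOn U N₁).smul (c i)).add
        ((isCompact_numericalRangeOn U N₂).smul (c l))).isClosed
    · obtain ⟨y₁, hy₁, y₂, hy₂, h⟩ := hz ω hω
      exact ⟨_, Set.add_mem_add (Set.smul_mem_smul_set hy₁) (Set.smul_mem_smul_set hy₂), h⟩
  obtain ⟨_, ⟨y₁, ⟨x₁, hx₁N, hx₁, rfl⟩, rfl⟩, _, ⟨y₂, ⟨x₂, hx₂N, hx₂, rfl⟩, rfl⟩, rfl⟩ := hmem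
  set x : Fin n → K := fun j => if j = i then x₁ else if j = l then x₂ else X (b j) with hx
  have hxi : x i = x₁ := by simp [hx]
  have hxl : x l = x₂ := by simp [hx, hil.symm]
  have hxj : ∀ j, j ≠ i → j ≠ l → x j = X (b j) := fun j h h' => by simp [hx, h, h']
  have hself : ∀ y : K, ‖y‖ = 1 → ⟪y, y⟫_ℂ = 1 := fun y hy => by
    rw [inner_self_eq_ofReal_norm_sq, hy]; simp
  have h21 : ⟪x₂, x₁⟫_ℂ = 0 := inner_eq_zero_symm.1 (h₁₂ x₁ hx₁N x₂ hx₂N)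
  obtain ⟨y, hy, hyx⟩ := exists_orthonormal_extension (natCast_le_rank_of_linearIsometry X) J x
    (by
      intro j hj j' hj'
      by_cases hji : j = i
      · subst hji
        rw [hxi]
        by_cases hj'i : j' = j
        · subst hj'i
          rw [hxi, hself _ hx₁, if_pos rfl]
        · rw [if_neg (Ne.symm hj'i)]
          by_cases hj'l : j' = l
          · rw [hj'l, hxl, h₁₂ x₁ hx₁N x₂ hx₂N]
          · rw [hxj j' hj'i hj'l, inner_eq_zero_symm, h₁ j' hj' hj'i hj'l x₁ hx₁N]
      · by_cases hjl : j = l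
        · subst hjl
          rw [hxl]
          by_cases hj'i : j' = i
          · rw [hj'i, hxi, h21, if_neg hji]
          · by_cases hj'l : j' = j
            · rw [hj'l, hxl, hself _ hx₂, if_pos rfl]
            · rw [if_neg (Ne.symm hj'l), hxj j' hj'i hj'l, inner_eq_zero_symm,
                h₂ j' hj' hj'i hj'l x₂ hx₂N]
        · rw [hxj j hji hjl]
          by_cases hj'i : j' = i
          · rw [hj'i, hxi, h₁ j hj hji hjl x₁ hx₁N, if_neg hji]
          · by_cases hj'l : j' = l
            · rw [hj'l, hxl, h₂ j hj hji hjl x₂ hx₂N, if_neg hjl]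
            · rw [hxj j' hj'i hj'l, X.inner_map_map, orthonormal_iff_ite.1 b.orthonormal])
  rw [mem_cNumericalRange_iff_of_diagonal U hb]
  refine ⟨y, hy, ?_⟩
  have hzero : ∀ j, j ≠ i ∧ j ≠ l → c j * ⟪y j, U (y j)⟫_ℂ = 0 := by
    rintro j ⟨hji, hjl⟩
    by_cases hj : j ∈ J
    · rw [hyx j hj, hxj j hji hjl, hU j hj hji hjl, mul_zero]
    · rw [hJ j hj, zero_mul]
  rw [Fintype.sum_eq_add i l hil hzero, hyx i hi, hyx l hl, hxi, hxl]
  rfl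

end OrthogonalPairs

/-! ### Normal matrices with eigenvalues of nonreal ratio -/

section NonrealRatio

variable {n : ℕ} {K : Type*} [NormedAddCommGroup K] [InnerProductSpace ℂ K]

theorem inner_eq_zero_of_mem_span_pair {z x y : K} (hx : ⟪z, x⟫_ℂ = 0) (hy : ⟪z, y⟫_ℂ = 0) :
    ∀ v ∈ Submodule.span ℂ {x, y}, ⟪z, v⟫_ℂ = 0 := by
  intro v hv
  obtain ⟨a, b, rfl⟩ := Submodule.mem_span_pair.1 hv
  rw [inner_add_right, inner_smul_right, inner_smul_right, hx, hy, mul_zero, mul_zero, add_zero]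

/-- A unit vector nearly parallel to `v` is nearly orthogonal to every `x ⊥ v`. -/
theorem norm_inner_le_of_le_norm_inner {v x y : K} (hv : ‖v‖ = 1) (hx : ‖x‖ = 1)
    (hvx : ⟪v, x⟫_ℂ = 0) (hy : ‖y‖ = 1) {σ : ℝ} (hσ : 0 ≤ σ)
    (h : 1 - σ ^ 2 / 2 ≤ ‖⟪v, y⟫_ℂ‖) : ‖⟪x, y⟫_ℂ‖ ≤ σ := by
  set y' := y - ⟪v, y⟫_ℂ • v with hy'
  have h1 : ⟪⟪v, y⟫_ℂ • v, y'⟫_ℂ = 0 := by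
    rw [hy', inner_smul_left, inner_sub_right, inner_smul_right, inner_self_eq_ofReal_norm_sq, hv]
    simp
  have h2 := norm_add_sq_eq_norm_sq_add_norm_sq_of_inner_eq_zero (𝕜 := ℂ) _ _ h1
  rw [hy', add_sub_cancel, ← hy', norm_smul, hv, hy] at h2
  have h3 : ⟪x, y⟫_ℂ = ⟪x, y'⟫_ℂ := by
    rw [hy', inner_sub_right, inner_smul_right, inner_eq_zero_symm.1 hvx, mul_zero, sub_zero]
  have h4 : ‖⟪x, y'⟫_ℂ‖ ≤ ‖y'‖ := by simpa [hx] using norm_inner_le_norm (𝕜 := ℂ) x y'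
  rw [h3]
  refine h4.trans ?_
  rw [← sq_le_sq₀ (norm_nonneg _) hσ]
  nlinarith [norm_nonneg ⟪v, y⟫_ℂ]

/-- If `p` and `q` are not real multiples of each other, then `p γ + p̄` and `q γ + q̄` do not
vanish simultaneously. -/
theorem two_mul_abs_im_div_le {p q γ : ℂ} {M : ℝ} (hM : 0 < M) (hp : ‖p‖ ≤ M) (hq : ‖q‖ ≤ M) :
    2 * |(p * (starRingEnd ℂ) q).im| / M ≤
      ‖p * γ + (starRingEnd ℂ) p‖ + ‖q * γ + (starRingEnd ℂ) q‖ := by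
  have h1 : (p * γ + (starRingEnd ℂ) p) * q - (q * γ + (starRingEnd ℂ) q) * p =
      -(((2 * (p * (starRingEnd ℂ) q).im : ℝ) : ℂ) * Complex.I) := by
    rw [← Complex.sub_conj (p * (starRingEnd ℂ) q), map_mul, Complex.conj_conj]
    ring
  have h2 := congrArg norm h1
  rw [norm_neg, norm_mul, Complex.norm_I, mul_one, Complex.norm_real, Real.norm_eq_abs, abs_mul,
    abs_two] at h2
  rw [div_le_iff₀ hM, ← h2]
  refine (norm_sub_le _ _).trans ?_
  rw [norm_mul, norm_mul, add_mul]
  gcongr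

/-- Stability of `‖q γ + q̄‖` under a change of `γ` and under rescaling the two summands by `ν⁻¹`
and `ν`, for `ν = √(1 - t²)` close to `1`. -/
theorem norm_sub_le_norm_of_sq_add_sq_eq_one {q γ₁ γ₂ : ℂ} {ν t M δ : ℝ} (hν0 : 0 < ν)
    (hν1 : ν ≤ 1) (hν2 : ν ^ 2 = 1 - t ^ 2) (hq : ‖q‖ ≤ M) (hγ : ‖γ₁ - γ₂‖ ≤ δ) :
    ‖q * γ₁ + (starRingEnd ℂ) q‖ - M * δ - M * t ^ 2 ≤
      ‖q * (((ν⁻¹ : ℝ) : ℂ) * γ₂) + (starRingEnd ℂ) (q * ν)‖ := by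
  have hM : 0 ≤ M := (norm_nonneg _).trans hq
  have hνC : (ν : ℂ) ≠ 0 := by exact_mod_cast hν0.ne'
  have hν2C : (ν : ℂ) ^ 2 = 1 - (t : ℂ) ^ 2 := by exact_mod_cast hν2
  set B := q * (((ν⁻¹ : ℝ) : ℂ) * γ₂) + (starRingEnd ℂ) (q * ν)
  have h3 : q * γ₁ + (starRingEnd ℂ) q =
      ν * B + q * (γ₁ - γ₂) + (starRingEnd ℂ) q * ((t ^ 2 : ℝ) : ℂ) := by
    simp only [B, map_mul, Complex.conj_ofReal]
    push_cast
    field_simp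
    linear_combination -(starRingEnd ℂ) q * hν2C
  have h4 : ‖(ν : ℂ) * B‖ ≤ ‖B‖ := by
    rw [norm_mul, Complex.norm_real, Real.norm_of_nonneg hν0.le]
    exact mul_le_of_le_one_left (norm_nonneg _) hν1
  have h5 : ‖q * (γ₁ - γ₂)‖ ≤ M * δ := by rw [norm_mul]; gcongr
  have h6 : ‖(starRingEnd ℂ) q * ((t ^ 2 : ℝ) : ℂ)‖ ≤ M * t ^ 2 := by
    rw [norm_mul, RCLike.norm_conj, Complex.norm_real, Real.norm_of_nonneg (sq_nonneg t)]
    gcongr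
  rw [h3]
  linarith [norm_add₃_le (a := (ν : ℂ) * B) (b := q * (γ₁ - γ₂))
    (c := (starRingEnd ℂ) q * ((t ^ 2 : ℝ) : ℂ))]

variable [CompleteSpace K]

/-- A dichotomy for unitary dilations `U` of a small matrix `T`: either `W_C(U)` contains a fixed
disc around `0`, or every unit vector `X v` is almost an eigenvector of `U²`. The disc comes from
rotating `X v` towards the component of `U X v` orthogonal to `ran X`. -/
theorem mem_cNumericalRange_or_le_norm_inner_sq {C T : Matrix (Fin n) (Fin n) ℂ}
    (hC : IsStarNormal C) {b : OrthonormalBasis (Fin n) ℂ (EuclideanSpace ℂ (Fin n))}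
    {c : Fin n → ℂ} (hb : ∀ i, matrixOp C (b i) = c i • b i) {U : K →L[ℂ] K}
    (hU : U ∈ unitary (K →L[ℂ] K)) (X : EuclideanSpace ℂ (Fin n) →ₗᵢ[ℂ] K)
    (hX : ∀ h k, ⟪X h, U (X k)⟫_ℂ = ⟪h, matrixOp T k⟫_ℂ) {i : Fin n} (hi : c i ≠ 0) {t κ M : ℝ}
    (ht : ‖matrixOp T‖ ≤ t) (ht1 : t < 1) (hκ : 0 < κ) (hM : 0 < M) (hCM : ‖matrixOp C‖ ≤ M)
    {v : EuclideanSpace ℂ (Fin n)} (hv : ‖v‖ = 1) {z : ℂ}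
    (hz : ‖z‖ + n * (t * M) ≤ perturbationRadius (‖c i‖ * κ) M) :
    z ∈ cNumericalRange C U ∨ 1 - 2 * t - κ ≤ ‖⟪X v, U (U (X v))⟫_ℂ‖ := by
  by_contra! hcon
  obtain ⟨hzU, hlt⟩ := hcon
  apply hzU
  have ht0 : 0 ≤ t := (norm_nonneg _).trans ht
  have hUn := norm_apply_of_mem_unitary hU
  have hvv : ⟪v, v⟫_ℂ = 1 := by rw [inner_self_eq_ofReal_norm_sq, hv]; simp
  have hrank : (n : Cardinal) ≤ Module.rank ℂ (EuclideanSpace ℂ (Fin n)) := by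
    rw [rank_eq_card_basis (EuclideanSpace.basisFun (Fin n) ℂ).toBasis, Fintype.card_fin]
  obtain ⟨y, hy, hyv⟩ := exists_orthonormal_extension hrank {i} (fun _ => v) (by
    intro j hj j' hj'
    rw [Finset.mem_singleton] at hj hj'
    rw [hj, hj', hvv, if_pos rfl])
  have hyv' : y i = v := hyv i (Finset.mem_singleton_self i)
  obtain ⟨R, hR⟩ := exists_linearIsometry_apply_eq b hy
  have hTv : ‖X (matrixOp T v)‖ ≤ t := by
    rw [X.norm_map]
    simpa [hv] using (matrixOp T).le_of_opNorm_le ht v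
  set f₀ := U (X v) - X (matrixOp T v) with hf₀
  have hf₀X : ∀ h, ⟪X h, f₀⟫_ℂ = 0 := fun h => by
    rw [hf₀, inner_sub_right, hX, X.inner_map_map, sub_self]
  set ν := ‖f₀‖ with hν
  have hν2 : 1 = ‖X (matrixOp T v)‖ ^ 2 + ν ^ 2 := by
    have h1 := norm_add_sq_eq_norm_sq_add_norm_sq_of_inner_eq_zero (𝕜 := ℂ) _ _
      (hf₀X (matrixOp T v))
    rw [hf₀, add_sub_cancel, hUn, X.norm_map v, hv, ← hf₀] at h1
    linarith [h1, sq ‖X (matrixOp T v)‖, sq ν]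
  have hTv2 : ‖X (matrixOp T v)‖ ^ 2 ≤ t := by
    nlinarith [norm_nonneg (X (matrixOp T v))]
  have hν1 : ν ≤ 1 := by
    rw [← sq_le_sq₀ (norm_nonneg _) zero_le_one]
    linarith [sq_nonneg ‖X (matrixOp T v)‖]
  have hν0 : 0 < ν := by
    refine lt_of_le_of_ne (norm_nonneg _) fun h => ?_
    rw [← h] at hν2
    linarith
  obtain ⟨a, ha⟩ : ∃ a, a = ((ν⁻¹ : ℝ) : ℂ) • f₀ := ⟨_, rfl⟩
  have ha1 : ‖a‖ = 1 := by
    rw [ha, norm_smul, Complex.norm_real, norm_inv, Real.norm_of_nonneg hν0.le, ← hν,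
      inv_mul_cancel₀ hν0.ne']
  have haX : ∀ h, ⟪X h, a⟫_ℂ = 0 := fun h => by rw [ha, inner_smul_right, hf₀X, mul_zero]
  have haU : ‖⟪a, U (X v)⟫_ℂ‖ = ν := by
    have h1 : U (X v) = f₀ + X (matrixOp T v) := by rw [hf₀, sub_add_cancel]
    rw [h1, inner_add_right, inner_eq_zero_symm.1 (haX _), add_zero, ha, inner_smul_left,
      inner_self_eq_ofReal_norm_sq, norm_mul, RCLike.norm_conj, Complex.norm_real,
      Complex.norm_real, Real.norm_of_nonneg (by positivity), Real.norm_of_nonneg (by positivity),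
      ← hν]
    field_simp
  have haU' : ν * ‖⟪X v, U a⟫_ℂ‖ ≤ ‖⟪X v, U (U (X v))⟫_ℂ‖ + t := by
    have h1 : ν * ‖⟪X v, U a⟫_ℂ‖ = ‖⟪X v, U f₀⟫_ℂ‖ := by
      rw [ha, map_smul, inner_smul_right, norm_mul, Complex.norm_real,
        Real.norm_of_nonneg (by positivity)]
      field_simp
    rw [h1, hf₀, map_sub, inner_sub_right]
    refine (norm_sub_le _ _).trans ?_
    gcongr
    refine (norm_inner_le_norm _ _).trans ?_
    rw [X.norm_map, hv, one_mul, hUn]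
    exact hTv
  have hgap : κ ≤ ν - ‖⟪X v, U a⟫_ℂ‖ := by
    refine le_of_mul_le_mul_left ?_ hν0
    have : ν * κ ≤ κ := mul_le_of_le_one_left hκ.le hν1
    rw [mul_sub]
    linarith [sq ν]
  have hRb : (X.comp R) (b i) = X v := by
    change X (R (b i)) = X v
    rw [hR, hyv']
  refine mem_cNumericalRange_of_nondegenerate (U.opNorm_le_bound zero_le_one fun x => by
    rw [hUn, one_mul]) b (X.comp R) (b.norm_eq_one i) ha1 (fun h => haX _)
    (κ := ‖c i‖ * κ) (by positivity) hM hCM ?_ ?_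
  · rw [adjoint_apply_of_eigenvector ((isStarNormal_matrixOp_iff C).2 hC) (hb i), hb, map_smul,
      map_smul, map_smul, map_smul, hRb, inner_smul_left, inner_smul_right, norm_mul, norm_mul,
      Complex.conj_conj, ← mul_sub, abs_mul, abs_of_nonneg (norm_nonneg (c i)), abs_sub_comm, haU,
      ContinuousLinearMap.adjoint_inner_left]
    gcongr
    exact hgap.trans (le_abs_self _)
  · refine (norm_sub_le _ _).trans (le_trans ?_ hz)
    gcongr
    refine norm_le_of_mem_cNumericalRange C ht hCM ((mem_cNumericalRange_iff C _ b _).2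
      ⟨R, Finset.sum_congr rfl fun j _ => ?_⟩)
    exact hX (R (b j)) (R (matrixOp C (b j)))

set_option maxHeartbeats 800000 in
/-- If two nonzero eigenvalues of a normal matrix have a nonreal ratio, small multiples of
`b_i b_k*` produce a gap: for a unitary dilation `U` that is not covered by
`mem_cNumericalRange_or_le_norm_inner_sq`, the operator `U²` is nearly a scalar `γ` on `X b_i` and
`X b_k`. The planes spanned by `X b_i, U X b_i` and by `X b_k, U X b_k` then contribute nearly the
segments `[-c_i s, c_i s]` and `[-c_k s, c_k s]` with `s² = γ` to `W_C(U)`, and as these are not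
parallel, their sum contains a disc around `0`. -/
theorem hasDilationGap_of_im_ne_zero {C : Matrix (Fin n) (Fin n) ℂ} (hC : IsStarNormal C)
    {b : OrthonormalBasis (Fin n) ℂ (EuclideanSpace ℂ (Fin n))} {c : Fin n → ℂ}
    (hb : ∀ i, matrixOp C (b i) = c i • b i) {i k : Fin n}
    (hik : (c i * (starRingEnd ℂ) (c k)).im ≠ 0) : HasDilationGap.{w} C := by
  have hne : i ≠ k := by
    rintro rfl
    simp [Complex.mul_conj] at hik
  have hi : c i ≠ 0 := by
    rintro h
    simp [h] at hik
  have hn0 : (0 : ℝ) < n := by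
    have := i.pos
    exact_mod_cast this
  set M := ‖matrixOp C‖ + 1 with hM
  have hM0 : 0 < M := by positivity
  have hCM : ‖matrixOp C‖ ≤ M := by rw [hM]; linarith
  have hcM : ∀ j, ‖c j‖ ≤ M := fun j => by
    have h := (matrixOp C).le_of_opNorm_le hCM (b j)
    rwa [hb, norm_smul, b.norm_eq_one, mul_one, mul_one] at h
  set Δ := |(c i * (starRingEnd ℂ) (c k)).im| with hΔ
  have hΔ0 : 0 < Δ := abs_pos.2 hik
  -- `σ` bounds the deviation of `U²` from a scalar, `ρ` is the radius of the disc around `0` in all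
  -- `W_C(U)`, and `t` is so small that `W_C(T)` has radius at most `ρ / 2`.
  set σ := Δ / (8 * M ^ 2) with hσ
  have hσ0 : 0 < σ := by positivity
  set κ := σ ^ 2 / 4 with hκ
  have hκ0 : 0 < κ := by positivity
  set ρ := min (perturbationRadius (‖c i‖ * κ) M / 2) (Δ / (2 * M)) with hρ
  have hρ0 : 0 < ρ := lt_min
    (half_pos (perturbationRadius_pos (mul_pos (norm_pos_iff.2 hi) hκ0) hM0)) (by positivity)
  set t := min (1 / 2) (min (σ ^ 2 / 8) (min (Δ / (6 * M ^ 2)) (ρ / (2 * n * M)))) with ht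
  have ht0 : 0 < t := by positivity
  have ht2 : t ≤ 1 / 2 := min_le_left _ _
  have htσ : t ≤ σ ^ 2 / 8 := (min_le_right _ _).trans (min_le_left _ _)
  have htΔ : t ≤ Δ / (6 * M ^ 2) :=
    (min_le_right _ _).trans ((min_le_right _ _).trans (min_le_left _ _))
  have htρ : n * (t * M) ≤ ρ / 2 := by
    have h1 : t ≤ ρ / (2 * n * M) :=
      (min_le_right _ _).trans ((min_le_right _ _).trans (min_le_right _ _))
    rw [le_div_iff₀ (by positivity)] at h1
    linarith
  obtain ⟨T, hT1, hT2, hT3, hT⟩ := exists_rankOne_nilpotent (b.norm_eq_one i) (b.norm_eq_one k)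
    (b.orthonormal.2 hne.symm) ht0
  refine ⟨T, hT1, hT2, hT3.trans (by linarith), (ρ : ℂ), n * (t * M), fun w hw =>
    norm_le_of_mem_cNumericalRange C hT3 hCM hw, ?_, fun K _ _ _ U hU => ?_⟩
  · rw [Complex.norm_real, Real.norm_of_nonneg hρ0.le]
    linarith
  obtain ⟨hUu, hUT⟩ := hU
  obtain ⟨X, hX⟩ := isDilation_iff.1 hUT
  have hUn := norm_apply_of_mem_unitary hUu
  have hUi : ∀ x y, ⟪U x, U y⟫_ℂ = ⟪x, y⟫_ℂ := fun x y =>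
    ContinuousLinearMap.inner_map_map_of_mem_unitary hUu x y
  have hbb : ∀ j l, ⟪b j, b l⟫_ℂ = if j = l then 1 else 0 := orthonormal_iff_ite.1 b.orthonormal
  -- Either `ρ` lies in a disc obtained by rotation, or `U²` is nearly scalar.
  have hdich : ∀ v : EuclideanSpace ℂ (Fin n), ‖v‖ = 1 →
      (ρ : ℂ) ∈ cNumericalRange C U ∨ 1 - σ ^ 2 / 2 ≤ ‖⟪X v, U (U (X v))⟫_ℂ‖ := fun v hv => by
    refine (mem_cNumericalRange_or_le_norm_inner_sq hC hb hUu X hX hi hT3 (by linarith) hκ0 hM0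
      hCM hv (z := (ρ : ℂ)) ?_).imp_right fun h => le_trans ?_ h
    · rw [Complex.norm_real, Real.norm_of_nonneg hρ0.le]
      have : ρ ≤ perturbationRadius (‖c i‖ * κ) M / 2 := min_le_left _ _
      linarith
    · rw [hκ]
      linarith
  rcases hdich _ (b.norm_eq_one i) with h | hγi
  · exact h
  rcases hdich _ (b.norm_eq_one k) with h | hγk
  · exact h
  obtain ⟨hp, hm, hmp⟩ := orthonormal_pair_rotated (b.norm_eq_one i) (b.norm_eq_one k)
    (b.orthonormal.2 hne)
  rcases hdich _ hp with h | hγp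
  · exact h
  obtain ⟨e, he⟩ : ∃ e, e = X (b i) := ⟨_, rfl⟩
  obtain ⟨g, hg⟩ : ∃ g, g = X (b k) := ⟨_, rfl⟩
  have he1 : ‖e‖ = 1 := by rw [he, X.norm_map, b.norm_eq_one]
  have hg1 : ‖g‖ = 1 := by rw [hg, X.norm_map, b.norm_eq_one]
  have hee : ⟪e, e⟫_ℂ = 1 := by rw [inner_self_eq_ofReal_norm_sq, he1]; simp
  have hgg : ⟪g, g⟫_ℂ = 1 := by rw [inner_self_eq_ofReal_norm_sq, hg1]; simp
  have heg : ⟪e, g⟫_ℂ = 0 := by rw [he, hg, X.inner_map_map, b.orthonormal.2 hne]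
  have hge : ⟪g, e⟫_ℂ = 0 := inner_eq_zero_symm.1 heg
  have hUe : ∀ h, ⟪X h, U e⟫_ℂ = 0 := fun h => by
    rw [he, hX, hT, b.orthonormal.2 hne.symm]
    simp
  have hUg : ∀ h, ⟪X h, U g⟫_ℂ = t * ⟪h, b i⟫_ℂ := fun h => by
    rw [hg, hX, hT, hbb, if_pos rfl, mul_one, inner_smul_right]
  have heUe : ⟪e, U e⟫_ℂ = 0 := by
    have h := hUe (b i)
    rwa [← he] at h
  have hgUe : ⟪g, U e⟫_ℂ = 0 := by rw [hg]; exact hUe _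
  have heUg : ⟪e, U g⟫_ℂ = t := by rw [he, hUg, hbb, if_pos rfl, mul_one]
  have hgUg : ⟪g, U g⟫_ℂ = 0 := by
    have h := hUg (b k)
    rwa [← hg, hbb, if_neg hne.symm, mul_zero] at h
  rw [← he] at hγi
  rw [← hg] at hγk
  rw [map_smul, map_add, ← he, ← hg] at hγp
  have hUU1 : ∀ x : K, ‖x‖ = 1 → ‖U (U x)‖ = 1 := fun x hx => by rw [hUn, hUn, hx]
  have hge2 : ‖⟪g, U (U e)⟫_ℂ‖ ≤ σ :=
    norm_inner_le_of_le_norm_inner he1 hg1 heg (hUU1 e he1) hσ0.le hγi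
  have heg2 : ‖⟪e, U (U g)⟫_ℂ‖ ≤ σ :=
    norm_inner_le_of_le_norm_inner hg1 he1 hge (hUU1 g hg1) hσ0.le hγk
  obtain ⟨hp', hm', hmp'⟩ := orthonormal_pair_rotated he1 hg1 heg
  have hpm2 := norm_inner_le_of_le_norm_inner hp' hm' (inner_eq_zero_symm.1 hmp')
    (hUU1 _ hp') hσ0.le hγp
  obtain ⟨γ₁, hγ₁⟩ : ∃ γ, γ = ⟪e, U (U e)⟫_ℂ := ⟨_, rfl⟩
  obtain ⟨γ₂, hγ₂⟩ : ∃ γ, γ = ⟪g, U (U g)⟫_ℂ := ⟨_, rfl⟩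
  have hγ : ‖γ₁ - γ₂‖ ≤ 4 * σ := by
    have h1 : ⟪((√2)⁻¹ : ℂ) • (e - g), U (U (((√2)⁻¹ : ℂ) • (e + g)))⟫_ℂ =
        1 / 2 * (γ₁ - γ₂ + ⟪e, U (U g)⟫_ℂ - ⟪g, U (U e)⟫_ℂ) := by
      rw [← inv_sqrt_two_mul_self]
      simp only [map_smul, map_add, inner_smul_left, inner_smul_right, inner_sub_left,
        inner_add_right, map_inv₀, Complex.conj_ofReal, hγ₁, hγ₂]
      ring
    rw [h1, norm_mul] at hpm2
    norm_num at hpm2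
    have h2 : γ₁ - γ₂ = (γ₁ - γ₂ + ⟪e, U (U g)⟫_ℂ - ⟪g, U (U e)⟫_ℂ) - ⟪e, U (U g)⟫_ℂ +
      ⟪g, U (U e)⟫_ℂ := by ring
    rw [h2]
    refine (norm_add_le _ _).trans ?_
    have h3 := norm_sub_le (γ₁ - γ₂ + ⟪e, U (U g)⟫_ℂ - ⟪g, U (U e)⟫_ℂ) ⟪e, U (U g)⟫_ℂ
    linarith
  have htt : t ^ 2 ≤ 1 / 4 := by nlinarith
  obtain ⟨ν, hν⟩ : ∃ ν, ν = √(1 - t ^ 2) := ⟨_, rfl⟩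
  have hν2 : ν ^ 2 = 1 - t ^ 2 := by rw [hν, Real.sq_sqrt (by linarith)]
  have hν0 : 0 < ν := by rw [hν]; exact Real.sqrt_pos.2 (by linarith)
  have hν1 : ν ≤ 1 := by nlinarith
  have hνC : (ν : ℂ) ≠ 0 := by exact_mod_cast hν0.ne'
  have hν2C : (ν : ℂ) ^ 2 = 1 - (t : ℂ) ^ 2 := by exact_mod_cast hν2
  -- The component of `U g` orthogonal to `e`, normalized.
  obtain ⟨f, hf⟩ : ∃ f, f = ((ν⁻¹ : ℝ) : ℂ) • (U g - (t : ℂ) • e) := ⟨_, rfl⟩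
  have hUgUg : ⟪U g, U g⟫_ℂ = 1 := by rw [hUi, hgg]
  have hUgUe : ⟪U g, U e⟫_ℂ = 0 := by rw [hUi, hge]
  have hUeUg : ⟪U e, U g⟫_ℂ = 0 := by rw [hUi, heg]
  have hUge : ⟪U g, e⟫_ℂ = t := by rw [← inner_conj_symm, heUg, Complex.conj_ofReal]
  have hUee : ⟪U e, e⟫_ℂ = 0 := inner_eq_zero_symm.1 heUe
  have hff : ⟪f, f⟫_ℂ = 1 := by
    rw [hf]
    simp only [inner_smul_left, inner_smul_right, inner_sub_left, inner_sub_right, hUgUg, hUge,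
      heUg, hee, Complex.conj_ofReal]
    push_cast
    field_simp
    linear_combination -hν2C
  have hf1 : ‖f‖ = 1 := by
    rw [inner_self_eq_ofReal_norm_sq] at hff
    have : ‖f‖ ^ 2 = 1 := by exact_mod_cast hff
    exact (pow_eq_one_iff_of_nonneg (norm_nonneg f) two_ne_zero).1 this
  have hXf : ∀ h, ⟪X h, f⟫_ℂ = 0 := fun h => by
    rw [hf, inner_smul_right, inner_sub_right, hUg, inner_smul_right, he, X.inner_map_map, sub_self,
      mul_zero]
  have hgf : ⟪g, f⟫_ℂ = 0 := by rw [hg]; exact hXf _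
  have hef : ⟪e, f⟫_ℂ = 0 := by rw [he]; exact hXf _
  have hUef : ⟪U e, f⟫_ℂ = 0 := by
    rw [hf, inner_smul_right, inner_sub_right, hUeUg, inner_smul_right, hUee]
    simp
  have hgUf : ⟪g, U f⟫_ℂ = ((ν⁻¹ : ℝ) : ℂ) * γ₂ := by
    rw [hf, map_smul, map_sub, map_smul, inner_smul_right, inner_sub_right, inner_smul_right, hgUe,
      ← hγ₂, mul_zero, sub_zero]
  have hfUg : ⟪f, U g⟫_ℂ = ν := by
    rw [hf, inner_smul_left, inner_sub_left, inner_smul_left, hUgUg, heUg, Complex.conj_ofReal,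
      Complex.conj_ofReal]
    push_cast
    field_simp
    linear_combination -hν2C
  have hfUf : ‖⟪f, U f⟫_ℂ‖ ≤ 2 * t := by
    have h1 : ⟪f, U f⟫_ℂ = ((ν⁻¹ ^ 2 * -t : ℝ) : ℂ) * ⟪e, U (U g)⟫_ℂ := by
      rw [hf]
      simp only [map_smul, map_sub, inner_smul_left, inner_smul_right, inner_sub_left,
        inner_sub_right, hUi, hgUg, heUe, hge, Complex.conj_ofReal]
      push_cast
      ring
    have h2 : ‖⟪e, U (U g)⟫_ℂ‖ ≤ 1 := by
      simpa [he1, hUU1 g hg1] using norm_inner_le_norm (𝕜 := ℂ) e (U (U g))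
    rw [h1, norm_mul, Complex.norm_real, Real.norm_eq_abs, abs_mul, abs_neg, abs_of_pos ht0,
      abs_of_nonneg (by positivity)]
    have h3 : ν⁻¹ ^ 2 ≤ 2 := by
      rw [inv_pow, hν2]
      exact inv_le_of_inv_le₀ (by norm_num) (by linarith)
    calc _ ≤ 2 * t * 1 := by gcongr
      _ = 2 * t := mul_one _
  have : FiniteDimensional ℂ (Submodule.span ℂ {e, U e}) :=
    FiniteDimensional.span_of_finite ℂ (Set.toFinite _)
  have : FiniteDimensional ℂ (Submodule.span ℂ {g, f}) :=
    FiniteDimensional.span_of_finite ℂ (Set.toFinite _)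
  refine mem_cNumericalRange_of_forall_re_le hb U X (J := Finset.univ) (by simp)
    (Finset.mem_univ i) (Finset.mem_univ k) hne (Submodule.span ℂ {e, U e})
    (Submodule.span ℂ {g, f}) ?_ ?_ ?_ ?_ ?_
  · intro x hx
    refine inner_eq_zero_of_mem_span_pair ?_ ?_
    · exact inner_eq_zero_symm.1 (inner_eq_zero_of_mem_span_pair hge hgUe x hx)
    · exact inner_eq_zero_symm.1 (inner_eq_zero_of_mem_span_pair (inner_eq_zero_symm.1 hef)
        (inner_eq_zero_symm.1 hUef) x hx)
  · intro j _ hji hjk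
    refine inner_eq_zero_of_mem_span_pair ?_ (hUe _)
    rw [he, X.inner_map_map, b.orthonormal.2 hji]
  · intro j _ hji hjk
    refine inner_eq_zero_of_mem_span_pair ?_ (hXf _)
    rw [hg, X.inner_map_map, b.orthonormal.2 hjk]
  · intro j _ hji hjk
    rw [hX, hT, b.orthonormal.2 (Ne.symm hjk)]
    simp
  · intro ω hω
    have hs : (√2)⁻¹ ^ 2 = (1 / 2 : ℝ) := by rw [inv_pow, Real.sq_sqrt (by norm_num)]; norm_num
    have hs' : (√2)⁻¹ ^ 2 + (√2)⁻¹ ^ 2 = (1 : ℝ) := by rw [hs]; norm_num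
    have hs'' : (√2)⁻¹ * (√2)⁻¹ = (1 / 2 : ℝ) := by rw [← sq, hs]
    obtain ⟨y₁, hy₁, h₁⟩ := exists_re_mul_mem_numericalRangeOn U
      (Submodule.subset_span (by simp) : e ∈ Submodule.span ℂ {e, U e})
      (Submodule.subset_span (by simp) : U e ∈ Submodule.span ℂ {e, U e}) he1
      (by rw [hUn, he1]) heUe hs' (ω * c i)
    obtain ⟨y₂, hy₂, h₂⟩ := exists_re_mul_mem_numericalRangeOn U
      (Submodule.subset_span (by simp) : g ∈ Submodule.span ℂ {g, f})
      (Submodule.subset_span (by simp) : f ∈ Submodule.span ℂ {g, f}) hg1 hf1 hgf hs' (ω * c k)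
    refine ⟨y₁, hy₁, y₂, hy₂, ?_⟩
    rw [hs'', ← hγ₁, hUi, hUi, hee, heUe, mul_one, mul_zero, add_zero, mul_zero,
      Complex.zero_re, add_zero] at h₁
    rw [hs'', hgUg, hgUf, hfUg, mul_zero, zero_add] at h₂
    rw [mul_add, ← mul_assoc, ← mul_assoc, Complex.add_re, h₁, h₂]
    set p := ω * c i with hp_def
    set q := ω * c k with hq_def
    have hpM : ‖p‖ ≤ M := by rw [hp_def, norm_mul, hω, one_mul]; exact hcM i
    have hqM : ‖q‖ ≤ M := by rw [hq_def, norm_mul, hω, one_mul]; exact hcM k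
    have hpq : |(p * (starRingEnd ℂ) q).im| = Δ := by
      have : p * (starRingEnd ℂ) q = c i * (starRingEnd ℂ) (c k) := by
        have h3 : ω * (starRingEnd ℂ) ω = 1 := by rw [Complex.mul_conj', hω]; simp
        rw [hp_def, hq_def, map_mul]
        linear_combination (c i * (starRingEnd ℂ) (c k)) * h3
      rw [this]
    clear_value p q
    have hmain := two_mul_abs_im_div_le (γ := γ₁) hM0 hpM hqM
    rw [hpq] at hmain
    have hB := norm_sub_le_norm_of_sq_add_sq_eq_one hν0 hν1 hν2 hqM hγ
    have hτ : -(M * t) ≤ (q * (((√2)⁻¹ : ℝ) ^ 2 * ⟪f, U f⟫_ℂ)).re := by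
      refine neg_le_of_abs_le ((Complex.abs_re_le_norm _).trans ?_)
      rw [← Complex.ofReal_pow, hs, norm_mul, norm_mul, Complex.norm_real]
      norm_num
      calc ‖q‖ * (1 / 2 * ‖⟪f, U f⟫_ℂ‖) ≤ M * (1 / 2 * (2 * t)) := by gcongr
        _ = M * t := by ring
    have hωρ : (ω * ρ).re ≤ Δ / (2 * M) := by
      refine (Complex.re_le_norm _).trans ?_
      rw [norm_mul, hω, one_mul, Complex.norm_real, Real.norm_of_nonneg hρ0.le]
      exact min_le_right _ _
    have hMσ : M * (4 * σ) = Δ / (2 * M) := by rw [hσ]; field_simp; ring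
    have hMt : M * t ≤ Δ / (6 * M) := by
      calc M * t ≤ M * (Δ / (6 * M ^ 2)) := by gcongr
        _ = Δ / (6 * M) := by field_simp
    have hMt2 : M * t ^ 2 ≤ M * t := by
      gcongr
      nlinarith
    have e1 : Δ / (2 * M) = Δ / M / 2 := by field_simp
    have e2 : Δ / (6 * M) = Δ / M / 6 := by field_simp
    have e3 : 2 * Δ / M = 2 * (Δ / M) := by ring
    have hΔM : 0 < Δ / M := by positivity
    rw [e1] at hωρ hMσ
    rw [e2] at hMt
    rw [e3] at hmain
    linarith

end NonrealRatio

/-! ### Operators shifting an orthonormal triple -/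

section CyclicTriples

variable {K : Type*} [NormedAddCommGroup K] [InnerProductSpace ℂ K]

theorem inner_eq_zero_of_mem_span {s : Set K} {z : K} (h : ∀ x ∈ s, ⟪z, x⟫_ℂ = 0) :
    ∀ v ∈ Submodule.span ℂ s, ⟪z, v⟫_ℂ = 0 := by
  intro v hv
  induction hv using Submodule.span_induction with
  | mem x hx => exact h x hx
  | zero => exact inner_zero_right _
  | add x y _ _ hx hy => rw [inner_add_right, hx, hy, add_zero]
  | smul a x _ hx => rw [inner_smul_right, hx, mul_zero]

/-- Let `U` act on an orthonormal triple by `x ↦ y ↦ f`, with `U f ⊥ y, f`. The numerical range of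
its compression to the span contains the disc of radius `1 / 2`. If `U f` is not close to `-x`, it
also contains `1 / 2 + δ`. -/
theorem exists_re_mul_le_of_le_norm_one_add {U : K →L[ℂ] K} {x y f : K} (hx : ‖x‖ = 1)
    (hy : ‖y‖ = 1) (hf : ‖f‖ = 1) (hxy : ⟪x, y⟫_ℂ = 0) (hxf : ⟪x, f⟫_ℂ = 0) (hyf : ⟪y, f⟫_ℂ = 0)
    (hUx : U x = y) (hUy : U y = f) (hxUf : ‖⟪x, U f⟫_ℂ‖ ≤ 1)
    (hyUf : ⟪y, U f⟫_ℂ = 0) (hfUf : ⟪f, U f⟫_ℂ = 0) {κ δ : ℝ}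
    (hκ0 : 0 < κ) (hκ1 : κ ≤ 1) (hκ : κ ≤ ‖1 + ⟪x, U f⟫_ℂ‖) (hδ0 : 0 ≤ δ) (hδ : δ ≤ κ ^ 2 / 64)
    {ω : ℂ} (hω : ‖ω‖ = 1) :
    ∃ s ∈ numericalRangeOn U (Submodule.span ℂ {x, y, f}),
      ω.re * (1 / 2 + δ) ≤ (ω * s).re := by
  have hxN : x ∈ Submodule.span ℂ {x, y, f} := Submodule.subset_span (by simp)
  have hyN : y ∈ Submodule.span ℂ {x, y, f} := Submodule.subset_span (by simp)
  have hfN : f ∈ Submodule.span ℂ {x, y, f} := Submodule.subset_span (by simp)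
  have hyy : ⟪y, y⟫_ℂ = 1 := by rw [inner_self_eq_ofReal_norm_sq, hy]; simp
  have hff : ⟪f, f⟫_ℂ = 1 := by rw [inner_self_eq_ofReal_norm_sq, hf]; simp
  have hre : ω.re ≤ 1 := (Complex.re_le_norm ω).trans hω.le
  have hs2 : (√2)⁻¹ ^ 2 = (1 / 2 : ℝ) := by rw [inv_pow, Real.sq_sqrt (by norm_num)]; norm_num
  rcases le_or_gt ‖ω - 1‖ (κ / 4) with hnear | hfar
  · -- Tilt `(x + y) / √2`, where the form has the value `1 / 2`, towards `f`.
    obtain ⟨hp, -, -⟩ := orthonormal_pair_rotated hx hy hxy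
    set p := ((√2)⁻¹ : ℂ) • (x + y) with hp_def
    have hpN : p ∈ Submodule.span ℂ {x, y, f} :=
      Submodule.smul_mem _ _ (Submodule.add_mem _ hxN hyN)
    have hUp : U p = ((√2)⁻¹ : ℂ) • (y + f) := by rw [hp_def, map_smul, map_add, hUx, hUy]
    have hpf : ⟪p, f⟫_ℂ = 0 := by
      rw [hp_def, inner_smul_left, inner_add_left, hxf, hyf, add_zero, mul_zero]
    have hpUf : ⟪p, U f⟫_ℂ = ((√2)⁻¹ : ℂ) * ⟪x, U f⟫_ℂ := by
      rw [hp_def, inner_smul_left, inner_add_left, hyUf, add_zero, map_inv₀, Complex.conj_ofReal]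
    have hfUp : ⟪f, U p⟫_ℂ = ((√2)⁻¹ : ℂ) := by
      rw [hUp, inner_smul_right, inner_add_right, inner_eq_zero_symm.1 hyf, hff, zero_add, mul_one]
    have hpUp : ⟪p, U p⟫_ℂ = 1 / 2 := by
      rw [hUp, hp_def]
      simp only [inner_smul_left, inner_smul_right, inner_add_left, inner_add_right, hxy, hxf, hyy,
        hyf, map_inv₀, Complex.conj_ofReal]
      linear_combination inv_sqrt_two_mul_self
    clear_value p
    set β := κ / 4 with hβ
    set α := √(1 - β ^ 2) with hα
    have hβ2 : β ^ 2 ≤ 1 / 2 := by rw [hβ]; nlinarith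
    have hα2 : α ^ 2 = 1 - β ^ 2 := Real.sq_sqrt (by linarith)
    obtain ⟨s, hs, hsω⟩ := exists_re_mul_mem_numericalRangeOn U hpN hfN hp hf hpf (α := α) (β := β)
      (by linarith) ω
    refine ⟨s, hs, ?_⟩
    rw [hsω, hpUf, hfUp, hpUp, hfUf]
    have h1 : ω * (((√2)⁻¹ : ℂ) * ⟪x, U f⟫_ℂ) + (starRingEnd ℂ) (ω * ((√2)⁻¹ : ℂ)) =
        (((√2)⁻¹ : ℝ) : ℂ) * ((1 + ⟪x, U f⟫_ℂ) + ((ω - 1) * ⟪x, U f⟫_ℂ +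
          (starRingEnd ℂ) (ω - 1))) := by
      simp only [map_mul, map_inv₀, Complex.conj_ofReal, map_sub, map_one]
      push_cast
      ring
    have h2 : κ / 2 ≤ ‖(1 + ⟪x, U f⟫_ℂ) + ((ω - 1) * ⟪x, U f⟫_ℂ + (starRingEnd ℂ) (ω - 1))‖ := by
      have h3 : ‖(ω - 1) * ⟪x, U f⟫_ℂ + (starRingEnd ℂ) (ω - 1)‖ ≤ κ / 4 + κ / 4 := by
        refine (norm_add_le _ _).trans (add_le_add ?_ ?_)
        · rw [norm_mul]
          exact (mul_le_of_le_one_right (norm_nonneg _) hxUf).trans hnear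
        · rwa [RCLike.norm_conj]
      have h4 := norm_sub_le_norm_add (1 + ⟪x, U f⟫_ℂ)
        ((ω - 1) * ⟪x, U f⟫_ℂ + (starRingEnd ℂ) (ω - 1))
      linarith
    rw [h1, norm_mul, Complex.norm_real, Real.norm_of_nonneg (by positivity)]
    have hαs : (√2)⁻¹ ≤ α := by
      rw [← sq_le_sq₀ (by positivity) (by positivity), hs2, hα2]
      linarith
    have h3 : κ ^ 2 / 16 ≤ α * β * ((√2)⁻¹ * ‖(1 + ⟪x, U f⟫_ℂ) + ((ω - 1) * ⟪x, U f⟫_ℂ +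
        (starRingEnd ℂ) (ω - 1))‖) := by
      calc κ ^ 2 / 16 = (√2)⁻¹ ^ 2 * (β * (κ / 2)) := by rw [hs2, hβ]; ring
        _ = (√2)⁻¹ * β * ((√2)⁻¹ * (κ / 2)) := by ring
        _ ≤ _ := by gcongr
    have h4 : (ω * ((α : ℂ) ^ 2 * (1 / 2) + (β : ℂ) ^ 2 * 0)).re = ω.re * ((1 - β ^ 2) / 2) := by
      have : ω * ((α : ℂ) ^ 2 * (1 / 2) + (β : ℂ) ^ 2 * 0) = ω * (((1 - β ^ 2) / 2 : ℝ) : ℂ) := by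
        rw [← hα2]
        push_cast
        ring
      rw [this, mul_comm, Complex.re_ofReal_mul, mul_comm]
    rw [h4]
    have h5 : ω.re * (β ^ 2 / 2 + δ) ≤ 1 * (β ^ 2 / 2 + δ) := by gcongr
    have h6 : β ^ 2 = κ ^ 2 / 16 := by rw [hβ]; ring
    rw [h6] at h5 ⊢
    linarith
  · -- Away from the direction `1` the disc of radius `1 / 2` in the span of `x, y` suffices.
    obtain ⟨s, hs, hsω⟩ := exists_re_mul_mem_numericalRangeOn U hxN hyN hx hy hxy
      (α := (√2)⁻¹) (β := (√2)⁻¹) (by rw [hs2]; norm_num) ω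
    refine ⟨s, hs, ?_⟩
    rw [hsω, hUx, hUy, hxf, hxy, hyf, hyy, ← sq, hs2]
    simp only [mul_zero, mul_one, zero_add, add_zero, Complex.zero_re, RCLike.norm_conj, hω]
    have h1 : ‖ω - 1‖ ^ 2 = 2 - 2 * ω.re := by
      have h2 : ω.re * ω.re + ω.im * ω.im = 1 := by
        rw [← Complex.normSq_apply, Complex.normSq_eq_norm_sq, hω, one_pow]
      rw [← Complex.normSq_eq_norm_sq, Complex.normSq_apply]
      simp
      linarith
    have h2 : κ ^ 2 / 16 < 2 - 2 * ω.re := by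
      rw [← h1]
      nlinarith
    nlinarith

/-- Let `U` act on an orthonormal triple by `x ↦ y ↦ f`, with `U f ⊥ y, f` and `U f ≈ -x`. With `v =
(x - y - f) / √3`, the set `W + ε ⟨v, U v⟩`, where `W` is the numerical range of the compression to
the orthogonal complement of `v` in the span, contains `1 / 2 + δ`. Indeed, `W` has points near `1 /
2` and `± i / 4`, coming from `x + y` and `(x + y) ± i (x + f)`, and `⟨v, U v⟩ ≈ 1 / 3`. -/
theorem exists_re_mul_le_of_norm_one_add_le {U : K →L[ℂ] K} {x y f : K} (hx : ‖x‖ = 1)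
    (hy : ‖y‖ = 1) (hf : ‖f‖ = 1) (hxy : ⟪x, y⟫_ℂ = 0) (hxf : ⟪x, f⟫_ℂ = 0) (hyf : ⟪y, f⟫_ℂ = 0)
    (hUx : U x = y) (hUy : U y = f) (hyUf : ⟪y, U f⟫_ℂ = 0) (hfUf : ⟪f, U f⟫_ℂ = 0)
    (hγ : ‖1 + ⟪x, U f⟫_ℂ‖ ≤ 1 / 60) {δ ε : ℝ} (hε0 : 0 ≤ ε) (hε1 : ε ≤ 1) (hδ0 : 0 ≤ δ)
    (hδ : δ ≤ ε / 6) {ω : ℂ} (hω : ‖ω‖ = 1) :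
    ∃ s ∈ numericalRangeOn U (Submodule.span ℂ {x + y, x + f}),
      ω.re * (1 / 2 + δ) ≤ (ω * (s + ε * (-⟪x, U f⟫_ℂ / 3))).re := by
  have hxx : ⟪x, x⟫_ℂ = 1 := by rw [inner_self_eq_ofReal_norm_sq, hx]; simp
  have hyy : ⟪y, y⟫_ℂ = 1 := by rw [inner_self_eq_ofReal_norm_sq, hy]; simp
  have hff : ⟪f, f⟫_ℂ = 1 := by rw [inner_self_eq_ofReal_norm_sq, hf]; simp
  have hyx := inner_eq_zero_symm.1 hxy
  have hfx := inner_eq_zero_symm.1 hxf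
  have hfy := inner_eq_zero_symm.1 hyf
  have hpN : x + y ∈ Submodule.span ℂ {x + y, x + f} := Submodule.subset_span (by simp)
  have hqN : x + f ∈ Submodule.span ℂ {x + y, x + f} := Submodule.subset_span (by simp)
  obtain ⟨γ, hγ_def⟩ : ∃ γ, γ = ⟪x, U f⟫_ℂ := ⟨_, rfl⟩
  rw [← hγ_def] at hγ ⊢
  have hω2 : ω.re ^ 2 + ω.im ^ 2 = 1 := by
    rw [sq, sq, ← Complex.normSq_apply, Complex.normSq_eq_norm_sq, hω, one_pow]
  have hre := abs_le.1 ((Complex.abs_re_le_norm ω).trans hω.le)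
  have hωγ : |(ω * (1 + γ)).re| ≤ 1 / 60 := by
    refine (Complex.abs_re_le_norm _).trans ?_
    rwa [norm_mul, hω, one_mul]
  have hωγ' := abs_le.1 hωγ
  have h0 : ∀ s : ℂ, (ω * (s + ε * (-γ / 3))).re =
      (ω * s).re + ε / 3 * (ω.re - (ω * (1 + γ)).re) := fun s => by
    have : ω * (s + ε * (-γ / 3)) = ω * s + ((ε / 3 : ℝ) : ℂ) * (ω - ω * (1 + γ)) := by
      push_cast
      ring
    rw [this, Complex.add_re, Complex.re_ofReal_mul, Complex.sub_re]
  -- In directions close to `1` the point `1 / 2` of the range suffices; otherwise one of the points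
  -- `(1 + (1 ± i) γ) / 4 ≈ ∓ i / 4` does.
  rcases le_or_gt (1 / 10) ω.re with h1 | h1
  · refine ⟨1 / 2, ⟨((√2)⁻¹ : ℂ) • (x + y), Submodule.smul_mem _ _ hpN,
      (orthonormal_pair_rotated hx hy hxy).1, ?_⟩, ?_⟩
    · rw [map_smul, map_add, hUx, hUy]
      simp only [inner_smul_left, inner_smul_right, inner_add_left, inner_add_right, hxy, hxf, hyy,
        hyf, map_inv₀, Complex.conj_ofReal]
      linear_combination -inv_sqrt_two_mul_self
    · rw [h0]
      have h2 : (ω * (1 / 2)).re = ω.re * (1 / 2) := by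
        have : ω * (1 / 2) = ((1 / 2 : ℝ) : ℂ) * ω := by push_cast; ring
        rw [this, Complex.re_ofReal_mul, mul_comm]
      rw [h2]
      nlinarith
  · obtain ⟨r, hr2, hr⟩ : ∃ r : ℝ, r ^ 2 = 1 ∧ r * ω.im = |ω.im| := by
      rcases le_total 0 ω.im with h | h
      · exact ⟨1, by norm_num, by rw [abs_of_nonneg h, one_mul]⟩
      · exact ⟨-1, by norm_num, by rw [abs_of_nonpos h, neg_one_mul]⟩
    have hr2C : (r : ℂ) ^ 2 = 1 := by exact_mod_cast hr2
    have hI := Complex.I_sq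
    refine ⟨(1 + (1 + r * Complex.I) * γ) / 4, ⟨(1 / 2 : ℂ) • ((x + y) + (r * Complex.I) • (x + f)),
      Submodule.smul_mem _ _ (Submodule.add_mem _ hpN (Submodule.smul_mem _ _ hqN)), ?_, ?_⟩, ?_⟩
    · have h2 : ⟪(1 / 2 : ℂ) • ((x + y) + (r * Complex.I) • (x + f)),
          (1 / 2 : ℂ) • ((x + y) + (r * Complex.I) • (x + f))⟫_ℂ = 1 := by
        simp only [inner_smul_left, inner_smul_right, inner_add_left, inner_add_right, hxx, hyy,
          hff, hxy, hyx, hxf, hfx, hyf, hfy, map_mul, map_div₀, map_one, map_ofNat,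
          Complex.conj_ofReal, Complex.conj_I]
        linear_combination (-(1 / 2) * Complex.I ^ 2) * hr2C - (1 / 2) * hI
      rw [inner_self_eq_ofReal_norm_sq] at h2
      exact (pow_eq_one_iff_of_nonneg (norm_nonneg _) two_ne_zero).1 (by exact_mod_cast h2)
    · simp only [map_smul, map_add, hUx, hUy, inner_smul_left, inner_smul_right, inner_add_left,
        inner_add_right, hxy, hyy, hff, hxf, hyf, hfy, hyUf, hfUf, ← hγ_def, map_mul, map_div₀,
        map_one, map_ofNat, Complex.conj_ofReal, Complex.conj_I]
      linear_combination (1 / 4 * Complex.I ^ 2 * γ) * hr2C + (1 / 4) * γ * hI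
    · rw [h0]
      have h2 : (ω * ((1 + (1 + r * Complex.I) * γ) / 4)).re =
          (|ω.im| + (ω * (1 + γ)).re + ((r * Complex.I) * (ω * (1 + γ))).re) / 4 := by
        rw [← hr]
        simp
        ring
      have h3 : -(1 / 60) ≤ ((r * Complex.I) * (ω * (1 + γ))).re := by
        refine neg_le_of_abs_le ((Complex.abs_re_le_norm _).trans ?_)
        have hr1 : |r| = 1 :=
          (pow_eq_one_iff_of_nonneg (abs_nonneg r) two_ne_zero).1 (by rw [sq_abs, hr2])
        rw [norm_mul, norm_mul, Complex.norm_real, Complex.norm_I, Real.norm_eq_abs, hr1, norm_mul,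
          hω, one_mul, one_mul, one_mul]
        exact hγ
      rw [h2]
      have h4 : ω.im ^ 2 = |ω.im| ^ 2 := (sq_abs _).symm
      rw [h4] at hω2
      have h5 := abs_nonneg ω.im
      have h6 : |ω.im| ≤ 1 := by nlinarith [sq_nonneg ω.re]
      rcases le_or_gt ω.re 0 with h7 | h7
      · have h8 : 1 ≤ |ω.im| - ω.re := by nlinarith
        have h9 : ω.re * (1 / 2 + δ - ε / 3) ≤ ω.re * (1 / 6) := by
          exact mul_le_mul_of_nonpos_left (by linarith) h7
        nlinarith
      · have h8 : 9 / 10 ≤ |ω.im| := by nlinarith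
        have h9 : ω.re * (1 / 2 + δ - ε / 3) ≤ 1 / 10 * (1 / 2) := by
          have : ω.re * (1 / 2 + δ - ε / 3) ≤ ω.re * (1 / 2) := by
            exact mul_le_mul_of_nonneg_left (by linarith) h7.le
          linarith
        nlinarith

end CyclicTriples

/-! ### Singular semidefinite matrices -/

section SemidefiniteMatrices

variable {n : ℕ}

/-- A positive semidefinite matrix of rank at least two with nonzero kernel has a gap: at `T = u
v*`, with `u, v = (b i ± b k) / √2` built from the extreme eigenvectors, `W_C(T)` is contained in
the disc of radius `r i / 2`. A unitary dilation maps `X v ↦ X u ↦ f` with `f ⊥ ran X`; depending on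
whether `U f` is close to `-X v`, a vector of the span of this triple or a pair of such vectors, the
second one used for the eigenvalue `r l`, contributes a larger real number to `W_C(U)`. -/
theorem hasDilationGap_of_extreme_eq_zero {C : Matrix (Fin n) (Fin n) ℂ}
    {b : OrthonormalBasis (Fin n) ℂ (EuclideanSpace ℂ (Fin n))} {r : Fin n → ℝ}
    (hb : ∀ i, matrixOp C (b i) = (r i : ℂ) • b i) {i k l : Fin n} (hil : i ≠ l)
    (hr : ∀ j, 0 ≤ r j ∧ r j ≤ r i) (hk : r k = 0) (hl : 0 < r l) : HasDilationGap.{w} C := by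
  have hi : 0 < r i := hl.trans_le (hr l).2
  have hik : i ≠ k := by
    rintro rfl
    exact hi.ne' hk
  have hlk : l ≠ k := by
    rintro rfl
    exact hl.ne' hk
  obtain ⟨hu, hv, hvu⟩ := orthonormal_pair_rotated (b.norm_eq_one i) (b.norm_eq_one k)
    (b.orthonormal.2 hik)
  have hbu : ∀ j, j ≠ i → j ≠ k → ⟪b j, ((√2)⁻¹ : ℂ) • (b i + b k)⟫_ℂ = 0 := fun j h h' => by
    rw [inner_smul_right, inner_add_right, b.orthonormal.2 h, b.orthonormal.2 h', add_zero,
      mul_zero]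
  have hbv : ∀ j, j ≠ i → j ≠ k → ⟪b j, ((√2)⁻¹ : ℂ) • (b i - b k)⟫_ℂ = 0 := fun j h h' => by
    rw [inner_smul_right, inner_sub_right, b.orthonormal.2 h, b.orthonormal.2 h', sub_zero,
      mul_zero]
  set u := ((√2)⁻¹ : ℂ) • (b i + b k)
  set v := ((√2)⁻¹ : ℂ) • (b i - b k)
  clear_value u v
  obtain ⟨T, hT1, hT2, hT3, hT⟩ := exists_rankOne_nilpotent hu hv hvu one_pos
  have hTx : ∀ x, matrixOp T x = ⟪v, x⟫_ℂ • u := fun x => by rw [hT]; simp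
  set ε := r l / r i with hε
  have hε0 : 0 < ε := by positivity
  have hε1 : ε ≤ 1 := (div_le_one hi).2 (hr l).2
  set δ := min (ε / 6) ((1 / 60) ^ 2 / 64) with hδ
  have hδ0 : 0 < δ := by positivity
  refine ⟨T, hT1, hT2, hT3, ((r i * (1 / 2 + δ) : ℝ) : ℂ), (r i - 0) / 2, fun z hz =>
    norm_le_of_mem_cNumericalRange_rankOne hb hr hu hv hvu hTx hz, ?_, fun K _ _ _ U hU => ?_⟩
  · rw [Complex.norm_real, Real.norm_of_nonneg (by positivity)]
    nlinarith
  obtain ⟨hUu, hUT⟩ := hU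
  obtain ⟨X, hX⟩ := isDilation_iff.1 hUT
  have hUn := norm_apply_of_mem_unitary hUu
  have hUi : ∀ x y, ⟪U x, U y⟫_ℂ = ⟪x, y⟫_ℂ := fun x y =>
    ContinuousLinearMap.inner_map_map_of_mem_unitary hUu x y
  obtain ⟨x, hx⟩ : ∃ x, x = X v := ⟨_, rfl⟩
  obtain ⟨y, hy⟩ : ∃ y, y = X u := ⟨_, rfl⟩
  have hx1 : ‖x‖ = 1 := by rw [hx, X.norm_map, hv]
  have hy1 : ‖y‖ = 1 := by rw [hy, X.norm_map, hu]
  have hxy : ⟪x, y⟫_ℂ = 0 := by rw [hx, hy, X.inner_map_map, hvu]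
  -- As `⟨y, U x⟩ = 1`, the equality case of the Cauchy-Schwarz inequality applies.
  have hUx : U x = y := by
    have h1 : ⟪y, U x⟫_ℂ = 1 := by
      rw [hx, hy, hX, hTx, inner_smul_right, inner_self_eq_ofReal_norm_sq,
        inner_self_eq_ofReal_norm_sq, hu, hv]
      simp
    exact ((inner_eq_one_iff_of_norm_eq_one hy1 (by rw [hUn, hx1])).1 h1).symm
  obtain ⟨f, hf⟩ : ∃ f, f = U y := ⟨_, rfl⟩
  have hf1 : ‖f‖ = 1 := by rw [hf, hUn, hy1]
  have hXf : ∀ h, ⟪X h, f⟫_ℂ = 0 := fun h => by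
    rw [hf, hy, hX, hTx, hvu]
    simp
  have hxf : ⟪x, f⟫_ℂ = 0 := by rw [hx]; exact hXf _
  have hyf : ⟪y, f⟫_ℂ = 0 := by rw [hy]; exact hXf _
  have hyUf : ⟪y, U f⟫_ℂ = 0 := by rw [← hUx, hUi, hxf]
  have hfUf : ⟪f, U f⟫_ℂ = 0 := by
    rw [← hyf, ← hUi y f, ← hf]
  have hxUf : ‖⟪x, U f⟫_ℂ‖ ≤ 1 := by
    simpa [hx1, hUn, hf1] using norm_inner_le_norm (𝕜 := ℂ) x (U f)
  have hXx : ∀ j, j ≠ i → j ≠ k → ⟪X (b j), x⟫_ℂ = 0 := fun j h h' => by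
    rw [hx, X.inner_map_map, hbv j h h']
  have hXy : ∀ j, j ≠ i → j ≠ k → ⟪X (b j), y⟫_ℂ = 0 := fun j h h' => by
    rw [hy, X.inner_map_map, hbu j h h']
  have hXU : ∀ j, j ≠ i → j ≠ k → ⟪X (b j), U (X (b j))⟫_ℂ = 0 := fun j h h' => by
    rw [hX, hTx, inner_smul_right, hbu j h h', mul_zero]
  have hmem : ∀ j : Fin n, j ≠ k → j ∈ Finset.univ.erase k := fun j hj => by simp [hj]
  have hmem' : ∀ j : Fin n, j ∈ Finset.univ.erase k → j ≠ k := fun j hj => by simpa using hj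
  have hJ : ∀ j : Fin n, j ∉ Finset.univ.erase k → (r j : ℂ) = 0 := fun j hj => by
    have : j = k := by simpa using hj
    rw [this, hk, Complex.ofReal_zero]
  have hωz : ∀ ω : ℂ, (ω * ((r i * (1 / 2 + δ) : ℝ) : ℂ)).re = r i * (ω.re * (1 / 2 + δ)) :=
    fun ω => by
      rw [mul_comm, Complex.re_ofReal_mul]
      ring
  rcases le_total (1 / 60) ‖1 + ⟪x, U f⟫_ℂ‖ with hγ | hγ
  · have : FiniteDimensional ℂ (Submodule.span ℂ {x, y, f}) :=
      FiniteDimensional.span_of_finite ℂ (Set.toFinite _)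
    refine mem_cNumericalRange_of_forall_re_le hb U X hJ (hmem i hik) (hmem l hlk) hil
      (Submodule.span ℂ {x, y, f}) (Submodule.span ℂ {X (b l)}) ?_ ?_ ?_ ?_ ?_
    · intro a ha
      refine inner_eq_zero_of_mem_span ?_
      rintro _ rfl
      rw [inner_eq_zero_symm]
      refine inner_eq_zero_of_mem_span ?_ a ha
      rintro _ (rfl | rfl | rfl)
      exacts [hXx l hil.symm hlk, hXy l hil.symm hlk, hXf _]
    · intro j hj hji hjl
      refine inner_eq_zero_of_mem_span ?_
      rintro _ (rfl | rfl | rfl)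
      exacts [hXx j hji (hmem' j hj), hXy j hji (hmem' j hj), hXf _]
    · intro j hj hji hjl
      refine inner_eq_zero_of_mem_span ?_
      rintro _ rfl
      rw [X.inner_map_map, b.orthonormal.2 hjl]
    · exact fun j hj hji _ => hXU j hji (hmem' j hj)
    · intro ω hω
      obtain ⟨s, hs, hsω⟩ := exists_re_mul_le_of_le_norm_one_add hx1 hy1 hf1 hxy hxf hyf hUx hf.symm
        hxUf hyUf hfUf (by norm_num) (by norm_num) hγ hδ0.le (min_le_right _ _) hω
      refine ⟨s, hs, _, ⟨X (b l), Submodule.mem_span_singleton_self _,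
        by rw [X.norm_map, b.norm_eq_one], rfl⟩, ?_⟩
      have h1 : ω * ((r i : ℂ) * s) = (r i : ℂ) * (ω * s) := by ring
      rw [hXU l hil.symm hlk, mul_zero, add_zero, hωz, h1, Complex.re_ofReal_mul]
      gcongr
  · obtain ⟨q, hq⟩ : ∃ q, q = ((√3)⁻¹ : ℂ) • (x - y - f) := ⟨_, rfl⟩
    have hs3 : ((√3)⁻¹ : ℂ) * ((√3)⁻¹ : ℂ) = 1 / 3 := by
      rw [← mul_inv, ← Complex.ofReal_mul, Real.mul_self_sqrt (by norm_num)]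
      norm_num
    have hxx : ⟪x, x⟫_ℂ = 1 := by rw [inner_self_eq_ofReal_norm_sq, hx1]; simp
    have hyy : ⟪y, y⟫_ℂ = 1 := by rw [inner_self_eq_ofReal_norm_sq, hy1]; simp
    have hff : ⟪f, f⟫_ℂ = 1 := by rw [inner_self_eq_ofReal_norm_sq, hf1]; simp
    have hyx := inner_eq_zero_symm.1 hxy
    have hfx := inner_eq_zero_symm.1 hxf
    have hfy := inner_eq_zero_symm.1 hyf
    have hq1 : ‖q‖ = 1 := by
      have h2 : ⟪q, q⟫_ℂ = 1 := by
        rw [hq]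
        simp only [inner_smul_left, inner_smul_right, inner_sub_left, inner_sub_right, hxx, hyy,
          hff, hxy, hyx, hxf, hfx, hyf, hfy, map_inv₀, Complex.conj_ofReal]
        linear_combination 3 * hs3
      rw [inner_self_eq_ofReal_norm_sq] at h2
      exact (pow_eq_one_iff_of_nonneg (norm_nonneg _) two_ne_zero).1 (by exact_mod_cast h2)
    have hqUq : ⟪q, U q⟫_ℂ = -⟪x, U f⟫_ℂ / 3 := by
      rw [hq]
      simp only [map_smul, map_sub, hUx, ← hf, inner_smul_left, inner_smul_right, inner_sub_left,
        inner_sub_right, hyy, hff, hxy, hxf, hyf, hfy, hyUf, hfUf, map_inv₀, Complex.conj_ofReal]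
      linear_combination (-⟪x, U f⟫_ℂ) * hs3
    have : FiniteDimensional ℂ (Submodule.span ℂ {x + y, x + f}) :=
      FiniteDimensional.span_of_finite ℂ (Set.toFinite _)
    refine mem_cNumericalRange_of_forall_re_le hb U X hJ (hmem i hik) (hmem l hlk) hil
      (Submodule.span ℂ {x + y, x + f}) (Submodule.span ℂ {q}) ?_ ?_ ?_ ?_ ?_
    · intro a ha
      refine inner_eq_zero_of_mem_span ?_
      rintro _ rfl
      rw [inner_eq_zero_symm]
      refine inner_eq_zero_of_mem_span ?_ a ha
      rintro _ (rfl | rfl) <;> rw [hq] <;>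
        simp [hx1, hy1, hf1, hxy, hyx, hxf, hfx,
          hyf, hfy]
    · intro j hj hji hjl
      refine inner_eq_zero_of_mem_span ?_
      rintro _ (rfl | rfl) <;>
        rw [inner_add_right, hXx j hji (hmem' j hj)]
      · rw [hXy j hji (hmem' j hj), add_zero]
      · rw [hXf, add_zero]
    · intro j hj hji hjl
      refine inner_eq_zero_of_mem_span ?_
      rintro _ rfl
      rw [hq, inner_smul_right, inner_sub_right, inner_sub_right, hXx j hji (hmem' j hj),
        hXy j hji (hmem' j hj), hXf]
      simp
    · exact fun j hj hji _ => hXU j hji (hmem' j hj)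
    · intro ω hω
      obtain ⟨s, hs, hsω⟩ := exists_re_mul_le_of_norm_one_add_le hx1 hy1 hf1 hxy hxf hyf hUx hf.symm
        hyUf hfUf hγ hε0.le hε1 hδ0.le (min_le_left _ _) hω
      refine ⟨s, hs, _, ⟨q, Submodule.mem_span_singleton_self _, hq1, rfl⟩, ?_⟩
      have h1 : ω * ((r i : ℂ) * s + r l * (-⟪x, U f⟫_ℂ / 3)) =
          (r i : ℂ) * (ω * (s + (ε : ℂ) * (-⟪x, U f⟫_ℂ / 3))) := by
        have hi' : (r i : ℂ) ≠ 0 := by exact_mod_cast hi.ne'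
        rw [hε]
        push_cast
        field_simp
      rw [hqUq, hωz, h1, Complex.re_ofReal_mul]
      gcongr

end SemidefiniteMatrices

/-! ### Existence of gaps and the dilation formulas -/

section Classification

variable {n : ℕ}

theorem HasDilationGap.of_smul {C : Matrix (Fin n) (Fin n) ℂ} {ω : ℂ} (hω : ω ≠ 0)
    (h : HasDilationGap.{w} (ω • C)) : HasDilationGap.{w} C := by
  obtain ⟨T, hT1, hT2, hT3, z, R, hR, hzR, hz⟩ := h
  have hω' : 0 < ‖ω‖ := norm_pos_iff.2 hω
  refine ⟨T, hT1, hT2, hT3, ω⁻¹ * z, ‖ω‖⁻¹ * R, ?_, ?_, fun K _ _ _ U hU => ?_⟩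
  · rintro _ ⟨Y, hY, rfl⟩
    have h1 := hR _ ⟨Y, hY, rfl⟩
    rw [Matrix.smul_mul, Matrix.trace_smul, smul_eq_mul, norm_mul] at h1
    rwa [le_inv_mul_iff₀ hω']
  · rw [norm_mul, norm_inv]
    gcongr
  · obtain ⟨Y, hY, rfl⟩ := hz K U hU
    refine ⟨Y, hY, ?_⟩
    rw [Matrix.smul_mul, Matrix.trace_smul, smul_eq_mul, inv_mul_cancel_left₀ hω]

theorem matrixOp_smul (a : ℂ) (A : Matrix (Fin n) (Fin n) ℂ) :
    matrixOp (a • A) = a • matrixOp A := by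
  simp [matrixOp]

/-- The case of smallest eigenvalue zero: one of `i`, `j` differs from the index `m` of the largest
eigenvalue. -/
theorem hasDilationGap_of_min_eq_zero {C : Matrix (Fin n) (Fin n) ℂ}
    {b : OrthonormalBasis (Fin n) ℂ (EuclideanSpace ℂ (Fin n))} {r : Fin n → ℝ}
    (hb : ∀ i, matrixOp C (b i) = (r i : ℂ) • b i) {i j : Fin n} (hij : i ≠ j) (hi : r i ≠ 0)
    (hj : r j ≠ 0) {m k : Fin n} (hm : ∀ l, r l ≤ r m) (hk : ∀ l, r k ≤ r l) (hk0 : r k = 0) :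
    HasDilationGap.{w} C := by
  have hr : ∀ l, 0 ≤ r l ∧ r l ≤ r m := fun l => ⟨hk0 ▸ hk l, hm l⟩
  by_cases hmi : m = i
  · exact hasDilationGap_of_extreme_eq_zero hb (l := j) (hmi ▸ hij) hr hk0
      (lt_of_le_of_ne (hr j).1 hj.symm)
  · exact hasDilationGap_of_extreme_eq_zero hb (l := i) hmi hr hk0
      (lt_of_le_of_ne (hr i).1 hi.symm)

theorem hasDilationGap_of_real_eigenvalues {C : Matrix (Fin n) (Fin n) ℂ}
    {b : OrthonormalBasis (Fin n) ℂ (EuclideanSpace ℂ (Fin n))} {r : Fin n → ℝ}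
    (hb : ∀ i, matrixOp C (b i) = (r i : ℂ) • b i) {i j : Fin n} (hij : i ≠ j) (hi : r i ≠ 0)
    (hj : r j ≠ 0) : HasDilationGap.{w} C := by
  have : Nonempty (Fin n) := ⟨i⟩
  obtain ⟨m, hm⟩ := Finite.exists_max r
  obtain ⟨k, hk⟩ := Finite.exists_min r
  by_cases hk0 : r k = 0
  · exact hasDilationGap_of_min_eq_zero hb hij hi hj hm hk hk0
  by_cases hm0 : r m = 0
  · refine HasDilationGap.of_smul (ω := -1) (by simp) (hasDilationGap_of_min_eq_zero (b := b)
      (r := fun l => -r l) (fun l => ?_) hij (neg_ne_zero.2 hi) (neg_ne_zero.2 hj)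
      (fun l => neg_le_neg (hk l)) (fun l => neg_le_neg (hm l)) (neg_eq_zero.2 hm0))
    rw [matrixOp_smul, smul_apply, hb, smul_smul]
    push_cast
    ring_nf
  by_cases hmk : m = k
  · -- All eigenvalues are equal, so that any two indices are extreme.
    have hc : ∀ l, r l = r i := fun l =>
      le_antisymm ((hm l).trans (hmk ▸ hk i)) ((hm i).trans (hmk ▸ hk l))
    exact hasDilationGap_of_extreme_ne_zero hb hij (fun l => by rw [hc l, hc j]; simp) hi hj
  · exact hasDilationGap_of_extreme_ne_zero hb hmk (fun l => ⟨hk l, hm l⟩) hm0 hk0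

/-- Every nonzero matrix that is not rank-one normal has a gap. -/
theorem hasDilationGap_of_ne_rankOne_normal {C : Matrix (Fin n) (Fin n) ℂ} (hn : 2 ≤ n)
    (hC0 : C ≠ 0) (h : ¬ (C.rank = 1 ∧ IsStarNormal C)) : HasDilationGap.{w} C := by
  by_cases hC : IsStarNormal C
  swap
  · exact hasDilationGap_of_not_isStarNormal hn hC
  obtain ⟨b, c, hb⟩ := exists_orthonormalBasis_eigenvectors hC
  obtain ⟨i, hi⟩ : ∃ i, c i ≠ 0 := by
    by_contra! hc
    refine hC0 ((Matrix.toEuclideanCLM (𝕜 := ℂ) (n := Fin n)).injective ?_)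
    rw [map_zero]
    ext1 x
    change matrixOp C x = 0
    simp [matrixOp_apply_of_diagonal hb, hc]
  obtain ⟨j, hji, hj⟩ : ∃ j, j ≠ i ∧ c j ≠ 0 := by
    by_contra! hc
    exact h ⟨(rank_eq_one_iff_of_diagonal hb).2 ⟨i, hi, hc⟩, hC⟩
  by_cases him : ∃ l m, (c l * (starRingEnd ℂ) (c m)).im ≠ 0
  · obtain ⟨l, m, hlm⟩ := him
    exact hasDilationGap_of_im_ne_zero hC hb hlm
  · -- All eigenvalues are real multiples of `c i`, and the factor `conj (c i)` makes them real.
    push Not at him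
    have hr : ∀ l, (starRingEnd ℂ) (c i) * c l = (((c l * (starRingEnd ℂ) (c i)).re : ℝ) : ℂ) :=
      fun l => by
        apply Complex.ext
        · rw [Complex.ofReal_re, mul_comm]
        · rw [Complex.ofReal_im, mul_comm, him]
    have hne : ∀ l, c l ≠ 0 → (c l * (starRingEnd ℂ) (c i)).re ≠ 0 := fun l hl h0 => by
      have h1 := hr l
      rw [h0, Complex.ofReal_zero] at h1
      exact mul_ne_zero (by simpa using hi) hl h1
    refine HasDilationGap.of_smul (ω := (starRingEnd ℂ) (c i)) (by simpa using hi)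
      (hasDilationGap_of_real_eigenvalues (b := b)
      (r := fun l => (c l * (starRingEnd ℂ) (c i)).re) (fun l => ?_) hji.symm (hne i hi) (hne j hj))
    rw [matrixOp_smul, smul_apply, hb, smul_smul, hr]

/-- A matrix with a gap violates the dilation formula for closed `C`-numerical ranges, in every
universe. -/
theorem HasDilationGap.exists_closure_ne {C : Matrix (Fin n) (Fin n) ℂ}
    (h : HasDilationGap.{u} C) :
    ∃ (H : Type u) (_ : NormedAddCommGroup H) (_ : InnerProductSpace ℂ H) (_ : CompleteSpace H)
      (T : H →L[ℂ] H), (n : Cardinal.{u}) ≤ Module.rank ℂ H ∧ ‖T‖ ≤ 1 ∧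
        closure (cNumericalRange C T) ≠
          {z : ℂ | ∀ (K : Type u) [NormedAddCommGroup K] [InnerProductSpace ℂ K]
            [CompleteSpace K] (U : K →L[ℂ] K), IsUnitaryDilation U T →
            z ∈ closure (cNumericalRange C U)} := by
  obtain ⟨T, -, -, hT, z, R, hR, hzR, hz⟩ := h
  let e : EuclideanSpace ℂ (Fin n) ≃ₗᵢ[ℂ] EuclideanSpace ℂ (ULift.{u} (Fin n)) :=
    LinearIsometryEquiv.piLpCongrLeft 2 ℂ ℂ Equiv.ulift.symm
  let T' : EuclideanSpace ℂ (ULift.{u} (Fin n)) →L[ℂ] EuclideanSpace ℂ (ULift.{u} (Fin n)) :=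
    e.toContinuousLinearEquiv.toContinuousLinearMap ∘L matrixOp T ∘L
      e.symm.toContinuousLinearEquiv.toContinuousLinearMap
  have hT'x : ∀ x, T' x = e (matrixOp T (e.symm x)) := fun _ => rfl
  have hd : IsDilation T' (matrixOp T) := isDilation_iff.2
    ⟨e.toLinearIsometry, fun x y => by simp [hT'x]⟩
  have hd' : IsDilation (matrixOp T) T' := isDilation_iff.2
    ⟨e.symm.toLinearIsometry, fun x y => by
      simp only [LinearIsometryEquiv.coe_toLinearIsometry, hT'x]
      rw [← e.inner_map_map, e.apply_symm_apply]⟩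
  refine ⟨_, inferInstance, inferInstance, inferInstance, T', ?_, ?_, fun heq => ?_⟩
  · refine natCast_le_rank_of_linearIsometry e.toLinearIsometry
  · refine T'.opNorm_le_bound zero_le_one fun x => ?_
    rw [hT'x, e.norm_map, one_mul]
    simpa using (matrixOp T).le_of_opNorm_le hT (e.symm x)
  · have hzT : z ∈ closure (cNumericalRange C T') := by
      rw [heq]
      exact fun K _ _ _ U hU => subset_closure (hz K U ⟨hU.1, hU.2.trans hd⟩)
    have hsub : closure (cNumericalRange C T') ⊆ Metric.closedBall 0 R :=
      closure_minimal (fun s hs => by simpa using hR s (cNumericalRange_mono C hd' hs))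
        Metric.isClosed_closedBall
    have := hsub hzT
    rw [mem_closedBall_zero_iff] at this
    exact absurd this (not_le.2 hzR)

/-- The dilation formula without closures for an operator on `ℂⁿ`, where the numerical range is
compact. -/
theorem cNumericalRange_eq_of_diagonal {C T : Matrix (Fin n) (Fin n) ℂ} (hn : n ≠ 0)
    {b : OrthonormalBasis (Fin n) ℂ (EuclideanSpace ℂ (Fin n))} {c : Fin n → ℂ}
    (hb : ∀ i, matrixOp C (b i) = c i • b i) {i₀ : Fin n} (hc : ∀ j, j ≠ i₀ → c j = 0)
    (h0 : c i₀ ≠ 0) (hT : ‖matrixOp T‖ ≤ 1) :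
    cNumericalRange C (matrixOp T) =
      {z : ℂ | ∀ (K : Type) [NormedAddCommGroup K] [InnerProductSpace ℂ K]
        [CompleteSpace K] (U : K →L[ℂ] K), IsUnitaryDilation U (matrixOp T) →
        z ∈ cNumericalRange C U} := by
  have hH : (n : Cardinal) ≤ Module.rank ℂ (EuclideanSpace ℂ (Fin n)) := by
    rw [rank_eq_card_basis (EuclideanSpace.basisFun (Fin n) ℂ).toBasis, Fintype.card_fin]
  have hclosed : IsClosed (cNumericalRange C (matrixOp T)) := by
    rw [cNumericalRange_eq_smul (matrixOp T) hb hc hH]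
    exact ((isCompact_numericalRangeOn (matrixOp T) ⊤).smul (c i₀)).isClosed
  refine Set.Subset.antisymm (fun z hz K _ _ _ U hU => cNumericalRange_mono C hU.2 hz)
    fun z hz => ?_
  rw [← hclosed.closure_eq, closure_cNumericalRange_eq hn hb hc h0 (matrixOp T) hH hT]
  exact fun K _ _ _ U hU => subset_closure (hz K U hU)

end Classification

theorem theorem1p1 (n : ℕ) (hn : 2 ≤ n) (C : Matrix (Fin n) (Fin n) ℂ) (hC : C ≠ 0) :
    List.TFAE [
      C.rank = 1 ∧ IsStarNormal C,
      ∀ (H : Type u) [NormedAddCommGroup H] [InnerProductSpace ℂ H] [CompleteSpace H]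
        (T : H →L[ℂ] H), (n : Cardinal.{u}) ≤ Module.rank ℂ H → ‖T‖ ≤ 1 →
        closure (cNumericalRange C T) =
          {z : ℂ | ∀ (K : Type u) [NormedAddCommGroup K] [InnerProductSpace ℂ K]
            [CompleteSpace K] (U : K →L[ℂ] K), IsUnitaryDilation U T →
            z ∈ closure (cNumericalRange C U)},
      ∀ T : Matrix (Fin n) (Fin n) ℂ, T.rank = 1 → IsNilpotent T → ‖matrixOp T‖ ≤ 1 →
        cNumericalRange C (matrixOp T) =
          {z : ℂ | ∀ (K : Type) [NormedAddCommGroup K] [InnerProductSpace ℂ K]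
            [CompleteSpace K] (U : K →L[ℂ] K), IsUnitaryDilation U (matrixOp T) →
            z ∈ cNumericalRange C U}] := by
  have hn0 : n ≠ 0 := by omega
  tfae_have 1 → 2 := by
    rintro ⟨h1, h2⟩ H _ _ _ T hH hT
    obtain ⟨b, c, hb⟩ := exists_orthonormalBasis_eigenvectors h2
    obtain ⟨i₀, hi₀, hc⟩ := (rank_eq_one_iff_of_diagonal hb).1 h1
    exact closure_cNumericalRange_eq hn0 hb hc hi₀ T hH hT
  tfae_have 1 → 3 := by
    rintro ⟨h1, h2⟩ T - - hT
    obtain ⟨b, c, hb⟩ := exists_orthonormalBasis_eigenvectors h2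
    obtain ⟨i₀, hi₀, hc⟩ := (rank_eq_one_iff_of_diagonal hb).1 h1
    exact cNumericalRange_eq_of_diagonal hn0 hb hc hi₀ hT
  tfae_have 2 → 1 := by
    intro h
    by_contra hna
    obtain ⟨H, _, _, _, T, hH, hT, hne⟩ :=
      (hasDilationGap_of_ne_rankOne_normal.{u} hn hC hna).exists_closure_ne
    exact hne (h H T hH hT)
  tfae_have 3 → 1 := by
    intro h
    by_contra hna
    obtain ⟨T, hT1, hT2, hT3, z, R, hR, hzR, hz⟩ :=
      hasDilationGap_of_ne_rankOne_normal.{0} hn hC hna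
    have hzT : z ∈ cNumericalRange C (matrixOp T) := by
      rw [h T hT1 hT2 hT3]
      exact hz
    exact absurd (hR z hzT) (not_le.2 hzR)
  tfae_finish
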